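/- Let $h>0$ and let $X=(X_t)_{t\ge 0}$ be an upwards skip-free Lévy chain on a probability space $(\Omega,\mathcal F,\mathsf P)$, i.e. a Lévy process with càdlàg paths which is compound Poisson with a nonzero finite Lévy measure $\lambda$, $\lambda(\{0\})=0$, $\mathsf E[e^{iuX_t}]=\exp\{t\int(e^{iux}-1)\lambda(dx)\}$, such that $\mathrm{supp}(\lambda)\subset h\mathbb Z$ and $\mathrm{supp}(\lambda|_{\mathcal B((0,\infty))})=\{h\}$. For $\beta\in\overline{\mathbb C^{\rightarrow}}:=\{z\in\mathbb C:\Re z\ge 0\}$ let $\psi(\beta):=\int_{\mathbb R}(e^{\beta x}-1)\lambda(dx)$; let $\Phi(0)$ be the largest root of $\psi|_{[0,\infty)}$ and $\Phi:[0,\infty)\to[\Phi(0),\infty)$ the inverse of the bijection $\psi:[\Phi(0),\infty)\to[0,\infty)$. For $t\ge 0$ let $\overline X_t:=\sup_{s\in[0,t]}X_s$, $\underline X_t:=\inf_{s\in[0,t]}X_s$, $\overline G^*_t:=\inf\{s\in[0,t]:X_s=\overline X_t\}$ and $\underline G_t:=\sup\{s\in[0,t]:X_s=\underline X_s\}$.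 For $\alpha\in\mathbb C$ with $\Re\alpha>0$ and $\beta\in\overline{\mathbb C^{\rightarrow}}$ the strict ascending and the descending ladder exponents are $$\kappa^*(\alpha,\beta):=c^*\exp\left(\int_0^\infty\int_{(0,\infty)}\frac{e^{-t}-e^{-\alpha t-\beta x}}{t}\,\mathsf P(X_t\in dx)\,dt\right),$$ $$\hat\kappa(\alpha,\beta):=\hat c\exp\left(\int_0^\infty\int_{(-\infty,0]}\frac{e^{-t}-e^{-\alpha t+\beta x}}{t}\,\mathsf P(X_t\in dx)\,dt\right),$$ where $c^*,\hat c>0$ are arbitrary fixed normalising constants. **Theorem (Wiener–Hopf factorization for upwards skip-free Lévy chains).** (i) Let $e_1$ be an exponential random variable of mean one, independent of $X$, let $p>0$ and $e_p:=e_1/p$. For every $\alpha\ge 0$ and $\beta\in\overline{\mathbb C^{\rightarrow}}$ (the expectations being absolutely convergent) $$\mathsf E[\exp\{-\alpha\overline G^*_{e_p}-\beta\overline X_{e_p}\}]=\frac{1-e^{-\Phi(p)h}}{1-e^{-(\beta+\Phi(p+\alpha))h}},$$ $$\mathsf E[\exp\{-\alpha\underline G_{e_p}+\beta\underline X_{e_p}\}]=\frac{p}{p+\alpha-\psi(\beta)}\,\frac{1-e^{(\beta-\Phi(p+\alpha))h}}{1-e^{-\Phi(p)h}},$$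 the latter whenever $p+\alpha\ne\psi(\beta)$. The number $\beta_0=\Phi(p+\alpha)$ is the unique $\beta_0>0$ such that $\psi(\beta_0)=p+\alpha$; $\psi$ is differentiable at $\beta_0$ with $\psi'(\beta_0)>0$, $\Phi$ is differentiable at $p+\alpha$, and $$\mathsf E[\exp\{-\alpha\underline G_{e_p}+\beta_0\underline X_{e_p}\}]=\frac{ph}{\psi'(\beta_0)(1-e^{-\Phi(p)h})}=\frac{ph\,\Phi'(p+\alpha)}{1-e^{-\Phi(p)h}}.$$ (ii) There are constants $k^*,\hat k\in(0,\infty)$ (depending on neither $\alpha$ nor $\beta$) such that for every $\alpha>0$ and $\beta\in\overline{\mathbb C^{\rightarrow}}$ (the outer integrals over $t$ defining $\kappa^*$ and $\hat\kappa$ being absolutely convergent) $$\kappa^*(\alpha,\beta)=k^*\bigl(1-e^{-(\beta+\Phi(\alpha))h}\bigr),\qquad \hat\kappa(\alpha,\beta)=\hat k\,\frac{\alpha-\psi(\beta)}{1-e^{(\beta-\Phi(\alpha))h}},$$ the latter whenever $\alpha\ne\psi(\beta)$. The number $\beta_0=\Phi(\alpha)$ is the unique $\beta_0>0$ such that $\psi(\beta_0)=\alpha$;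 $\psi$ is differentiable at $\beta_0$ with $\psi'(\beta_0)>0$, $\Phi$ is differentiable at $\alpha$, and $$\hat\kappa(\alpha,\beta_0)=\hat k\,\psi'(\beta_0)/h=\frac{\hat k}{h\,\Phi'(\alpha)}.$$ -/

import Mathlib

open MeasureTheory ProbabilityTheory Filter Topology Set
open scoped NNReal

noncomputable section

namespace SkipFree

/-- `X` is a real-valued Lévy process: it starts at `0` almost surely, has independent and
stationary increments, and each of its sample paths is right-continuous with left limits. -/
structure IsLevyProcess {Ω : Type*} [MeasurableSpace Ω] (X : ℝ≥0 → Ω → ℝ) (P : Measure Ω) :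
    Prop where
  measurable : ∀ t, Measurable (X t)
  zero : ∀ᵐ ω ∂P, X 0 ω = 0
  indep : HasIndepIncrements X P
  stationary : ∀ s t : ℝ≥0, IdentDistrib (fun ω => X (s + t) ω - X s ω) (X t) P P
  rightCts : ∀ ω t, ContinuousWithinAt (fun s => X s ω) (Ici t) t
  leftLim : ∀ ω t, ∃ l : ℝ, Tendsto (fun s => X s ω) (𝓝[<] t) (𝓝 l)

/-- `X` is a compound Poisson process with Lévy measure `lam`: a Lévy process with
`E[exp(i u X_t)] = exp(t ∫ (exp(i u x) - 1) lam(dx))`, where `lam` is a nonzero finite measure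
without an atom at `0`. -/
structure IsCompoundPoisson {Ω : Type*} [MeasurableSpace Ω] (X : ℝ≥0 → Ω → ℝ)
    (lam : Measure ℝ) (P : Measure Ω) : Prop extends IsLevyProcess X P where
  finite : IsFiniteMeasure lam
  ne_zero : lam ≠ 0
  no_atom_zero : lam {0} = 0
  charFun_eq : ∀ (t : ℝ≥0) (u : ℝ), charFun (P.map (X t)) u
    = Complex.exp ((t : ℂ) * ∫ x : ℝ, (Complex.exp (Complex.I * u * x) - 1) ∂lam)

/-- `X` is an upwards skip-free Lévy chain with Lévy measure `lam` and lattice span `h > 0`: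
a compound Poisson process with `supp lam ⊆ hℤ` and `supp (lam restricted to (0,∞)) = {h}`. -/
structure IsUpwardsSkipFreeLevyChain {Ω : Type*} [MeasurableSpace Ω] (X : ℝ≥0 → Ω → ℝ)
    (lam : Measure ℝ) (h : ℝ) (P : Measure Ω) : Prop extends IsCompoundPoisson X lam P where
  h_pos : 0 < h
  support_subset : lam.support ⊆ {x | ∃ k : ℤ, x = h * k}
  support_pos : (lam.restrict (Ioi 0)).support = {h}

/-- The Laplace exponent `ψ(β) = ∫ (e^{βx} - 1) lam(dx)`, for complex `β`. -/
def psi (lam : Measure ℝ) (β : ℂ) : ℂ := ∫ x : ℝ, (Complex.exp (β * x) - 1) ∂lam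

/-- The Laplace exponent as a real function of a real argument. -/
def psiReal (lam : Measure ℝ) (β : ℝ) : ℝ := ∫ x : ℝ, (Real.exp (β * x) - 1) ∂lam

theorem psi_ofReal (lam : Measure ℝ) (β : ℝ) : psi lam (β : ℂ) = (psiReal lam β : ℂ) := by
  unfold psi psiReal
  rw [← integral_complex_ofReal]
  congr 1
  ext x
  push_cast
  rfl

/-- `Φ(0)`: the largest root of `ψ` on `[0,∞)`. -/
def PhiZero (lam : Measure ℝ) : ℝ := sSup {β : ℝ | 0 ≤ β ∧ psiReal lam β = 0}

/-- `Φ : [0,∞) → [Φ(0),∞)`: the inverse of the bijection `ψ : [Φ(0),∞) → [0,∞)`. -/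
def Phi (lam : Measure ℝ) : ℝ → ℝ := Function.invFunOn (psiReal lam) (Ici (PhiZero lam))

variable {Ω : Type*}

/-- The running supremum `sup {X_s : s ∈ [0,t]}`. -/
def runSup (X : ℝ≥0 → Ω → ℝ) (t : ℝ≥0) (ω : Ω) : ℝ := sSup ((fun s => X s ω) '' Iic t)

/-- The running infimum `inf {X_s : s ∈ [0,t]}`. -/
def runInf (X : ℝ≥0 → Ω → ℝ) (t : ℝ≥0) (ω : Ω) : ℝ := sInf ((fun s => X s ω) '' Iic t)

/-- The last time of attaining a new maximum on `[0,t]`: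
`inf {s ∈ [0,t] : X_s = sup_{[0,t]} X}`. -/
def lastMaxTime (X : ℝ≥0 → Ω → ℝ) (t : ℝ≥0) (ω : Ω) : ℝ≥0 :=
  sInf {s | s ≤ t ∧ X s ω = runSup X t ω}

/-- The last time on `[0,t]` of attaining the running infimum:
`sup {s ∈ [0,t] : X_s = inf_{[0,s]} X}`. -/
def lastMinTime (X : ℝ≥0 → Ω → ℝ) (t : ℝ≥0) (ω : Ω) : ℝ≥0 :=
  sSup {s | s ≤ t ∧ X s ω = runInf X s ω}

variable [MeasurableSpace Ω]

/-- `∫_{(0,∞)} (e^{-t} - e^{-αt-βx}) / t P(X_t ∈ dx)` -/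
def ascIntegrand (X : ℝ≥0 → Ω → ℝ) (P : Measure Ω) (α β : ℂ) (t : ℝ) : ℂ :=
  ∫ x in Ioi (0 : ℝ), (Complex.exp (-t) - Complex.exp (-α * t - β * x)) / t
    ∂(P.map (X t.toNNReal))

/-- `∫_{(-∞,0]} (e^{-t} - e^{-αt+βx}) / t P(X_t ∈ dx)` -/
def descIntegrand (X : ℝ≥0 → Ω → ℝ) (P : Measure Ω) (α β : ℂ) (t : ℝ) : ℂ :=
  ∫ x in Iic (0 : ℝ), (Complex.exp (-t) - Complex.exp (-α * t + β * x)) / t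
    ∂(P.map (X t.toNNReal))

/-- The strict ascending ladder exponent `κ*`, with normalising constant `c`. -/
def kappaStar (c : ℝ) (X : ℝ≥0 → Ω → ℝ) (P : Measure Ω) (α β : ℂ) : ℂ :=
  c * Complex.exp (∫ t in Ioi (0 : ℝ), ascIntegrand X P α β t)

/-- The (weak) descending ladder exponent `κ̂`, with normalising constant `c`. -/
def kappaHat (c : ℝ) (X : ℝ≥0 → Ω → ℝ) (P : Measure Ω) (α β : ℂ) : ℂ :=
  c * Complex.exp (∫ t in Ioi (0 : ℝ), descIntegrand X P α β t)

end SkipFree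

end

open scoped ENNReal

noncomputable section

namespace SkipFree

/-- The properties of the Lévy measure of an upwards skip-free chain. -/
structure IsSkipFreeMeasure (lam : Measure ℝ) (h : ℝ) : Prop where
  finite : IsFiniteMeasure lam
  h_pos : 0 < h
  ae_le : ∀ᵐ x ∂lam, x ≤ h
  ae_lattice : ∀ᵐ x ∂lam, ∃ k : ℤ, x = h * k
  atom_pos : 0 < lam.real {h}

theorem IsUpwardsSkipFreeLevyChain.isSkipFreeMeasure {Ω : Type*} [MeasurableSpace Ω]
    {X : ℝ≥0 → Ω → ℝ} {lam : Measure ℝ} {h : ℝ} {P : Measure Ω}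
    (hX : IsUpwardsSkipFreeLevyChain X lam h P) : IsSkipFreeMeasure lam h := by
  have := hX.finite
  have hsupp : (lam.restrict (Ioi 0)) {h}ᶜ = 0 := by
    rw [← hX.support_pos]; exact Measure.measure_compl_support
  have hae : ∀ᵐ x ∂lam, 0 < x → x = h := by
    have h1 : ∀ᵐ x ∂(lam.restrict (Ioi 0)), x = h := hsupp
    exact (ae_restrict_iff' measurableSet_Ioi).1 h1
  refine ⟨hX.finite, hX.h_pos, ?_, ?_, ?_⟩
  · filter_upwards [hae] with x hx
    rcases le_or_gt x 0 with h0 | h0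
    · exact h0.trans hX.h_pos.le
    · exact (hx h0).le
  · filter_upwards [Measure.support_mem_ae (μ := lam)] with x hx using hX.support_subset hx
  · have h1 : (lam.restrict (Ioi 0)) ≠ 0 := by
      rw [← Measure.nonempty_support_iff, hX.support_pos]; exact singleton_nonempty h
    have h2 : (lam.restrict (Ioi 0)) {h} ≠ 0 := by
      intro h0
      apply h1
      rw [← Measure.measure_univ_eq_zero, ← union_compl_self {h}]
      exact measure_union_null h0 hsupp
    have h3 : lam {h} ≠ 0 := by
      intro h0
      exact h2 (le_antisymm ((Measure.restrict_apply_le _ _).trans h0.le) zero_le)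
    exact ENNReal.toReal_pos h3 (measure_ne_top _ _)

namespace IsSkipFreeMeasure

variable {lam : Measure ℝ} {h : ℝ}

theorem mass_pos (H : IsSkipFreeMeasure lam h) : 0 < lam.real univ := by
  have := H.finite
  exact H.atom_pos.trans_le (measureReal_mono (subset_univ _))

theorem mem_integrableExpSet (H : IsSkipFreeMeasure lam h) {β : ℝ} (hβ : 0 ≤ β) :
    β ∈ integrableExpSet id lam := by
  have := H.finite
  refine Integrable.of_bound (C := Real.exp (β * h)) (by fun_prop) ?_
  filter_upwards [H.ae_le] with x hx
  rw [Real.norm_eq_abs, abs_of_pos (Real.exp_pos _)]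
  exact Real.exp_le_exp.2 (mul_le_mul_of_nonneg_left hx hβ)

theorem mem_interior_integrableExpSet (H : IsSkipFreeMeasure lam h) {β : ℝ} (hβ : 0 < β) :
    β ∈ interior (integrableExpSet id lam) :=
  interior_mono (fun _ hx => H.mem_integrableExpSet (mem_Ioi.1 hx).le)
    (by simpa [interior_Ioi] using hβ : β ∈ interior (Ioi 0))

theorem integrable_exp (H : IsSkipFreeMeasure lam h) {β : ℝ} (hβ : 0 ≤ β) :
    Integrable (fun x => Real.exp (β * x)) lam := H.mem_integrableExpSet hβ

theorem integrable_cexp (H : IsSkipFreeMeasure lam h) {β : ℂ} (hβ : 0 ≤ β.re) :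
    Integrable (fun x : ℝ => Complex.exp (β * x)) lam :=
  integrable_cexp_mul_of_re_mem_integrableExpSet aemeasurable_id (H.mem_integrableExpSet hβ)

theorem integral_cexp (H : IsSkipFreeMeasure lam h) {β : ℂ} (hβ : 0 ≤ β.re) :
    ∫ x : ℝ, Complex.exp (β * x) ∂lam = psi lam β + lam.real univ := by
  have := H.finite
  rw [psi, integral_sub (H.integrable_cexp hβ) (integrable_const _)]
  simp

theorem integral_exp (H : IsSkipFreeMeasure lam h) {β : ℝ} (hβ : 0 ≤ β) :
    ∫ x : ℝ, Real.exp (β * x) ∂lam = psiReal lam β + lam.real univ := by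
  have := H.finite
  rw [psiReal, integral_sub (H.integrable_exp hβ) (integrable_const _)]
  simp

theorem psiReal_eq (H : IsSkipFreeMeasure lam h) {β : ℝ} (hβ : 0 ≤ β) :
    psiReal lam β = mgf id lam β - lam.real univ := by
  rw [eq_sub_iff_add_eq, ← H.integral_exp hβ]; rfl

theorem psi_eq (H : IsSkipFreeMeasure lam h) {β : ℂ} (hβ : 0 ≤ β.re) :
    psi lam β = complexMGF id lam β - lam.real univ := by
  rw [eq_sub_iff_add_eq, ← H.integral_cexp hβ]; rfl

theorem psiReal_zero : psiReal lam 0 = 0 := by simp [psiReal]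

theorem re_psi_le (H : IsSkipFreeMeasure lam h) {β : ℂ} (hβ : 0 ≤ β.re) :
    (psi lam β).re ≤ psiReal lam β.re := by
  have h1 := H.integral_cexp hβ
  have h2 := H.integral_exp hβ
  have h3 : ‖∫ x : ℝ, Complex.exp (β * x) ∂lam‖ ≤ ∫ x : ℝ, Real.exp (β.re * x) ∂lam := by
    refine (norm_integral_le_integral_norm _).trans_eq ?_
    congr 1 with x
    simp [Complex.norm_exp]
  rw [h1, h2] at h3
  have h4 := (Complex.re_le_norm _).trans h3
  simp at h4
  linarith

theorem psiReal_le (H : IsSkipFreeMeasure lam h) {β : ℝ} (hβ : 0 ≤ β) :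
    psiReal lam β ≤ lam.real univ * Real.exp (β * h) := by
  have := H.finite
  have h1 : ∫ x : ℝ, Real.exp (β * x) ∂lam ≤ ∫ _ : ℝ, Real.exp (β * h) ∂lam := by
    refine integral_mono_ae (H.integrable_exp hβ) (integrable_const _) ?_
    filter_upwards [H.ae_le] with x hx
    exact Real.exp_le_exp.2 (mul_le_mul_of_nonneg_left hx hβ)
  rw [H.integral_exp hβ] at h1
  simp only [integral_const, smul_eq_mul] at h1
  linarith [H.mass_pos]

theorem le_psiReal (H : IsSkipFreeMeasure lam h) {β : ℝ} (hβ : 0 ≤ β) :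
    lam.real {h} * Real.exp (β * h) - lam.real univ ≤ psiReal lam β := by
  have := H.finite
  have h1 : ∫ x in {h}, Real.exp (β * x) ∂lam ≤ ∫ x : ℝ, Real.exp (β * x) ∂lam :=
    setIntegral_le_integral (H.integrable_exp hβ) (ae_of_all _ fun x => (Real.exp_pos _).le)
  rw [H.integral_exp hβ, integral_singleton] at h1
  simp only [smul_eq_mul] at h1
  linarith

theorem convexOn_psiReal (H : IsSkipFreeMeasure lam h) : ConvexOn ℝ (Ici 0) (psiReal lam) := by
  have := H.finite
  refine ⟨convex_Ici 0, fun x hx y hy a b ha hb hab => ?_⟩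
  have hxy : 0 ≤ a * x + b * y := add_nonneg (mul_nonneg ha hx) (mul_nonneg hb hy)
  have h1 : ∫ z : ℝ, Real.exp ((a * x + b * y) * z) ∂lam
      ≤ ∫ z : ℝ, (a * Real.exp (x * z) + b * Real.exp (y * z)) ∂lam := by
    refine integral_mono (H.integrable_exp hxy)
      (((H.integrable_exp hx).const_mul a).add ((H.integrable_exp hy).const_mul b)) fun z => ?_
    have := convexOn_exp.2 (mem_univ (x * z)) (mem_univ (y * z)) ha hb hab
    simp only [smul_eq_mul] at this
    convert this using 2
    ring
  rw [integral_add ((H.integrable_exp hx).const_mul a) ((H.integrable_exp hy).const_mul b),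
    integral_const_mul, integral_const_mul, H.integral_exp hxy, H.integral_exp hx,
    H.integral_exp hy] at h1
  change psiReal lam (a * x + b * y) ≤ a * psiReal lam x + b * psiReal lam y
  have : (a + b) * lam.real univ = lam.real univ := by rw [hab, one_mul]
  linarith

theorem hasStrictDerivAt_psiReal (H : IsSkipFreeMeasure lam h) {β : ℝ} (hβ : 0 < β) :
    HasStrictDerivAt (psiReal lam) (deriv (psiReal lam) β) β := by
  have h1 : AnalyticAt ℝ (fun x => mgf id lam x - lam.real univ) β :=
    (analyticAt_mgf (H.mem_interior_integrableExpSet hβ)).sub analyticAt_const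
  have h2 : AnalyticAt ℝ (psiReal lam) β := by
    refine h1.congr ?_
    filter_upwards [lt_mem_nhds hβ] with x hx using (H.psiReal_eq hx.le).symm
  exact h2.hasStrictDerivAt

theorem continuousOn_psiReal (H : IsSkipFreeMeasure lam h) :
    ContinuousOn (psiReal lam) (Ici 0) := by
  have := H.finite
  have hc : ContinuousOn (fun β => ∫ x : ℝ, Real.exp (β * x) ∂lam) (Ici 0) := by
    intro β₀ hβ₀
    refine continuousWithinAt_of_dominated (bound := fun _ => Real.exp ((β₀ + 1) * h)) ?_ ?_
      (integrable_const _) (ae_of_all _ fun x => by fun_prop)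
    · exact Eventually.of_forall fun β => by fun_prop
    · have : ∀ᶠ β in 𝓝[Ici 0] β₀, β < β₀ + 1 :=
        mem_nhdsWithin_of_mem_nhds (gt_mem_nhds (by linarith))
      filter_upwards [this, self_mem_nhdsWithin] with β hβ hβ0
      filter_upwards [H.ae_le] with x hx
      rw [Real.norm_eq_abs, abs_of_pos (Real.exp_pos _)]
      refine Real.exp_le_exp.2 ?_
      nlinarith [H.h_pos, mem_Ici.1 hβ0]
  refine (hc.sub (continuousOn_const (c := lam.real univ))).congr fun β hβ => ?_
  change _ = (∫ x : ℝ, Real.exp (β * x) ∂lam) - lam.real univ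
  rw [H.integral_exp hβ]
  ring

theorem psiReal_lt (H : IsSkipFreeMeasure lam h) {β b q : ℝ} (hq : 0 < q) (hb : psiReal lam b = q)
    (hβ : 0 ≤ β) (hβb : β < b) : psiReal lam β < q := by
  have hb0 : 0 < b := hβ.trans_lt hβb
  have := H.convexOn_psiReal.2 (mem_Ici.2 le_rfl) (mem_Ici.2 hb0.le)
    (sub_nonneg.2 ((div_le_one hb0).2 hβb.le)) (div_nonneg hβ hb0.le) (by ring)
  simp only [smul_eq_mul, psiReal_zero, hb] at this
  have h1 : (1 - β / b) * 0 + β / b * b = β := by field_simp; simp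
  rw [h1] at this
  have h2 : β / b < 1 := (div_lt_one hb0).2 hβb
  nlinarith

theorem exists_psiReal_eq (H : IsSkipFreeMeasure lam h) {q : ℝ} (hq : 0 < q) :
    ∃ b, 0 < b ∧ psiReal lam b = q := by
  have hl := H.atom_pos
  obtain ⟨B, hB0, hB⟩ : ∃ B, 0 ≤ B ∧ q ≤ psiReal lam B := by
    refine ⟨((q + lam.real univ) / lam.real {h}) / h, ?_, ?_⟩
    · exact div_nonneg (div_nonneg (by linarith [H.mass_pos]) hl.le) H.h_pos.le
    · refine le_trans ?_ (H.le_psiReal (div_nonneg (div_nonneg (by linarith [H.mass_pos]) hl.le)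
        H.h_pos.le))
      rw [div_mul_cancel₀ _ H.h_pos.ne']
      have := Real.add_one_le_exp ((q + lam.real univ) / lam.real {h})
      have h2 := mul_le_mul_of_nonneg_left this hl.le
      rw [mul_add, mul_div_cancel₀ _ hl.ne'] at h2
      linarith
  have hIcc := intermediate_value_Icc hB0 (H.continuousOn_psiReal.mono Icc_subset_Ici_self)
  obtain ⟨b, hb, hbq⟩ := hIcc ⟨by rw [psiReal_zero]; exact hq.le, hB⟩
  refine ⟨b, lt_of_le_of_ne hb.1 ?_, hbq⟩
  rintro rfl
  rw [psiReal_zero] at hbq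
  exact hq.ne hbq

theorem psiReal_injective (H : IsSkipFreeMeasure lam h) {q b b' : ℝ} (hq : 0 < q)
    (hb0 : 0 ≤ b) (hb0' : 0 ≤ b') (hb : psiReal lam b = q) (hb' : psiReal lam b' = q) :
    b = b' := by
  rcases lt_trichotomy b b' with hlt | heq | hlt
  · exact absurd hb (H.psiReal_lt hq hb' hb0 hlt).ne
  · exact heq
  · exact absurd hb' (H.psiReal_lt hq hb hb0' hlt).ne

theorem PhiZero_nonneg : 0 ≤ PhiZero lam :=
  Real.sSup_nonneg fun _ hx => hx.1

theorem PhiZero_le (H : IsSkipFreeMeasure lam h) {b q : ℝ} (hq : 0 < q) (hb0 : 0 ≤ b)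
    (hb : psiReal lam b = q) : PhiZero lam ≤ b := by
  refine csSup_le ⟨0, le_rfl, psiReal_zero⟩ ?_
  rintro r ⟨hr0, hr⟩
  by_contra! hlt
  have hr0' : 0 < r := hb0.trans_lt hlt
  have := H.convexOn_psiReal.2 (mem_Ici.2 le_rfl) (mem_Ici.2 hr0'.le)
    (sub_nonneg.2 ((div_le_one hr0').2 hlt.le)) (div_nonneg hb0 hr0'.le) (by ring)
  simp only [smul_eq_mul, psiReal_zero, hr] at this
  have h1 : (1 - b / r) * 0 + b / r * r = b := by field_simp; simp
  rw [h1, hb] at this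
  simp at this
  linarith

theorem Phi_spec (H : IsSkipFreeMeasure lam h) {q : ℝ} (hq : 0 < q) :
    0 < Phi lam q ∧ psiReal lam (Phi lam q) = q := by
  obtain ⟨b, hb0, hb⟩ := H.exists_psiReal_eq hq
  have hex : ∃ b ∈ Ici (PhiZero lam), psiReal lam b = q := ⟨b, H.PhiZero_le hq hb0.le hb, hb⟩
  have h1 : Phi lam q ∈ Ici (PhiZero lam) := Function.invFunOn_mem hex
  have h2 : psiReal lam (Phi lam q) = q := Function.invFunOn_eq hex
  refine ⟨lt_of_le_of_ne (PhiZero_nonneg.trans h1) fun h0 => ?_, h2⟩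
  rw [← h0, psiReal_zero] at h2
  exact hq.ne h2

theorem Phi_pos (H : IsSkipFreeMeasure lam h) {q : ℝ} (hq : 0 < q) : 0 < Phi lam q :=
  (H.Phi_spec hq).1

theorem psiReal_Phi (H : IsSkipFreeMeasure lam h) {q : ℝ} (hq : 0 < q) :
    psiReal lam (Phi lam q) = q := (H.Phi_spec hq).2

theorem eq_Phi_iff (H : IsSkipFreeMeasure lam h) {q : ℝ} (hq : 0 < q) (b : ℝ) :
    (0 < b ∧ psiReal lam b = q) ↔ b = Phi lam q := by
  constructor
  · rintro ⟨hb0, hb⟩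
    exact H.psiReal_injective hq hb0.le (H.Phi_pos hq).le hb (H.psiReal_Phi hq)
  · rintro rfl
    exact H.Phi_spec hq

theorem deriv_psiReal_pos (H : IsSkipFreeMeasure lam h) {q : ℝ} (hq : 0 < q) :
    0 < deriv (psiReal lam) (Phi lam q) := by
  have hp := H.Phi_pos hq
  have := H.convexOn_psiReal.slope_le_of_hasDerivAt (mem_Ici.2 le_rfl) (mem_Ici.2 hp.le) hp
    (H.hasStrictDerivAt_psiReal hp).hasDerivAt
  refine lt_of_lt_of_le ?_ this
  rw [slope_def_field, psiReal_zero, H.psiReal_Phi hq]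
  simp only [sub_zero]
  positivity

theorem hasDerivAt_Phi (H : IsSkipFreeMeasure lam h) {q : ℝ} (hq : 0 < q) :
    HasDerivAt (Phi lam) (deriv (psiReal lam) (Phi lam q))⁻¹ q := by
  have hp := H.Phi_pos hq
  have := (H.hasStrictDerivAt_psiReal hp).to_local_left_inverse (H.deriv_psiReal_pos hq).ne'
    (g := Phi lam) ?_
  · rw [H.psiReal_Phi hq] at this
    exact this.hasDerivAt
  · have hc : ContinuousAt (psiReal lam) (Phi lam q) :=
      (H.hasStrictDerivAt_psiReal hp).hasDerivAt.continuousAt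
    have h1 : ∀ᶠ x in 𝓝 (Phi lam q), 0 < psiReal lam x := by
      refine hc.eventually_const_lt ?_
      rw [H.psiReal_Phi hq]; exact hq
    filter_upwards [h1, lt_mem_nhds hp] with x hx hx0
    exact (((H.eq_Phi_iff hx) x).1 ⟨hx0, rfl⟩).symm

theorem tendsto_Phi_atTop (H : IsSkipFreeMeasure lam h) : Tendsto (Phi lam) atTop atTop := by
  refine tendsto_atTop.2 fun b => ?_
  have hm : 0 < lam.real univ * Real.exp (max b 0 * h) :=
    mul_pos H.mass_pos (Real.exp_pos _)
  filter_upwards [eventually_gt_atTop (lam.real univ * Real.exp (max b 0 * h))] with q hq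
  by_contra! hlt
  have hq0 := hm.trans hq
  have h1 := H.psiReal_le (H.Phi_pos hq0).le
  rw [H.psiReal_Phi hq0] at h1
  have h2 : Real.exp (Phi lam q * h) ≤ Real.exp (max b 0 * h) :=
    Real.exp_le_exp.2 (mul_le_mul_of_nonneg_right (hlt.le.trans (le_max_left _ _)) H.h_pos.le)
  nlinarith [H.mass_pos]

theorem re_psi_lt (H : IsSkipFreeMeasure lam h) {q : ℝ} (hq : 0 < q) {β : ℂ} (hβ : 0 ≤ β.re)
    (hβΦ : β.re < Phi lam q) : (psi lam β).re < q :=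
  (H.re_psi_le hβ).trans_lt (H.psiReal_lt hq (H.psiReal_Phi hq) hβ hβΦ)

theorem differentiableOn_psi (H : IsSkipFreeMeasure lam h) :
    DifferentiableOn ℂ (psi lam) {z | 0 < z.re} := by
  have h1 : DifferentiableOn ℂ (fun z => complexMGF id lam z - lam.real univ) {z | 0 < z.re} :=
    (differentiableOn_complexMGF.mono fun z hz => H.mem_interior_integrableExpSet hz).sub_const _
  exact h1.congr fun z hz => H.psi_eq (show 0 < z.re from hz).le

/-- The quotient `(1 - e^{(β - Φ(q))h}) / (q - ψ(β))` converges to `h / ψ'(Φ(q))`. -/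
theorem tendsto_slope_quotient (H : IsSkipFreeMeasure lam h) {q : ℝ} (hq : 0 < q) :
    Tendsto (fun β : ℝ => (1 - Real.exp ((β - Phi lam q) * h)) / (q - psiReal lam β))
      (𝓝[≠] (Phi lam q)) (𝓝 (h / deriv (psiReal lam) (Phi lam q))) := by
  set b := Phi lam q with hb
  have hp : 0 < b := H.Phi_pos hq
  have h1 : HasDerivAt (fun β : ℝ => Real.exp ((β - b) * h)) h b := by
    have := (((hasDerivAt_id b).sub_const b).mul_const h).exp
    simpa using this
  have h2 := (H.hasStrictDerivAt_psiReal hp).hasDerivAt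
  have h3 := h1.tendsto_slope.div h2.tendsto_slope (H.deriv_psiReal_pos hq).ne'
  refine h3.congr' ?_
  filter_upwards [self_mem_nhdsWithin] with β hβ
  have hne : β - b ≠ 0 := sub_ne_zero.2 hβ
  simp only [Pi.div_apply, slope_def_field, sub_self, zero_mul, Real.exp_zero]
  rw [show psiReal lam b = q from H.psiReal_Phi hq, div_div_div_cancel_right₀ hne,
    ← neg_sub q, ← neg_sub (1 : ℝ), neg_div_neg_eq]

end IsSkipFreeMeasure

/-- The `n`-fold convolution power of a measure. -/
def convPow (lam : Measure ℝ) : ℕ → Measure ℝ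
  | 0 => Measure.dirac 0
  | n + 1 => Measure.conv lam (convPow lam n)

instance isFiniteMeasure_convPow (lam : Measure ℝ) [IsFiniteMeasure lam] (n : ℕ) :
    IsFiniteMeasure (convPow lam n) := by
  induction n with
  | zero => unfold convPow; infer_instance
  | succ n ih => unfold convPow; infer_instance

/-- The law at time `t` of a compound Poisson process with jump measure `lam`. -/
def cpLaw (lam : Measure ℝ) (t : ℝ) : Measure ℝ :=
  Measure.sum fun n : ℕ =>
    ENNReal.ofReal (Real.exp (-(lam.real univ * t)) * t ^ n / n.factorial) • convPow lam n

/-- The resolvent `∫ e^{-qt} P(X_t ∈ ·) dt` of a compound Poisson process with jump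
measure `lam`. -/
def resolvent (lam : Measure ℝ) (q : ℝ) : Measure ℝ :=
  Measure.sum fun n : ℕ => ENNReal.ofReal ((q + lam.real univ)⁻¹ ^ (n + 1)) • convPow lam n

theorem lintegral_convPow {lam : Measure ℝ} [IsFiniteMeasure lam] {g : ℝ → ℝ≥0∞}
    (hg : Measurable g) (h0 : g 0 = 1) (hadd : ∀ x y, g (x + y) = g x * g y) (n : ℕ) :
    ∫⁻ x, g x ∂(convPow lam n) = (∫⁻ x, g x ∂lam) ^ n := by
  induction n with
  | zero => simp [convPow, lintegral_dirac' _ hg, h0]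
  | succ n ih =>
    rw [convPow, Measure.lintegral_conv hg]
    simp_rw [hadd, lintegral_const_mul _ hg, ih, lintegral_mul_const _ hg]
    rw [pow_succ, mul_comm]

theorem integral_convPow {lam : Measure ℝ} [IsFiniteMeasure lam] {f : ℝ → ℂ}
    (hf : Measurable f) (h0 : f 0 = 1) (hadd : ∀ x y, f (x + y) = f x * f y)
    (hint : Integrable f lam) (n : ℕ) :
    Integrable f (convPow lam n) ∧ ∫ x, f x ∂(convPow lam n) = (∫ x, f x ∂lam) ^ n := by
  have hI : ∀ n, Integrable f (convPow lam n) := by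
    intro n
    refine ⟨hf.aestronglyMeasurable, ?_⟩
    have := lintegral_convPow (lam := lam) (g := fun x => ‖f x‖ₑ) hf.enorm (by simp [h0])
      (fun x y => by rw [hadd, enorm_mul]) n
    rw [HasFiniteIntegral, this]
    exact ENNReal.pow_lt_top hint.2
  refine ⟨hI n, ?_⟩
  induction n with
  | zero => simp [convPow, h0]
  | succ n ih =>
    have hI' := hI (n + 1)
    rw [convPow] at hI'
    rw [convPow, integral_conv hI']
    simp_rw [hadd, integral_const_mul, ih, integral_mul_const]
    rw [pow_succ, mul_comm]

theorem convPow_succ_singleton {lam : Measure ℝ} [IsFiniteMeasure lam] (n : ℕ) (x : ℝ) :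
    convPow lam (n + 1) {x} = ∫⁻ y, convPow lam n {x - y} ∂lam := by
  have h1 : Measurable (indicator {x} (fun _ : ℝ => (1 : ℝ≥0∞))) :=
    measurable_const.indicator (measurableSet_singleton x)
  have h2 : ∀ (μ : Measure ℝ) (s : Set ℝ), MeasurableSet s →
      μ s = ∫⁻ z, s.indicator (fun _ => 1) z ∂μ := fun μ s hs => by
    rw [lintegral_indicator hs]; simp
  rw [h2 _ _ (measurableSet_singleton x), convPow, Measure.lintegral_conv h1]
  congr 1 with y
  rw [h2 _ _ (measurableSet_singleton (x - y))]
  congr 1 with z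
  by_cases hz : y + z = x
  · simp [show z = x - y by linarith]
  · rw [indicator_of_notMem (by simpa using hz), indicator_of_notMem]
    simp only [mem_singleton_iff]
    intro hz'
    exact hz (by linarith)

theorem hasSum_poisson_pow (m t : ℝ) (z : ℂ) :
    HasSum (fun n : ℕ => ((Real.exp (-(m * t)) * t ^ n / n.factorial : ℝ) : ℂ) * z ^ n)
      (Complex.exp (t * (z - m))) := by
  have h1 := (NormedSpace.expSeries_div_hasSum_exp (t * z : ℂ)).mul_left
    (Complex.exp (-(m * t)))
  rw [← Complex.exp_eq_exp_ℂ, ← Complex.exp_add] at h1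
  rw [show (t * (z - m) : ℂ) = -(m * t) + t * z by ring]
  refine h1.congr_fun fun n => ?_
  push_cast
  rw [mul_pow]
  ring

theorem poisson_weight_nonneg {m t : ℝ} (ht : 0 ≤ t) (n : ℕ) :
    0 ≤ Real.exp (-(m * t)) * t ^ n / n.factorial := by positivity

theorem integral_cpLaw {lam : Measure ℝ} [IsFiniteMeasure lam] {f : ℝ → ℂ}
    (hf : Measurable f) (h0 : f 0 = 1) (hadd : ∀ x y, f (x + y) = f x * f y)
    (hint : Integrable f lam) {t : ℝ} (ht : 0 ≤ t) :
    Integrable f (cpLaw lam t) ∧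
      ∫ x, f x ∂(cpLaw lam t) = Complex.exp (t * (∫ x, f x ∂lam - lam.real univ)) := by
  have hI : Integrable f (cpLaw lam t) := by
    refine ⟨hf.aestronglyMeasurable, ?_⟩
    rw [HasFiniteIntegral, cpLaw, lintegral_sum_measure]
    simp_rw [lintegral_smul_measure]
    have h1 : ∀ n, ∫⁻ x, ‖f x‖ₑ ∂(convPow lam n) = ENNReal.ofReal ((∫ x, ‖f x‖ ∂lam) ^ n) := by
      intro n
      rw [lintegral_convPow (g := fun x => ‖f x‖ₑ) hf.enorm (by simp [h0])
        (fun x y => by rw [hadd, enorm_mul]) n,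
        ENNReal.ofReal_pow (integral_nonneg fun _ => norm_nonneg _),
        ofReal_integral_norm_eq_lintegral_enorm hint]
    simp_rw [h1, smul_eq_mul]
    have h2 : Summable fun n : ℕ => Real.exp (-(lam.real univ * t)) * t ^ n / n.factorial
        * (∫ x, ‖f x‖ ∂lam) ^ n := by
      have := (hasSum_poisson_pow (lam.real univ) t ((∫ x, ‖f x‖ ∂lam : ℝ) : ℂ)).summable
      exact_mod_cast this
    have h3 : ∀ n : ℕ, 0 ≤ (∫ x, ‖f x‖ ∂lam) ^ n := fun n =>
      pow_nonneg (integral_nonneg fun _ => norm_nonneg _) n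
    simp_rw [← ENNReal.ofReal_mul (poisson_weight_nonneg ht _)]
    rw [← ENNReal.ofReal_tsum_of_nonneg (fun n => mul_nonneg (poisson_weight_nonneg ht n) (h3 n))
      h2]
    exact ENNReal.ofReal_lt_top
  refine ⟨hI, ?_⟩
  have h1 := hasSum_integral_measure (by simpa only [cpLaw] using hI)
  have h2 := hasSum_poisson_pow (lam.real univ) t (∫ x, f x ∂lam)
  refine h1.unique (h2.congr_fun ?_)
  intro n
  rw [integral_smul_measure, ENNReal.toReal_ofReal (poisson_weight_nonneg ht n),
    (integral_convPow hf h0 hadd hint n).2]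
  simp [Complex.real_smul]

theorem isProbabilityMeasure_cpLaw (lam : Measure ℝ) [IsFiniteMeasure lam] {t : ℝ} (ht : 0 ≤ t) :
    IsProbabilityMeasure (cpLaw lam t) := by
  have h1 := integral_cpLaw (lam := lam) (f := fun _ => 1) measurable_const rfl (by simp)
    (integrable_const _) ht
  have : IsFiniteMeasure (cpLaw lam t) := by
    have := (integrable_const_iff (c := (1 : ℂ))).1 h1.1
    exact (isFiniteMeasure_iff _).2 (by simpa [isFiniteMeasure_iff] using this)
  refine ⟨?_⟩
  have h2 := h1.2
  simp only [integral_const] at h2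
  simp at h2
  have h3 : (cpLaw lam t).real univ = 1 := by exact_mod_cast h2
  rw [measureReal_def, ENNReal.toReal_eq_one_iff] at h3
  exact h3

theorem cpLaw_apply (lam : Measure ℝ) (t : ℝ) {s : Set ℝ} (hs : MeasurableSet s) :
    cpLaw lam t s = ∑' n : ℕ, ENNReal.ofReal (Real.exp (-(lam.real univ * t)) * t ^ n
      / n.factorial) * convPow lam n s := by
  rw [cpLaw, Measure.sum_apply _ hs]
  rfl

theorem measurable_cpLaw_apply (lam : Measure ℝ) {s : Set ℝ} (hs : MeasurableSet s) :
    Measurable fun t => cpLaw lam t s := by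
  simp_rw [cpLaw_apply lam _ hs]
  exact Measurable.tsum fun n => by fun_prop

theorem exp_le_cpLaw_zero (lam : Measure ℝ) (t : ℝ) :
    ENNReal.ofReal (Real.exp (-(lam.real univ * t))) ≤ cpLaw lam t {0} := by
  rw [cpLaw_apply lam t (measurableSet_singleton 0)]
  refine le_trans ?_ (ENNReal.le_tsum 0)
  simp [convPow]

theorem cpLaw_compl_zero_le (lam : Measure ℝ) [IsFiniteMeasure lam] {t : ℝ} (ht : 0 ≤ t) :
    cpLaw lam t {0}ᶜ ≤ ENNReal.ofReal (lam.real univ * t) := by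
  have := isProbabilityMeasure_cpLaw lam ht
  rw [prob_compl_eq_one_sub (measurableSet_singleton 0)]
  refine (tsub_le_tsub_left (exp_le_cpLaw_zero lam t) 1).trans ?_
  rw [← ENNReal.ofReal_one, ← ENNReal.ofReal_sub _ (Real.exp_pos _).le]
  refine ENNReal.ofReal_le_ofReal ?_
  have := Real.add_one_le_exp (-(lam.real univ * t))
  linarith

theorem resolvent_apply (lam : Measure ℝ) (q : ℝ) {s : Set ℝ} (hs : MeasurableSet s) :
    resolvent lam q s = ∑' n : ℕ, ENNReal.ofReal ((q + lam.real univ)⁻¹ ^ (n + 1))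
      * convPow lam n s := by
  rw [resolvent, Measure.sum_apply _ hs]
  rfl

theorem lintegral_pow_mul_exp {r : ℝ} (hr : 0 < r) (n : ℕ) :
    ∫⁻ t in Ioi (0 : ℝ), ENNReal.ofReal (t ^ n * Real.exp (-(r * t)))
      = ENNReal.ofReal (n.factorial * r⁻¹ ^ (n + 1)) := by
  have h1 := Real.integral_rpow_mul_exp_neg_mul_Ioi (a := n + 1) (r := r) (by positivity) hr
  have h2 : ∫ t in Ioi (0 : ℝ), t ^ n * Real.exp (-(r * t))
      = n.factorial * r⁻¹ ^ (n + 1) := by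
    rw [← Real.Gamma_nat_eq_factorial, mul_comm, ← one_div, ← Real.rpow_natCast]
    push_cast
    rw [← h1]
    refine setIntegral_congr_fun measurableSet_Ioi fun t ht => ?_
    simp
  have hpos : 0 < ∫ t in Ioi (0 : ℝ), t ^ n * Real.exp (-(r * t)) := by
    rw [h2]; positivity
  rw [← h2, ofReal_integral_eq_lintegral_ofReal]
  · exact (not_imp_comm.1 integral_undef) hpos.ne'
  · filter_upwards [ae_restrict_mem measurableSet_Ioi] with t ht
    have : (0 : ℝ) < t := ht
    positivity

/-- The resolvent is the Laplace transform in time of the transition law. -/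
theorem lintegral_exp_mul_cpLaw (lam : Measure ℝ) [IsFiniteMeasure lam] {q : ℝ} (hq : 0 < q)
    {s : Set ℝ} (hs : MeasurableSet s) :
    ∫⁻ t in Ioi (0 : ℝ), ENNReal.ofReal (Real.exp (-(q * t))) * cpLaw lam t s
      = resolvent lam q s := by
  have hm : 0 ≤ lam.real univ := measureReal_nonneg
  rw [resolvent_apply lam q hs]
  have h1 : ∀ t ∈ Ioi (0 : ℝ), ENNReal.ofReal (Real.exp (-(q * t))) * cpLaw lam t s
      = ∑' n : ℕ, ENNReal.ofReal (t ^ n * Real.exp (-((q + lam.real univ) * t)))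
        * (ENNReal.ofReal (n.factorial : ℝ)⁻¹ * convPow lam n s) := by
    intro t ht
    have ht' : (0 : ℝ) < t := ht
    rw [cpLaw_apply lam t hs, ← ENNReal.tsum_mul_left]
    congr 1 with n
    rw [← mul_assoc, ← mul_assoc, ← ENNReal.ofReal_mul (by positivity),
      ← ENNReal.ofReal_mul (by positivity)]
    congr 2
    rw [add_mul, neg_add, Real.exp_add]
    ring
  rw [setLIntegral_congr_fun measurableSet_Ioi h1, lintegral_tsum fun n => by fun_prop]
  congr 1 with n
  rw [lintegral_mul_const _ (by fun_prop), lintegral_pow_mul_exp (by linarith), ← mul_assoc,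
    ← ENNReal.ofReal_mul (by positivity)]
  congr 2
  have : (n.factorial : ℝ) ≠ 0 := by positivity
  field_simp

theorem lintegral_resolvent {lam : Measure ℝ} [IsFiniteMeasure lam] {g : ℝ → ℝ≥0∞}
    (hg : Measurable g) (h0 : g 0 = 1) (hadd : ∀ x y, g (x + y) = g x * g y) {q a : ℝ}
    (ha : 0 ≤ a) (hga : ∫⁻ x, g x ∂lam = ENNReal.ofReal a) (haq : a < q + lam.real univ) :
    ∫⁻ x, g x ∂(resolvent lam q) = ENNReal.ofReal (1 / (q + lam.real univ - a)) := by
  set r := q + lam.real univ with hr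
  have hr0 : 0 < r := ha.trans_lt haq
  rw [resolvent, lintegral_sum_measure]
  simp_rw [lintegral_smul_measure, lintegral_convPow hg h0 hadd, hga, ← ENNReal.ofReal_pow ha,
    smul_eq_mul, ← hr]
  simp_rw [← ENNReal.ofReal_mul (pow_nonneg (inv_nonneg.2 hr0.le) _)]
  have h1 : HasSum (fun n : ℕ => r⁻¹ ^ (n + 1) * a ^ n) (1 / (r - a)) := by
    have h2 := (hasSum_geometric_of_lt_one (div_nonneg ha hr0.le)
      ((div_lt_one hr0).2 haq)).mul_left r⁻¹
    have h3 : r - a ≠ 0 := by linarith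
    rw [show 1 / (r - a) = r⁻¹ * (1 - a / r)⁻¹ by
      rw [one_sub_div hr0.ne', inv_div]; field_simp]
    refine h2.congr_fun fun n => ?_
    rw [pow_succ, div_pow, inv_pow]
    ring
  rw [← ENNReal.ofReal_tsum_of_nonneg (fun n => by positivity) h1.summable, h1.tsum_eq]

/-- The renewal equation for the atoms of the resolvent. -/
theorem resolvent_singleton (lam : Measure ℝ) [IsFiniteMeasure lam] {q : ℝ} (hq : 0 < q) (x : ℝ) :
    resolvent lam q {x} = ENNReal.ofReal (q + lam.real univ)⁻¹ *
      (Measure.dirac 0 {x} + ∫⁻ y, resolvent lam q {x - y} ∂lam) := by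
  have hm : 0 ≤ lam.real univ := measureReal_nonneg
  simp_rw [resolvent_apply lam q (measurableSet_singleton _)]
  rw [tsum_eq_zero_add' ENNReal.summable, mul_add]
  have hmeas : ∀ n, Measurable fun y => convPow lam n {x - y} := by
    intro n
    have : (fun y => convPow lam n {x - y})
        = fun y => convPow lam n (Prod.mk y ⁻¹' {p : ℝ × ℝ | p.1 + p.2 = x}) := by
      ext y
      congr 1
      ext z
      simp only [mem_singleton_iff, mem_preimage, mem_ofPred_eq]
      constructor <;> intro h <;> linarith
    rw [this]
    exact measurable_measure_prodMk_left
      (measurableSet_eq_fun (by fun_prop) (by fun_prop))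
  congr 1
  · simp [convPow]
  · rw [lintegral_tsum fun n => ((hmeas n).const_mul _).aemeasurable, ← ENNReal.tsum_mul_left]
    congr 1 with n
    rw [lintegral_const_mul _ (hmeas n), convPow_succ_singleton, ← mul_assoc,
      ← ENNReal.ofReal_mul (by positivity)]
    congr 2
    rw [pow_succ (_ : ℝ) (n + 1), mul_comm]

theorem ae_convPow_lattice {lam : Measure ℝ} [IsFiniteMeasure lam] {h : ℝ}
    (hl : ∀ᵐ x ∂lam, ∃ k : ℤ, x = h * k) (n : ℕ) :
    ∀ᵐ x ∂(convPow lam n), ∃ k : ℤ, x = h * k := by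
  have hms : MeasurableSet {x : ℝ | ∃ k : ℤ, x = h * k} := by
    have : {x : ℝ | ∃ k : ℤ, x = h * k} = range fun k : ℤ => h * (k : ℝ) := by
      ext x; simp [eq_comm]
    rw [this]
    exact (countable_range _).measurableSet
  induction n with
  | zero =>
    rw [convPow, ae_dirac_iff hms]
    exact ⟨0, by simp⟩
  | succ n ih =>
    rw [convPow, Measure.conv, ae_map_iff (by fun_prop) hms]
    have h1 : MeasurableSet {p : ℝ × ℝ | ∃ k : ℤ, p.1 + p.2 = h * k} :=
      (measurable_fst.add measurable_snd) hms
    rw [Measure.ae_prod_iff_ae_ae h1]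
    filter_upwards [hl] with x hx
    filter_upwards [ih] with y hy
    obtain ⟨j, rfl⟩ := hx
    obtain ⟨k, rfl⟩ := hy
    exact ⟨j + k, by push_cast; ring⟩

theorem restrict_eq_sum_dirac {μ : Measure ℝ} {c : ℕ → ℝ} (hc : Function.Injective c) {s : Set ℝ}
    (hs : ∀ᵐ x ∂μ, x ∈ s ↔ x ∈ range c) :
    μ.restrict s = Measure.sum fun k => μ {c k} • Measure.dirac (c k) := by
  have h1 : s =ᵐ[μ] ⋃ k, {c k} := by
    filter_upwards [hs] with x hx
    refine propext (hx.trans ?_)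
    change _ ↔ x ∈ ⋃ k, {c k}
    simp [eq_comm]
  rw [Measure.restrict_congr_set h1, Measure.restrict_iUnion]
  · simp_rw [Measure.restrict_singleton]
  · intro i j hij
    simpa [Function.onFun] using hc.ne hij
  · exact fun k => measurableSet_singleton _

namespace IsSkipFreeMeasure

variable {lam : Measure ℝ} {h : ℝ}

theorem ae_cpLaw_lattice (H : IsSkipFreeMeasure lam h) (t : ℝ) :
    ∀ᵐ x ∂(cpLaw lam t), ∃ k : ℤ, x = h * k := by
  have := H.finite
  rw [cpLaw, Measure.ae_sum_iff]
  exact fun n => Measure.ae_smul_measure (ae_convPow_lattice H.ae_lattice n) _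

theorem ae_resolvent_lattice (H : IsSkipFreeMeasure lam h) (q : ℝ) :
    ∀ᵐ x ∂(resolvent lam q), ∃ k : ℤ, x = h * k := by
  have := H.finite
  rw [resolvent, Measure.ae_sum_iff]
  exact fun n => Measure.ae_smul_measure (ae_convPow_lattice H.ae_lattice n) _

theorem injective_pos_lattice (H : IsSkipFreeMeasure lam h) :
    Function.Injective fun k : ℕ => h * ((k : ℝ) + 1) := by
  intro a b hab
  have := mul_left_cancel₀ H.h_pos.ne' hab
  exact_mod_cast add_right_cancel this

theorem injective_neg_lattice (H : IsSkipFreeMeasure lam h) :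
    Function.Injective fun k : ℕ => -(h * ((k : ℝ) + 1)) := fun _ _ hab =>
  H.injective_pos_lattice (neg_injective hab)

theorem mem_Ioi_iff (H : IsSkipFreeMeasure lam h) {x : ℝ} (hx : ∃ k : ℤ, x = h * k) :
    x ∈ Ioi (0 : ℝ) ↔ x ∈ range fun k : ℕ => h * ((k : ℝ) + 1) := by
  obtain ⟨k, rfl⟩ := hx
  simp only [mem_Ioi, mem_range]
  rw [mul_pos_iff_of_pos_left H.h_pos]
  constructor
  · intro hk
    have hk' : 0 < k := by exact_mod_cast hk
    obtain ⟨n, hn⟩ := Int.eq_ofNat_of_zero_le (show 0 ≤ k - 1 by omega)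
    have hn' : (k : ℝ) - 1 = n := by exact_mod_cast hn
    exact ⟨n, by rw [← hn']; ring⟩
  · rintro ⟨j, hj⟩
    rw [← mul_left_cancel₀ H.h_pos.ne' hj]
    positivity

theorem mem_Iio_iff (H : IsSkipFreeMeasure lam h) {x : ℝ} (hx : ∃ k : ℤ, x = h * k) :
    x ∈ Iio (0 : ℝ) ↔ x ∈ range fun k : ℕ => -(h * ((k : ℝ) + 1)) := by
  have h1 := H.mem_Ioi_iff (x := -x) (by
    obtain ⟨k, rfl⟩ := hx
    exact ⟨-k, by push_cast; ring⟩)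
  simp only [mem_Ioi, mem_range, Left.neg_pos_iff] at h1
  rw [mem_Iio, h1]
  simp only [mem_range, neg_eq_iff_eq_neg]

theorem restrict_Ioi (H : IsSkipFreeMeasure lam h) {μ : Measure ℝ}
    (hμ : ∀ᵐ x ∂μ, ∃ k : ℤ, x = h * k) :
    μ.restrict (Ioi 0) = Measure.sum fun k : ℕ =>
      μ {h * ((k : ℝ) + 1)} • Measure.dirac (h * ((k : ℝ) + 1)) :=
  restrict_eq_sum_dirac H.injective_pos_lattice (hμ.mono fun _ hx => H.mem_Ioi_iff hx)

theorem restrict_Iio (H : IsSkipFreeMeasure lam h) {μ : Measure ℝ}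
    (hμ : ∀ᵐ x ∂μ, ∃ k : ℤ, x = h * k) :
    μ.restrict (Iio 0) = Measure.sum fun k : ℕ =>
      μ {-(h * ((k : ℝ) + 1))} • Measure.dirac (-(h * ((k : ℝ) + 1))) :=
  restrict_eq_sum_dirac H.injective_neg_lattice (hμ.mono fun _ hx => H.mem_Iio_iff hx)

theorem integral_cexp_cpLaw (H : IsSkipFreeMeasure lam h) {β : ℂ} (hβ : 0 ≤ β.re) {t : ℝ}
    (ht : 0 ≤ t) : Integrable (fun x : ℝ => Complex.exp (β * x)) (cpLaw lam t) ∧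
      ∫ x : ℝ, Complex.exp (β * x) ∂(cpLaw lam t) = Complex.exp (t * psi lam β) := by
  have := H.finite
  have h1 := integral_cpLaw (lam := lam) (f := fun x : ℝ => Complex.exp (β * x)) (by fun_prop)
    (by simp) (fun x y => by push_cast; rw [mul_add, Complex.exp_add]) (H.integrable_cexp hβ) ht
  rw [H.integral_cexp hβ, add_sub_cancel_right] at h1
  exact h1

theorem integral_exp_cpLaw (H : IsSkipFreeMeasure lam h) {β : ℝ} (hβ : 0 ≤ β) {t : ℝ}
    (ht : 0 ≤ t) : Integrable (fun x : ℝ => Real.exp (β * x)) (cpLaw lam t) ∧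
      ∫ x : ℝ, Real.exp (β * x) ∂(cpLaw lam t) = Real.exp (t * psiReal lam β) := by
  have h1 := H.integral_cexp_cpLaw (β := β) (by simpa using hβ) ht
  rw [psi_ofReal] at h1
  constructor
  · refine h1.1.re.congr (ae_of_all _ fun x => ?_)
    change (Complex.exp (β * x)).re = _
    rw [← Complex.ofReal_mul, Complex.exp_ofReal_re]
  · have h2 := h1.2
    rw [← Complex.ofReal_mul, ← Complex.ofReal_exp] at h2
    rw [← Complex.ofReal_inj, ← h2, ← integral_complex_ofReal]
    congr 1 with x
    push_cast
    rfl

/-- Two upward jumps in a short time have a probability of second order. -/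
theorem setIntegral_exp_Ici_le (H : IsSkipFreeMeasure lam h) {b : ℝ} (hb : 0 ≤ b) {t : ℝ}
    (ht : 0 < t) (ht1 : t ≤ 1) :
    ∫ x in Ici (2 * h), Real.exp (b * x) ∂(cpLaw lam t)
      ≤ Real.exp (lam.real univ * Real.exp (b * h)) * t ^ 2 := by
  set θ := -Real.log t / h with hθ
  have hθ0 : 0 ≤ θ := div_nonneg (neg_nonneg.2 (Real.log_nonpos ht.le ht1)) H.h_pos.le
  have hθh : θ * h = -Real.log t := div_mul_cancel₀ _ H.h_pos.ne'
  obtain ⟨hI, hE⟩ := H.integral_exp_cpLaw (β := b + θ) (by positivity) ht.le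
  obtain ⟨hI', -⟩ := H.integral_exp_cpLaw hb ht.le
  have h1 : ∫ x in Ici (2 * h), Real.exp (b * x) ∂(cpLaw lam t)
      ≤ ∫ x in Ici (2 * h), t ^ 2 * Real.exp ((b + θ) * x) ∂(cpLaw lam t) := by
    refine setIntegral_mono_on hI'.integrableOn (hI.const_mul _).integrableOn measurableSet_Ici
      fun x hx => ?_
    have h2 : t ^ 2 = Real.exp (-(2 * (θ * h))) := by
      rw [hθh, mul_neg, neg_neg, two_mul, Real.exp_add, Real.exp_log ht, sq]
    rw [h2, ← Real.exp_add]
    refine Real.exp_le_exp.2 ?_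
    have := mul_le_mul_of_nonneg_left (mem_Ici.1 hx) hθ0
    linarith
  have h3 : ∫ x in Ici (2 * h), t ^ 2 * Real.exp ((b + θ) * x) ∂(cpLaw lam t)
      ≤ ∫ x, t ^ 2 * Real.exp ((b + θ) * x) ∂(cpLaw lam t) :=
    setIntegral_le_integral (hI.const_mul _) (ae_of_all _ fun x => by positivity)
  rw [integral_const_mul (t ^ 2) (fun x => Real.exp ((b + θ) * x)) (μ := cpLaw lam t), hE] at h3
  refine h1.trans (h3.trans ?_)
  rw [mul_comm]
  refine mul_le_mul_of_nonneg_right (Real.exp_le_exp.2 ?_) (by positivity)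
  have h4 := mul_le_mul_of_nonneg_left (H.psiReal_le (β := b + θ) (by positivity)) ht.le
  refine h4.trans (le_of_eq ?_)
  rw [add_mul, Real.exp_add, hθh, Real.exp_neg, Real.exp_log ht]
  field_simp

theorem lintegral_exp_resolvent (H : IsSkipFreeMeasure lam h) {q β : ℝ} (hβ : 0 ≤ β)
    (hβq : psiReal lam β < q) :
    ∫⁻ x, ENNReal.ofReal (Real.exp (β * x)) ∂(resolvent lam q)
      = ENNReal.ofReal (1 / (q - psiReal lam β)) := by
  have := H.finite
  have h1 := H.integral_exp hβ
  rw [lintegral_resolvent (a := psiReal lam β + lam.real univ) (by fun_prop) (by simp) _ _ _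
    (by linarith)]
  · congr 2; ring
  · intro x y
    rw [mul_add, Real.exp_add, ENNReal.ofReal_mul (Real.exp_pos _).le]
  · rw [← h1]; exact integral_nonneg fun x => (Real.exp_pos _).le
  · rw [← h1, ofReal_integral_eq_lintegral_ofReal (H.integrable_exp hβ)
      (ae_of_all _ fun x => (Real.exp_pos _).le)]

theorem resolvent_univ (H : IsSkipFreeMeasure lam h) {q : ℝ} (hq : 0 < q) :
    resolvent lam q univ = ENNReal.ofReal q⁻¹ := by
  have := H.lintegral_exp_resolvent (q := q) le_rfl (by rw [psiReal_zero]; exact hq)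
  simpa [psiReal_zero] using this

theorem isFiniteMeasure_resolvent (H : IsSkipFreeMeasure lam h) {q : ℝ} (hq : 0 < q) :
    IsFiniteMeasure (resolvent lam q) :=
  ⟨by rw [H.resolvent_univ hq]; exact ENNReal.ofReal_lt_top⟩

theorem resolvent_real_le (H : IsSkipFreeMeasure lam h) {q : ℝ} (hq : 0 < q) (s : Set ℝ) :
    (resolvent lam q).real s ≤ q⁻¹ := by
  have := H.isFiniteMeasure_resolvent hq
  refine (measureReal_mono (subset_univ s)).trans_eq ?_
  rw [measureReal_def, H.resolvent_univ hq, ENNReal.toReal_ofReal (inv_nonneg.2 hq.le)]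

theorem measurable_singleton_sub (μ : Measure ℝ) [SFinite μ] (x : ℝ) :
    Measurable fun y => μ {x - y} := by
  have : (fun y => μ {x - y})
      = fun y => μ (Prod.mk y ⁻¹' {p : ℝ × ℝ | p.1 + p.2 = x}) := by
    ext y
    congr 1
    ext z
    simp only [mem_singleton_iff, mem_preimage, mem_ofPred_eq]
    constructor <;> intro h <;> linarith
  rw [this]
  exact measurable_measure_prodMk_left (measurableSet_eq_fun (by fun_prop) (by fun_prop))

theorem resolvent_real_singleton (H : IsSkipFreeMeasure lam h) {q : ℝ} (hq : 0 < q) {x : ℝ}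
    (hx : x ≠ 0) : (q + lam.real univ) * (resolvent lam q).real {x}
      = ∫ y, (resolvent lam q).real {x - y} ∂lam := by
  have := H.finite
  have := H.isFiniteMeasure_resolvent hq
  have hm := H.mass_pos
  have h1 := congrArg ENNReal.toReal (resolvent_singleton lam hq x)
  have h0 : Measure.dirac (0 : ℝ) {x} = 0 := by simp [hx.symm]
  rw [h0, zero_add, ENNReal.toReal_mul, ENNReal.toReal_ofReal (by positivity),
    ← integral_toReal (measurable_singleton_sub _ x).aemeasurable
      (ae_of_all _ fun y => measure_lt_top _ _)] at h1
  change _ * (resolvent lam q {x}).toReal = _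
  rw [h1, mul_inv_cancel_left₀ (by positivity)]
  rfl

theorem resolvent_lattice_eq (H : IsSkipFreeMeasure lam h) {q : ℝ} (hq : 0 < q) (k : ℕ) :
    (resolvent lam q).real {h * (k : ℝ)}
      = (resolvent lam q).real {0} * Real.exp (-(Phi lam q * (h * k))) := by
  have := H.finite
  have := H.isFiniteMeasure_resolvent hq
  have hm := H.mass_pos
  have hΦ := H.Phi_pos hq
  set u : ℝ → ℝ := fun x => (resolvent lam q).real {x} with hu
  set v : ℝ → ℝ := fun x => u x - u 0 * Real.exp (-(Phi lam q * x)) with hv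
  set M := ⨆ k : ℕ, |v (h * k)| with hM
  have hu0 : ∀ x, 0 ≤ u x := fun x => measureReal_nonneg
  have huq : ∀ x, u x ≤ q⁻¹ := fun x => H.resolvent_real_le hq _
  have hbdd : BddAbove (range fun k : ℕ => |v (h * k)|) := by
    refine ⟨q⁻¹ + q⁻¹, ?_⟩
    rintro _ ⟨k, rfl⟩
    have h1 : Real.exp (-(Phi lam q * (h * k))) ≤ 1 :=
      Real.exp_le_one_iff.2 (by have := H.h_pos; simp only [Left.neg_nonpos_iff]; positivity)
    have h2 : u 0 * Real.exp (-(Phi lam q * (h * k))) ≤ q⁻¹ :=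
      (mul_le_of_le_one_right (hu0 0) h1).trans (huq 0)
    have h3 : 0 ≤ u 0 * Real.exp (-(Phi lam q * (h * k))) :=
      mul_nonneg (hu0 0) (Real.exp_pos _).le
    simp only [hv, abs_le]
    constructor <;> linarith [hu0 (h * k), huq (h * k)]
  have hle : ∀ k : ℕ, |v (h * k)| ≤ M := fun k => le_ciSup hbdd k
  have hM0 : 0 ≤ M := (abs_nonneg _).trans (hle 0)
  have hstep : ∀ k : ℕ, (q + lam.real univ) * |v (h * k)| ≤ lam.real univ * M := by
    intro k
    rcases Nat.eq_zero_or_pos k with rfl | hk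
    · simp only [hv, Nat.cast_zero, mul_zero, neg_zero, Real.exp_zero, mul_one, sub_self, abs_zero]
      positivity
    have hx : h * (k : ℝ) ≠ 0 := mul_ne_zero H.h_pos.ne' (by positivity)
    have h1 := H.resolvent_real_singleton hq hx
    have hint : Integrable (fun y => u (h * k - y)) lam := by
      refine Integrable.of_bound (C := q⁻¹) ?_ (ae_of_all _ fun y => ?_)
      · exact (measurable_singleton_sub _ _).ennreal_toReal.aestronglyMeasurable
      · rw [Real.norm_eq_abs, abs_of_nonneg (hu0 _)]; exact huq _
    have hexp : ∀ y, u 0 * Real.exp (-(Phi lam q * (h * k - y)))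
        = u 0 * Real.exp (-(Phi lam q * (h * k))) * Real.exp (Phi lam q * y) := fun y => by
      rw [mul_assoc, ← Real.exp_add]; congr 2; ring
    have h2 : (q + lam.real univ) * v (h * k) = ∫ y, v (h * k - y) ∂lam := by
      simp only [hv]
      simp_rw [hexp]
      rw [integral_sub hint ((H.integrable_exp hΦ.le).const_mul _), integral_const_mul,
        H.integral_exp hΦ.le, H.psiReal_Phi hq, ← h1]
      ring
    rw [← abs_of_pos (by positivity : 0 < q + lam.real univ), ← abs_mul, h2]
    have h3 : ‖∫ y, v (h * k - y) ∂lam‖ ≤ M * lam.real univ := by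
      refine norm_integral_le_of_norm_le_const ?_
      filter_upwards [H.ae_le, H.ae_lattice] with y hy hyl
      obtain ⟨j, rfl⟩ := hyl
      have hj : j ≤ 1 := by
        have := le_of_mul_le_mul_left (hy.trans_eq (mul_one h).symm) H.h_pos
        exact_mod_cast this
      obtain ⟨n, hn⟩ := Int.eq_ofNat_of_zero_le (show 0 ≤ (k : ℤ) - j by omega)
      have hn' : (k : ℝ) - j = n := by exact_mod_cast hn
      have h4 : h * (k : ℝ) - h * j = h * (n : ℝ) := by rw [← hn']; ring
      rw [h4, Real.norm_eq_abs]
      exact hle _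
    rw [mul_comm M] at h3
    exact h3
  have hMle : M ≤ lam.real univ * M / (q + lam.real univ) :=
    ciSup_le fun k => by
      rw [le_div_iff₀ (by positivity), mul_comm]
      exact hstep k
  have hMzero : M = 0 := by
    rw [le_div_iff₀ (by positivity)] at hMle
    nlinarith
  have := abs_eq_zero.1 (le_antisymm ((hle k).trans_eq hMzero) (abs_nonneg _))
  exact sub_eq_zero.1 this

end IsSkipFreeMeasure

namespace IsSkipFreeMeasure

variable {lam : Measure ℝ} {h : ℝ}

theorem hasSum_setIntegral_Ioi {E : Type*} [NormedAddCommGroup E] [NormedSpace ℝ E]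
    [CompleteSpace E] (H : IsSkipFreeMeasure lam h)
    {μ : Measure ℝ} (hμ : ∀ᵐ x ∂μ, ∃ k : ℤ, x = h * k) {f : ℝ → E}
    (hf : IntegrableOn f (Ioi 0) μ) :
    HasSum (fun k : ℕ => μ.real {h * ((k : ℝ) + 1)} • f (h * ((k : ℝ) + 1)))
      (∫ x in Ioi 0, f x ∂μ) := by
  rw [IntegrableOn, H.restrict_Ioi hμ] at hf
  rw [H.restrict_Ioi hμ]
  refine (hasSum_integral_measure hf).congr_fun fun k => ?_
  rw [integral_smul_measure, integral_dirac]
  rfl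

theorem hasSum_setIntegral_Iio {E : Type*} [NormedAddCommGroup E] [NormedSpace ℝ E]
    [CompleteSpace E] (H : IsSkipFreeMeasure lam h)
    {μ : Measure ℝ} (hμ : ∀ᵐ x ∂μ, ∃ k : ℤ, x = h * k) {f : ℝ → E}
    (hf : IntegrableOn f (Iio 0) μ) :
    HasSum (fun k : ℕ => μ.real {-(h * ((k : ℝ) + 1))} • f (-(h * ((k : ℝ) + 1))))
      (∫ x in Iio 0, f x ∂μ) := by
  rw [IntegrableOn, H.restrict_Iio hμ] at hf
  rw [H.restrict_Iio hμ]
  refine (hasSum_integral_measure hf).congr_fun fun k => ?_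
  rw [integral_smul_measure, integral_dirac]
  rfl

theorem resolvent_real_zero (H : IsSkipFreeMeasure lam h) {q : ℝ} (hq : 0 < q) :
    (resolvent lam q).real {0} = h / deriv (psiReal lam) (Phi lam q) := by
  have := H.isFiniteMeasure_resolvent hq
  have hh := H.h_pos
  set b := Phi lam q with hb
  have hb0 : 0 < b := H.Phi_pos hq
  set ρ := resolvent lam q with hρ
  have hψ : ∀ β, 0 ≤ β → β < b → psiReal lam β < q := fun β h0 h1 =>
    H.psiReal_lt hq (H.psiReal_Phi hq) h0 h1
  have hI : ∀ β, 0 ≤ β → β < b → Integrable (fun x => Real.exp (β * x)) ρ := by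
    intro β h0 h1
    refine ⟨by fun_prop, ?_⟩
    have := H.lintegral_exp_resolvent h0 (hψ β h0 h1)
    rw [hasFiniteIntegral_iff_norm]
    simp_rw [Real.norm_eq_abs, abs_of_pos (Real.exp_pos _)]
    rw [this]
    exact ENNReal.ofReal_lt_top
  have hE : ∀ β, 0 ≤ β → β < b → ∫ x, Real.exp (β * x) ∂ρ = 1 / (q - psiReal lam β) := by
    intro β h0 h1
    rw [integral_eq_lintegral_of_nonneg_ae (ae_of_all _ fun x => (Real.exp_pos _).le)
      (by fun_prop), H.lintegral_exp_resolvent h0 (hψ β h0 h1), ENNReal.toReal_ofReal]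
    exact one_div_nonneg.2 (sub_nonneg.2 (hψ β h0 h1).le)
  have hpos : ∀ β, 0 ≤ β → β < b → ∫ x in Ioi 0, Real.exp (β * x) ∂ρ
      = ρ.real {0} * (Real.exp ((β - b) * h) / (1 - Real.exp ((β - b) * h))) := by
    intro β h0 h1
    have h2 := H.hasSum_setIntegral_Ioi (H.ae_resolvent_lattice q) (hI β h0 h1).integrableOn
    have hr1 : Real.exp ((β - b) * h) < 1 :=
      Real.exp_lt_one_iff.2 (mul_neg_of_neg_of_pos (by linarith) hh)
    have h3 := ((hasSum_geometric_of_lt_one (Real.exp_pos ((β - b) * h)).le hr1).mul_left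
      (Real.exp ((β - b) * h))).mul_left (ρ.real {0})
    rw [div_eq_mul_inv]
    refine h2.unique (h3.congr_fun fun k => ?_)
    have h4 := H.resolvent_lattice_eq hq (k + 1)
    rw [Nat.cast_add_one] at h4
    rw [h4, smul_eq_mul, mul_assoc, ← Real.exp_nat_mul, ← Real.exp_add, ← Real.exp_add]
    congr 2
    ring
  have hid : ∀ β, 0 ≤ β → β < b →
      ρ.real {0} * (Real.exp ((β - b) * h)
        * ((1 - Real.exp ((β - b) * h)) / (q - psiReal lam β))⁻¹)
      + (∫ x in Iic 0, Real.exp (β * x) ∂ρ) * (q - psiReal lam β) = 1 := by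
    intro β h0 h1
    have h2 := integral_add_compl (measurableSet_Iic (a := (0 : ℝ))) (hI β h0 h1)
    rw [compl_Iic, hE β h0 h1, hpos β h0 h1] at h2
    have h3 : q - psiReal lam β ≠ 0 := (sub_pos.2 (hψ β h0 h1)).ne'
    rw [eq_div_iff h3] at h2
    rw [inv_div]
    refine Eq.trans ?_ h2
    ring
  have hR : ∀ β, 0 ≤ β → β < b → |∫ x in Iic 0, Real.exp (β * x) ∂ρ| ≤ q⁻¹ := by
    intro β h0 h1
    rw [← Real.norm_eq_abs]
    refine (norm_setIntegral_le_of_norm_le_const (C := 1) (measure_lt_top _ _) fun x hx => ?_).trans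
      ?_
    · rw [Real.norm_eq_abs, abs_of_pos (Real.exp_pos _)]
      exact Real.exp_le_one_iff.2 (mul_nonpos_of_nonneg_of_nonpos h0 hx)
    · rw [one_mul]; exact H.resolvent_real_le hq _
  have hev : ∀ᶠ β in 𝓝[<] b, 0 ≤ β ∧ β < b := by
    filter_upwards [self_mem_nhdsWithin, mem_nhdsWithin_of_mem_nhds (lt_mem_nhds hb0)] with β h1 h2
    exact ⟨le_of_lt h2, h1⟩
  have hψc : ContinuousAt (psiReal lam) b :=
    (H.hasStrictDerivAt_psiReal hb0).hasDerivAt.continuousAt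
  have hlim0 : Tendsto (fun β => q - psiReal lam β) (𝓝[<] b) (𝓝 0) := by
    have : Tendsto (fun β => q - psiReal lam β) (𝓝 b) (𝓝 (q - psiReal lam b)) :=
      tendsto_const_nhds.sub hψc
    rw [H.psiReal_Phi hq, sub_self] at this
    exact this.mono_left nhdsWithin_le_nhds
  have hlim1 := bdd_le_mul_tendsto_zero' q⁻¹ (hev.mono fun β hβ => hR β hβ.1 hβ.2) hlim0
  have hlim2 : Tendsto (fun β => Real.exp ((β - b) * h)) (𝓝[<] b) (𝓝 1) := by
    have : Tendsto (fun β => Real.exp ((β - b) * h)) (𝓝 b) (𝓝 (Real.exp ((b - b) * h))) :=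
      Continuous.tendsto (by fun_prop) b
    rw [sub_self, zero_mul, Real.exp_zero] at this
    exact this.mono_left nhdsWithin_le_nhds
  have hd := H.deriv_psiReal_pos hq
  have hlim3 := ((H.tendsto_slope_quotient hq).mono_left
    (nhdsWithin_mono b fun x (hx : x < b) => hx.ne)).inv₀ (div_pos hh hd).ne'
  have hlim := ((hlim2.mul hlim3).const_mul (ρ.real {0})).add hlim1
  have hone := tendsto_nhds_unique (hlim.congr' (hev.mono fun β hβ => hid β hβ.1 hβ.2))
    tendsto_const_nhds
  rw [add_zero, one_mul, inv_div] at hone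
  rw [← hb] at hd hone
  rw [eq_div_iff hd.ne', ← div_mul_cancel₀ (_ * _) hh.ne', mul_div_assoc, hone, one_mul]

theorem resolvent_pos_lattice (H : IsSkipFreeMeasure lam h) {q : ℝ} (hq : 0 < q) (k : ℕ) :
    resolvent lam q {h * ((k : ℝ) + 1)} = ENNReal.ofReal
      (h * (deriv (psiReal lam) (Phi lam q))⁻¹ * Real.exp (-(Phi lam q * (h * (k + 1))))) := by
  have := H.isFiniteMeasure_resolvent hq
  have h1 := H.resolvent_lattice_eq hq (k + 1)
  rw [Nat.cast_add_one, H.resolvent_real_zero hq, div_eq_mul_inv] at h1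
  rw [← h1, ofReal_measureReal]

theorem lintegral_exp_Ioi {t : ℝ} (ht : 0 < t) (q : ℝ) :
    ∫⁻ r in Ioi q, ENNReal.ofReal (Real.exp (-(r * t)))
      = ENNReal.ofReal (Real.exp (-(q * t)) / t) := by
  have h1 : ∀ r, Real.exp (-(r * t)) = Real.exp (-t * r) := fun r => by congr 1; ring
  simp_rw [h1]
  rw [← ofReal_integral_eq_lintegral_ofReal (integrableOn_exp_mul_Ioi (neg_lt_zero.2 ht) q)
    (ae_of_all _ fun r => (Real.exp_pos _).le), integral_exp_mul_Ioi (neg_lt_zero.2 ht), neg_div_neg_eq]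

/-- Kendall's identity: `∫ e^{-qt} P(X_t = kh) / t dt = e^{-Φ(q)kh} / k`. -/
theorem kendall (H : IsSkipFreeMeasure lam h) {q : ℝ} (hq : 0 < q) (k : ℕ) :
    ∫⁻ t in Ioi (0 : ℝ), ENNReal.ofReal (Real.exp (-(q * t)) / t)
        * cpLaw lam t {h * ((k : ℝ) + 1)}
      = ENNReal.ofReal (Real.exp (-(Phi lam q * (h * (k + 1)))) / (k + 1)) := by
  have := H.finite
  have hh := H.h_pos
  set x := h * ((k : ℝ) + 1) with hx
  have hx0 : 0 < x := by positivity
  have hmeas := measurable_cpLaw_apply lam (measurableSet_singleton x)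
  have h1 : ∀ t ∈ Ioi (0 : ℝ), ENNReal.ofReal (Real.exp (-(q * t)) / t) * cpLaw lam t {x}
      = ∫⁻ r in Ioi q, ENNReal.ofReal (Real.exp (-(r * t))) * cpLaw lam t {x} := by
    intro t ht
    rw [lintegral_mul_const _ (by fun_prop), lintegral_exp_Ioi ht]
  rw [setLIntegral_congr_fun measurableSet_Ioi h1, lintegral_lintegral_swap]
  swap
  · refine Measurable.aemeasurable ?_
    refine Measurable.mul ?_ (hmeas.comp measurable_fst)
    fun_prop
  have h2 : ∀ r ∈ Ioi q, ∫⁻ t in Ioi (0 : ℝ), ENNReal.ofReal (Real.exp (-(r * t)))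
      * cpLaw lam t {x} = ENNReal.ofReal
      (h * (deriv (psiReal lam) (Phi lam r))⁻¹ * Real.exp (-(Phi lam r * x))) := by
    intro r hr
    have hr0 : 0 < r := hq.trans hr
    rw [lintegral_exp_mul_cpLaw lam hr0 (measurableSet_singleton x)]
    exact H.resolvent_pos_lattice hr0 k
  rw [setLIntegral_congr_fun measurableSet_Ioi h2]
  have hderiv : ∀ r, 0 < r → HasDerivAt (fun r => -(Real.exp (-(Phi lam r * x)) / (k + 1)))
      (h * (deriv (psiReal lam) (Phi lam r))⁻¹ * Real.exp (-(Phi lam r * x))) r := by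
    intro r hr
    have := ((((H.hasDerivAt_Phi hr).mul_const x).neg.exp).div_const ((k : ℝ) + 1)).neg
    refine this.congr_deriv ?_
    change -(Real.exp (-(Phi lam r * x)) * -((deriv (psiReal lam) (Phi lam r))⁻¹ * x) / (k + 1)) = _
    have h3 : x / ((k : ℝ) + 1) = h := by rw [hx]; field_simp
    rw [← h3]
    ring
  have hlim : Tendsto (fun r => -(Real.exp (-(Phi lam r * x)) / (k + 1))) atTop (𝓝 0) := by
    have h3 : Tendsto (fun r => Real.exp (-(Phi lam r * x))) atTop (𝓝 0) :=
      Real.tendsto_exp_neg_atTop_nhds_zero.comp (H.tendsto_Phi_atTop.atTop_mul_const hx0)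
    simpa using (h3.div_const ((k : ℝ) + 1)).neg
  have hnn : ∀ r ∈ Ioi q,
      0 ≤ h * (deriv (psiReal lam) (Phi lam r))⁻¹ * Real.exp (-(Phi lam r * x)) := by
    intro r hr
    have := H.deriv_psiReal_pos (hq.trans hr)
    positivity
  have hcont := (hderiv q hq).continuousAt.continuousWithinAt (s := Ici q)
  have hint := integrableOn_Ioi_deriv_of_nonneg hcont
    (fun r hr => hderiv r (hq.trans hr)) hnn hlim
  rw [← ofReal_integral_eq_lintegral_ofReal hint
    ((ae_restrict_mem measurableSet_Ioi).mono hnn),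
    integral_Ioi_of_hasDerivAt_of_tendsto hcont (fun r hr => hderiv r (hq.trans hr)) hint hlim]
  congr 1
  ring

end IsSkipFreeMeasure

/-- Frullani's integral for a complex parameter. -/
theorem integrableOn_frullani_and_integral {w : ℂ} (hw : 0 < w.re) :
    IntegrableOn (fun t : ℝ => (Complex.exp (-t) - Complex.exp (-w * t)) / t) (Ioi 0) ∧
      ∫ t in Ioi (0 : ℝ), (Complex.exp (-t) - Complex.exp (-w * t)) / t = Complex.log w := by
  set c := min 1 w.re with hc
  have hc0 : 0 < c := lt_min one_pos hw
  set z : ℝ → ℂ := fun θ => 1 + θ * (w - 1) with hz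
  have hzre : ∀ θ ∈ Icc (0 : ℝ) 1, c ≤ (z θ).re := by
    intro θ hθ
    have h1 : (z θ).re = (1 - θ) * 1 + θ * w.re := by simp [hz]; ring
    rw [h1]
    have h2 := mul_le_mul_of_nonneg_left (min_le_left 1 w.re) (sub_nonneg.2 hθ.2)
    have h3 := mul_le_mul_of_nonneg_left (min_le_right 1 w.re) hθ.1
    linarith
  set F : ℝ → ℝ → ℂ := fun t θ => (w - 1) * Complex.exp (-z θ * t) with hF
  have hFint : Integrable (Function.uncurry F)
      ((volume.restrict (Ioi (0 : ℝ))).prod (volume.restrict (Ioc (0 : ℝ) 1))) := by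
    have h1 : Integrable (fun p : ℝ × ℝ => ‖w - 1‖ * Real.exp (-c * p.1) * (1 : ℝ))
        ((volume.restrict (Ioi (0 : ℝ))).prod (volume.restrict (Ioc (0 : ℝ) 1))) :=
      ((integrableOn_exp_mul_Ioi (neg_lt_zero.2 hc0) 0).const_mul _).mul_prod
        (integrable_const (1 : ℝ))
    refine h1.mono' (by simp only [hF, hz]; fun_prop) ?_
    rw [Measure.prod_restrict]
    filter_upwards [ae_restrict_mem (measurableSet_Ioi.prod measurableSet_Ioc)] with p hp
    obtain ⟨hp1, hp2⟩ := hp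
    simp only [Function.uncurry, hF, norm_mul, mul_one]
    refine mul_le_mul_of_nonneg_left ?_ (norm_nonneg _)
    rw [Complex.norm_exp]
    refine Real.exp_le_exp.2 ?_
    have h2 := mul_le_mul_of_nonneg_right (hzre p.2 ⟨hp2.1.le, hp2.2⟩) (mem_Ioi.1 hp1).le
    simp only [Complex.mul_re, Complex.neg_re, Complex.ofReal_re, Complex.ofReal_im, mul_zero,
      sub_zero]
    linarith
  have hinner : ∀ t ∈ Ioi (0 : ℝ), ∫ θ in Ioc (0 : ℝ) 1, F t θ
      = (Complex.exp (-t) - Complex.exp (-w * t)) / t := by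
    intro t ht
    have ht0 : (t : ℂ) ≠ 0 := by exact_mod_cast (mem_Ioi.1 ht).ne'
    rw [← intervalIntegral.integral_of_le zero_le_one]
    have hd : ∀ θ ∈ uIcc (0 : ℝ) 1,
        HasDerivAt (fun θ : ℝ => -Complex.exp (-z θ * t) / t) (F t θ) θ := by
      intro θ _
      have h1 : HasDerivAt (fun θ : ℝ => -z θ * t) (-(w - 1) * t) θ := by
        have := ((Complex.ofRealCLM.hasDerivAt (x := θ)).mul_const (w - 1)).const_add 1
        simpa [hz] using this.neg.mul_const (t : ℂ)
      refine (h1.cexp.neg.div_const (t : ℂ)).congr_deriv ?_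
      simp only [hF]
      field_simp
    rw [intervalIntegral.integral_eq_sub_of_hasDerivAt hd
      (Continuous.intervalIntegrable (by simp only [hF, hz]; fun_prop) _ _)]
    simp only [hz]
    push_cast
    rw [zero_mul, add_zero, one_mul, add_sub_cancel]
    ring_nf
  have houter : ∀ θ ∈ Ioc (0 : ℝ) 1, ∫ t in Ioi (0 : ℝ), F t θ = (w - 1) / z θ := by
    intro θ hθ
    have h1 : (-z θ).re < 0 := by
      have := hzre θ ⟨hθ.1.le, hθ.2⟩
      rw [Complex.neg_re]; linarith
    simp only [hF]
    rw [integral_const_mul, integral_exp_mul_complex_Ioi h1]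
    simp [div_eq_mul_inv]
  constructor
  · have := hFint.integral_prod_left
    exact (integrable_congr ((ae_restrict_mem measurableSet_Ioi).mono hinner)).1 this
  · rw [← setIntegral_congr_fun measurableSet_Ioi hinner, integral_integral_swap hFint,
      setIntegral_congr_fun measurableSet_Ioc houter,
      ← intervalIntegral.integral_of_le zero_le_one]
    have hd : ∀ θ ∈ uIcc (0 : ℝ) 1,
        HasDerivAt (fun θ : ℝ => Complex.log (z θ)) ((w - 1) / z θ) θ := by
      intro θ hθ
      rw [uIcc_of_le zero_le_one] at hθ
      have h1 : HasDerivAt z (w - 1) θ := by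
        have := ((Complex.ofRealCLM.hasDerivAt (x := θ)).mul_const (w - 1)).const_add 1
        simpa [hz] using this
      exact h1.clog_real (Or.inl (hc0.trans_le (hzre θ hθ)))
    have hcont : ContinuousOn (fun θ : ℝ => (w - 1) / z θ) (uIcc 0 1) := by
      rw [uIcc_of_le zero_le_one]
      refine ContinuousOn.div continuousOn_const (by simp only [hz]; fun_prop) fun θ hθ h0 => ?_
      have := hzre θ hθ
      rw [h0] at this
      simp at this
      linarith
    rw [intervalIntegral.integral_eq_sub_of_hasDerivAt hd hcont.intervalIntegrable]
    simp [hz]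

/-- Termwise integration of a weighted Laplace transform over countably many atoms. -/
theorem integrableOn_and_hasSum_of_atoms {lam : Measure ℝ} [IsFiniteMeasure lam] {c : ℕ → ℝ}
    {s : Set ℝ} {q : ℝ} {γ : ℂ} {a : ℕ → ℝ} (ha0 : ∀ k, 0 ≤ a k)
    (hG : ∀ t, 0 < t → HasSum (fun k => (cpLaw lam t).real {c k} • Complex.exp (γ * c k))
      (∫ x in s, Complex.exp (γ * x) ∂(cpLaw lam t)))
    (ha : ∀ k, ∫⁻ t in Ioi (0 : ℝ), ENNReal.ofReal (Real.exp (-(q * t)) / t) * cpLaw lam t {c k}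
      = ENNReal.ofReal (a k))
    (hs : Summable fun k => a k * Real.exp (γ.re * c k)) :
    IntegrableOn (fun t : ℝ => Complex.exp (-q * t) / t
      * ∫ x in s, Complex.exp (γ * x) ∂(cpLaw lam t)) (Ioi 0) ∧
    HasSum (fun k => a k * Complex.exp (γ * c k)) (∫ t in Ioi (0 : ℝ), Complex.exp (-q * t) / t
      * ∫ x in s, Complex.exp (γ * x) ∂(cpLaw lam t)) := by
  set g : ℕ → ℝ → ℝ := fun k t => Real.exp (-(q * t)) / t * (cpLaw lam t).real {c k} with hg
  set F : ℕ → ℝ → ℂ := fun k t => (g k t : ℂ) * Complex.exp (γ * c k) with hF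
  have hgm : ∀ k, Measurable (g k) := fun k =>
    (by fun_prop : Measurable fun t : ℝ => Real.exp (-(q * t)) / t).mul
      (measurable_cpLaw_apply lam (measurableSet_singleton (c k))).ennreal_toReal
  have hg0 : ∀ k, ∀ t ∈ Ioi (0 : ℝ), 0 ≤ g k t := fun k t ht =>
    mul_nonneg (div_nonneg (Real.exp_pos _).le (mem_Ioi.1 ht).le) measureReal_nonneg
  have hgl : ∀ k, ∫⁻ t in Ioi (0 : ℝ), ENNReal.ofReal (g k t) = ENNReal.ofReal (a k) := by
    intro k
    rw [← ha k]
    refine setLIntegral_congr_fun measurableSet_Ioi fun t ht => ?_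
    have := isProbabilityMeasure_cpLaw lam (mem_Ioi.1 ht).le
    simp only [hg]
    rw [ENNReal.ofReal_mul (div_nonneg (Real.exp_pos _).le (mem_Ioi.1 ht).le), ofReal_measureReal]
  have hgI : ∀ k, IntegrableOn (g k) (Ioi 0) := fun k => by
    refine ⟨(hgm k).aestronglyMeasurable, ?_⟩
    rw [hasFiniteIntegral_iff_ofReal ((ae_restrict_mem measurableSet_Ioi).mono (hg0 k)), hgl k]
    exact ENNReal.ofReal_lt_top
  have hgi : ∀ k, ∫ t in Ioi (0 : ℝ), g k t = a k := fun k => by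
    rw [integral_eq_lintegral_of_nonneg_ae ((ae_restrict_mem measurableSet_Ioi).mono (hg0 k))
      (hgm k).aestronglyMeasurable, hgl k, ENNReal.toReal_ofReal (ha0 k)]
  have hFI : ∀ k, IntegrableOn (F k) (Ioi 0) := fun k => (hgI k).ofReal.mul_const _
  have hFi : ∀ k, ∫ t in Ioi (0 : ℝ), F k t = a k * Complex.exp (γ * c k) := fun k => by
    simp only [hF]
    rw [integral_mul_const, integral_complex_ofReal, hgi k]
  have hnorm : ∀ k, ∫ t in Ioi (0 : ℝ), ‖F k t‖ = a k * Real.exp (γ.re * c k) := fun k => by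
    rw [← hgi k, ← integral_mul_const]
    refine setIntegral_congr_fun measurableSet_Ioi fun t ht => ?_
    simp only [hF, norm_mul, Complex.norm_real, Real.norm_eq_abs, abs_of_nonneg (hg0 k t ht),
      Complex.norm_exp]
    simp
  have hsumF : ∀ t ∈ Ioi (0 : ℝ), HasSum (fun k => F k t) (Complex.exp (-q * t) / t
      * ∫ x in s, Complex.exp (γ * x) ∂(cpLaw lam t)) := by
    intro t ht
    refine ((hG t ht).mul_left _).congr_fun fun k => ?_
    simp only [hF, hg, Complex.real_smul]
    push_cast
    rw [neg_mul]
    ring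
  have hmain := hasSum_integral_of_summable_integral_norm hFI (by simpa only [hnorm] using hs)
  rw [setIntegral_congr_fun measurableSet_Ioi fun t ht => (hsumF t ht).tsum_eq] at hmain
  refine ⟨⟨?_, ?_⟩, by simpa only [hFi] using hmain⟩
  · refine aestronglyMeasurable_of_tendsto_ae (u := atTop)
      (f := fun S : Finset ℕ => fun t => ∑ k ∈ S, F k t) ?_ ?_
    · exact fun S => Finset.aestronglyMeasurable_fun_sum S fun k _ => (hFI k).1
    · exact (ae_restrict_mem measurableSet_Ioi).mono hsumF
  · refine lt_of_le_of_lt (lintegral_mono_ae (g := fun t => ∑' k, ‖F k t‖ₑ) ?_) ?_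
    · filter_upwards [ae_restrict_mem measurableSet_Ioi] with t ht
      rw [← (hsumF t ht).tsum_eq]
      exact enorm_tsum_le_tsum_enorm
    · rw [lintegral_tsum fun k => (hFI k).1.enorm]
      have : ∀ k, ∫⁻ t in Ioi (0 : ℝ), ‖F k t‖ₑ = ENNReal.ofReal (a k * Real.exp (γ.re * c k)) :=
        fun k => by rw [← hnorm k, ofReal_integral_norm_eq_lintegral_enorm (hFI k)]
      simp_rw [this]
      rw [← ENNReal.ofReal_tsum_of_nonneg (fun k => mul_nonneg (ha0 k) (Real.exp_pos _).le) hs]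
      exact ENNReal.ofReal_lt_top

namespace IsSkipFreeMeasure

variable {lam : Measure ℝ} {h : ℝ}

theorem hasSum_log_series {z : ℂ} (hz : ‖z‖ < 1) :
    HasSum (fun k : ℕ => z ^ (k + 1) / ((k : ℂ) + 1)) (-Complex.log (1 - z)) := by
  have h1 := Complex.hasSum_taylorSeries_neg_log hz
  rw [← hasSum_nat_add_iff' 1] at h1
  simpa using h1

theorem norm_exp_sub_Phi_lt (H : IsSkipFreeMeasure lam h) {b : ℝ} {γ : ℂ} (hγ : γ.re < b) :
    ‖Complex.exp ((γ - b) * h)‖ < 1 := by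
  rw [Complex.norm_exp, Real.exp_lt_one_iff]
  simp only [Complex.mul_re, Complex.sub_re, Complex.ofReal_re, Complex.sub_im, Complex.ofReal_im,
    sub_zero, mul_zero]
  exact mul_neg_of_neg_of_pos (by linarith) H.h_pos

theorem integrable_cexp_restrict_Ioi (H : IsSkipFreeMeasure lam h) (γ : ℂ) {t : ℝ} (ht : 0 < t) :
    IntegrableOn (fun x : ℝ => Complex.exp (γ * x)) (Ioi 0) (cpLaw lam t) := by
  have := H.finite
  refine (H.integral_exp_cpLaw (β := |γ.re|) (abs_nonneg _) ht.le).1.integrableOn.mono'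
    (by fun_prop) ?_
  filter_upwards [ae_restrict_mem measurableSet_Ioi] with x hx
  rw [Complex.norm_exp]
  refine Real.exp_le_exp.2 ?_
  simp only [Complex.mul_re, Complex.ofReal_re, Complex.ofReal_im, mul_zero, sub_zero]
  exact mul_le_mul_of_nonneg_right (le_abs_self _) (mem_Ioi.1 hx).le

theorem integrable_cexp_restrict_Iio (H : IsSkipFreeMeasure lam h) {γ : ℂ} (hγ : 0 ≤ γ.re)
    {t : ℝ} (ht : 0 < t) :
    IntegrableOn (fun x : ℝ => Complex.exp (γ * x)) (Iio 0) (cpLaw lam t) :=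
  (H.integral_cexp_cpLaw hγ ht.le).1.integrableOn

/-- The contribution of the upward half-line to the ladder exponents. -/
theorem integrableOn_and_integral_pos_part (H : IsSkipFreeMeasure lam h) {q : ℝ} (hq : 0 < q)
    {γ : ℂ} (hγ : γ.re < Phi lam q) :
    IntegrableOn (fun t : ℝ => Complex.exp (-q * t) / t
      * ∫ x in Ioi 0, Complex.exp (γ * x) ∂(cpLaw lam t)) (Ioi 0) ∧
    ∫ t in Ioi (0 : ℝ), Complex.exp (-q * t) / t
      * ∫ x in Ioi 0, Complex.exp (γ * x) ∂(cpLaw lam t)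
      = -Complex.log (1 - Complex.exp ((γ - Phi lam q) * h)) := by
  have := H.finite
  have hlog := hasSum_log_series (H.norm_exp_sub_Phi_lt hγ)
  have hterm : ∀ (γ : ℂ) (k : ℕ),
      ((Real.exp (-(Phi lam q * (h * (k + 1)))) / (k + 1) : ℝ) : ℂ)
        * Complex.exp (γ * (h * ((k : ℝ) + 1) : ℝ))
      = Complex.exp ((γ - Phi lam q) * h) ^ (k + 1) / ((k : ℂ) + 1) := by
    intro γ k
    rw [← Complex.exp_nat_mul]
    push_cast
    rw [div_mul_eq_mul_div, ← Complex.exp_add]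
    congr 2
    ring
  have hs : Summable fun k : ℕ => Real.exp (-(Phi lam q * (h * (k + 1)))) / (k + 1)
      * Real.exp (γ.re * (h * ((k : ℝ) + 1))) := by
    have h1 := (hasSum_log_series (z := Complex.exp (((γ.re : ℝ) - Phi lam q) * h))
      (H.norm_exp_sub_Phi_lt (by simpa using hγ))).summable
    simp_rw [← hterm] at h1
    exact_mod_cast h1
  have hmain := integrableOn_and_hasSum_of_atoms (lam := lam)
    (c := fun k : ℕ => h * ((k : ℝ) + 1)) (s := Ioi 0) (q := q) (γ := γ)
    (a := fun k => Real.exp (-(Phi lam q * (h * (k + 1)))) / (k + 1))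
    (fun k => by positivity)
    (fun t ht => H.hasSum_setIntegral_Ioi (f := fun x : ℝ => Complex.exp (γ * x)) (H.ae_cpLaw_lattice t)
      (H.integrable_cexp_restrict_Ioi γ ht))
    (fun k => H.kendall hq k) hs
  refine ⟨hmain.1, hmain.2.unique (hlog.congr_fun fun k => (hterm γ k))⟩

/-- The Laplace transform of `P(X_t = -(k+1)h) / t` in time. -/
def negWeight (lam : Measure ℝ) (h q : ℝ) (k : ℕ) : ℝ :=
  (∫⁻ t in Ioi (0 : ℝ), ENNReal.ofReal (Real.exp (-(q * t)) / t)
    * cpLaw lam t {-(h * ((k : ℝ) + 1))}).toReal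

theorem tsum_negWeight_lt_top (H : IsSkipFreeMeasure lam h) {q : ℝ} (hq : 0 < q) :
    ∑' k : ℕ, ∫⁻ t in Ioi (0 : ℝ), ENNReal.ofReal (Real.exp (-(q * t)) / t)
      * cpLaw lam t {-(h * ((k : ℝ) + 1))} < ∞ := by
  have := H.finite
  rw [← lintegral_tsum fun k => by
    have := measurable_cpLaw_apply lam (measurableSet_singleton (-(h * ((k : ℝ) + 1))))
    fun_prop]
  have h1 : ∀ t ∈ Ioi (0 : ℝ), ∑' k : ℕ, ENNReal.ofReal (Real.exp (-(q * t)) / t)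
      * cpLaw lam t {-(h * ((k : ℝ) + 1))}
      ≤ ENNReal.ofReal (lam.real univ * Real.exp (-q * t)) := by
    intro t ht
    have ht0 : (0 : ℝ) < t := ht
    rw [ENNReal.tsum_mul_left]
    have h2 : ∑' k : ℕ, cpLaw lam t {-(h * ((k : ℝ) + 1))} ≤ ENNReal.ofReal (lam.real univ * t) := by
      refine le_trans ?_ (cpLaw_compl_zero_le lam ht0.le)
      rw [← measure_iUnion]
      · refine measure_mono (iUnion_subset fun k x hx => ?_)
        rw [mem_singleton_iff] at hx
        simp only [mem_compl_iff, mem_singleton_iff, hx, neg_eq_zero]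
        have := H.h_pos
        positivity
      · intro i j hij
        exact disjoint_singleton.2 (H.injective_neg_lattice.ne hij)
      · exact fun k => measurableSet_singleton _
    refine (mul_le_mul_right h2 _).trans ?_
    rw [← ENNReal.ofReal_mul (by positivity)]
    refine ENNReal.ofReal_le_ofReal (le_of_eq ?_)
    rw [neg_mul]
    field_simp
  refine (setLIntegral_mono (by fun_prop) h1).trans_lt ?_
  have h3 := (integrableOn_exp_mul_Ioi (neg_lt_zero.2 hq) 0).const_mul (lam.real univ)
  rw [← ofReal_integral_eq_lintegral_ofReal h3 (ae_of_all _ fun t => by positivity)]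
  exact ENNReal.ofReal_lt_top

theorem negWeight_nonneg (q : ℝ) (k : ℕ) : 0 ≤ negWeight lam h q k := ENNReal.toReal_nonneg

theorem summable_negWeight (H : IsSkipFreeMeasure lam h) {q : ℝ} (hq : 0 < q) :
    Summable (negWeight lam h q) :=
  ENNReal.summable_toReal (H.tsum_negWeight_lt_top hq).ne

/-- The contribution of the downward half-line to the ladder exponents. -/
theorem integrableOn_and_hasSum_neg_part (H : IsSkipFreeMeasure lam h) {q : ℝ} (hq : 0 < q)
    {γ : ℂ} (hγ : 0 ≤ γ.re) :
    IntegrableOn (fun t : ℝ => Complex.exp (-q * t) / t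
      * ∫ x in Iio 0, Complex.exp (γ * x) ∂(cpLaw lam t)) (Ioi 0) ∧
    HasSum (fun k : ℕ => negWeight lam h q k * Complex.exp (γ * (-(h * ((k : ℝ) + 1)) : ℝ)))
      (∫ t in Ioi (0 : ℝ), Complex.exp (-q * t) / t
      * ∫ x in Iio 0, Complex.exp (γ * x) ∂(cpLaw lam t)) := by
  have := H.finite
  refine integrableOn_and_hasSum_of_atoms (lam := lam)
    (c := fun k : ℕ => -(h * ((k : ℝ) + 1))) (s := Iio 0) (q := q) (γ := γ)
    (a := negWeight lam h q) (fun k => negWeight_nonneg q k)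
    (fun t ht => H.hasSum_setIntegral_Iio (f := fun x : ℝ => Complex.exp (γ * x)) (H.ae_cpLaw_lattice t)
      (H.integrable_cexp_restrict_Iio hγ ht)) (fun k => ?_) ?_
  · rw [negWeight, ENNReal.ofReal_toReal]
    exact ne_top_of_le_ne_top (H.tsum_negWeight_lt_top hq).ne (ENNReal.le_tsum k)
  · refine Summable.of_nonneg_of_le
      (fun k => mul_nonneg (negWeight_nonneg q k) (Real.exp_pos _).le) (fun k => ?_)
      (H.summable_negWeight hq)
    refine mul_le_of_le_one_right (negWeight_nonneg q k) (Real.exp_le_one_iff.2 ?_)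
    have := H.h_pos
    refine mul_nonpos_of_nonneg_of_nonpos hγ (neg_nonpos.2 (by positivity))

theorem differentiableOn_neg_part (H : IsSkipFreeMeasure lam h) {q : ℝ} (hq : 0 < q) :
    DifferentiableOn ℂ (fun γ : ℂ => ∫ t in Ioi (0 : ℝ), Complex.exp (-q * t) / t
      * ∫ x in Iio 0, Complex.exp (γ * x) ∂(cpLaw lam t)) {z | 0 < z.re} := by
  have h1 : DifferentiableOn ℂ (fun γ : ℂ => ∑' k : ℕ,
      negWeight lam h q k * Complex.exp (γ * (-(h * ((k : ℝ) + 1)) : ℝ))) {z | 0 < z.re} := by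
    refine Complex.differentiableOn_tsum_of_summable_norm (H.summable_negWeight hq)
      (fun k => by fun_prop) (isOpen_lt continuous_const Complex.continuous_re) fun k w hw => ?_
    rw [norm_mul, Complex.norm_real, Real.norm_eq_abs, abs_of_nonneg (negWeight_nonneg q k),
      Complex.norm_exp]
    refine mul_le_of_le_one_right (negWeight_nonneg q k) (Real.exp_le_one_iff.2 ?_)
    rw [Complex.re_mul_ofReal]
    have := H.h_pos
    exact mul_nonpos_of_nonneg_of_nonpos (le_of_lt hw) (neg_nonpos.2 (by positivity))
  exact h1.congr fun γ hγ => (H.integrableOn_and_hasSum_neg_part hq (le_of_lt hγ)).2.tsum_eq.symm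

end IsSkipFreeMeasure

theorem integral_add_sub {α : Type*} [MeasurableSpace α] {μ : Measure α} {f g k : α → ℂ}
    (hf : Integrable f μ) (hg : Integrable g μ) (hk : Integrable k μ) :
    ∫ x, (f x + g x - k x) ∂μ = ∫ x, f x ∂μ + ∫ x, g x ∂μ - ∫ x, k x ∂μ := by
  rw [← integral_add hf hg]
  exact integral_sub (hf.add hg) hk

theorem integral_sub_add {α : Type*} [MeasurableSpace α] {μ : Measure α} {f g k : α → ℂ}
    (hf : Integrable f μ) (hg : Integrable g μ) (hk : Integrable k μ) :
    ∫ x, (f x - g x + k x) ∂μ = ∫ x, f x ∂μ - ∫ x, g x ∂μ + ∫ x, k x ∂μ := by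
  rw [← integral_sub hf hg]
  exact integral_add (hf.sub hg) hk

namespace IsSkipFreeMeasure

variable {lam : Measure ℝ} {h : ℝ}

theorem setIntegral_exp_sub_exp (H : IsSkipFreeMeasure lam h) {s : Set ℝ} {γ : ℂ} {t : ℝ}
    (ht : 0 < t) (α : ℂ)
    (hs : IntegrableOn (fun x : ℝ => Complex.exp (γ * x)) s (cpLaw lam t)) :
    ∫ x in s, (Complex.exp (-t) - Complex.exp (-α * t + γ * x)) / t ∂(cpLaw lam t)
      = Complex.exp (-(1 : ℝ) * t) / t * ∫ x in s, Complex.exp ((0 : ℂ) * x) ∂(cpLaw lam t)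
        - Complex.exp (-α * t) / t * ∫ x in s, Complex.exp (γ * x) ∂(cpLaw lam t) := by
  have := H.finite
  have := isProbabilityMeasure_cpLaw lam ht.le
  have h0 : IntegrableOn (fun x : ℝ => Complex.exp ((0 : ℂ) * x)) s (cpLaw lam t) := by
    simp only [zero_mul, Complex.exp_zero]
    exact (integrable_const _).integrableOn
  rw [← integral_const_mul, ← integral_const_mul,
    ← integral_sub (h0.const_mul _) (hs.const_mul _)]
  congr 1 with x
  rw [Complex.exp_add]
  simp only [zero_mul, Complex.exp_zero]
  push_cast
  rw [neg_one_mul]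
  ring

theorem exp_Phi_ne_one (H : IsSkipFreeMeasure lam h) {q : ℝ} {γ : ℂ}
    (hγ : γ.re < Phi lam q) : 1 - Complex.exp ((γ - Phi lam q) * h) ≠ 0 := by
  intro h0
  have := H.norm_exp_sub_Phi_lt hγ
  rw [← sub_eq_zero.1 h0, norm_one] at this
  exact lt_irrefl _ this

theorem ascending_exponent (H : IsSkipFreeMeasure lam h) {α : ℝ} (hα : 0 < α) {β : ℂ}
    (hβ : 0 ≤ β.re) :
    IntegrableOn (fun t : ℝ => ∫ x in Ioi (0 : ℝ),
      (Complex.exp (-t) - Complex.exp (-α * t - β * x)) / t ∂(cpLaw lam t)) (Ioi 0) ∧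
    Complex.exp (∫ t in Ioi (0 : ℝ), ∫ x in Ioi (0 : ℝ),
      (Complex.exp (-t) - Complex.exp (-α * t - β * x)) / t ∂(cpLaw lam t))
      = (1 - Complex.exp (-(β + Phi lam α) * h)) / (1 - Complex.exp (-Phi lam 1 * h)) := by
  have hΦα := H.Phi_pos hα
  have hΦ1 := H.Phi_pos one_pos
  have hb : (-β).re < Phi lam α := by rw [Complex.neg_re]; linarith
  have h1 := H.integrableOn_and_integral_pos_part one_pos (γ := 0) (by simpa using hΦ1)
  have h2 := H.integrableOn_and_integral_pos_part hα (γ := -β) hb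
  have heq : ∀ t ∈ Ioi (0 : ℝ), (Complex.exp (-(1 : ℝ) * t) / t
        * ∫ x in Ioi (0 : ℝ), Complex.exp ((0 : ℂ) * x) ∂(cpLaw lam t))
        - (Complex.exp (-α * t) / t * ∫ x in Ioi (0 : ℝ), Complex.exp (-β * x) ∂(cpLaw lam t))
      = ∫ x in Ioi (0 : ℝ),
        (Complex.exp (-t) - Complex.exp (-α * t - β * x)) / t ∂(cpLaw lam t) := by
    intro t ht
    have := H.setIntegral_exp_sub_exp (s := Ioi 0) (γ := -β) ht α
      (H.integrable_cexp_restrict_Ioi _ ht)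
    rw [← this]
    simp only [neg_mul, sub_eq_add_neg]
  constructor
  · exact (h1.1.sub h2.1).congr_fun heq measurableSet_Ioi
  · rw [← setIntegral_congr_fun measurableSet_Ioi heq, integral_sub h1.1 h2.1, h1.2, h2.2,
      sub_neg_eq_add, Complex.exp_add, Complex.exp_neg,
      Complex.exp_log (H.exp_Phi_ne_one (q := 1) (by simpa using hΦ1)),
      Complex.exp_log (H.exp_Phi_ne_one hb), zero_sub, div_eq_inv_mul]
    congr 4
    ring

/-- The logarithm of the descending ladder exponent, up to normalisation. -/
def descExponent (lam : Measure ℝ) (α : ℝ) (β : ℂ) : ℂ :=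
  ∫ t in Ioi (0 : ℝ), ∫ x in Iic (0 : ℝ),
    (Complex.exp (-t) - Complex.exp (-α * t + β * x)) / t ∂(cpLaw lam t)

theorem descExponent_decomp (H : IsSkipFreeMeasure lam h) {α : ℝ} (hα : 0 < α) {β : ℂ}
    (hβ : 0 ≤ β.re) :
    IntegrableOn (fun t : ℝ => ∫ x in Iic (0 : ℝ),
      (Complex.exp (-t) - Complex.exp (-α * t + β * x)) / t ∂(cpLaw lam t)) (Ioi 0) ∧
    descExponent lam α β = (∫ t in Ioi (0 : ℝ),
        (Complex.exp (-t) - Complex.exp (-α * t)) / t * (cpLaw lam t).real {0})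
      + (∫ t in Ioi (0 : ℝ), Complex.exp (-(1 : ℝ) * t) / t
          * ∫ x in Iio 0, Complex.exp ((0 : ℂ) * x) ∂(cpLaw lam t))
      - ∫ t in Ioi (0 : ℝ), Complex.exp (-α * t) / t
          * ∫ x in Iio 0, Complex.exp (β * x) ∂(cpLaw lam t) := by
  have := H.finite
  have h1 := H.integrableOn_and_hasSum_neg_part one_pos (γ := 0) le_rfl
  have h2 := H.integrableOn_and_hasSum_neg_part hα hβ
  have h0 : IntegrableOn (fun t : ℝ => (Complex.exp (-t) - Complex.exp (-α * t)) / t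
      * (cpLaw lam t).real {0}) (Ioi 0) := by
    have hf := (integrableOn_frullani_and_integral (w := α) (by simpa using hα)).1
    refine Integrable.mul_bdd (c := 1) hf ?_ ?_
    · exact (Complex.measurable_ofReal.comp
        (measurable_cpLaw_apply lam (measurableSet_singleton 0)).ennreal_toReal).aestronglyMeasurable
    · filter_upwards [ae_restrict_mem measurableSet_Ioi] with t ht
      have := isProbabilityMeasure_cpLaw lam (mem_Ioi.1 ht).le
      rw [Complex.norm_real, Real.norm_eq_abs, abs_of_nonneg measureReal_nonneg]
      exact measureReal_le_one
  have heq : ∀ t ∈ Ioi (0 : ℝ), (Complex.exp (-t) - Complex.exp (-α * t)) / t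
        * (cpLaw lam t).real {0}
      + (Complex.exp (-(1 : ℝ) * t) / t
          * ∫ x in Iio 0, Complex.exp ((0 : ℂ) * x) ∂(cpLaw lam t))
      - (Complex.exp (-α * t) / t * ∫ x in Iio 0, Complex.exp (β * x) ∂(cpLaw lam t))
      = ∫ x in Iic (0 : ℝ),
        (Complex.exp (-t) - Complex.exp (-α * t + β * x)) / t ∂(cpLaw lam t) := by
    intro t ht
    have := isProbabilityMeasure_cpLaw lam (mem_Ioi.1 ht).le
    have hI : ∀ γ : ℂ, 0 ≤ γ.re → ∫ x in Iic (0 : ℝ), Complex.exp (γ * x) ∂(cpLaw lam t)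
        = (cpLaw lam t).real {0} + ∫ x in Iio (0 : ℝ), Complex.exp (γ * x) ∂(cpLaw lam t) := by
      intro γ hγ
      have hint := (H.integral_cexp_cpLaw hγ (mem_Ioi.1 ht).le).1
      rw [← Iio_union_right, setIntegral_union (by simp) (measurableSet_singleton _)
        hint.integrableOn hint.integrableOn, integral_singleton, add_comm]
      simp
    rw [H.setIntegral_exp_sub_exp ht α (H.integral_cexp_cpLaw hβ (mem_Ioi.1 ht).le).1.integrableOn,
      hI 0 le_rfl, hI β hβ]
    push_cast
    rw [neg_one_mul]
    ring
  constructor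
  · exact ((h0.add h1.1).sub h2.1).congr_fun heq measurableSet_Ioi
  · rw [descExponent, ← setIntegral_congr_fun measurableSet_Ioi heq,
      integral_add_sub h0 h1.1 h2.1]

theorem differentiableOn_descExponent (H : IsSkipFreeMeasure lam h) {α : ℝ} (hα : 0 < α) :
    DifferentiableOn ℂ (descExponent lam α) {z | 0 < z.re} :=
  ((H.differentiableOn_neg_part hα).const_sub _).congr
    fun _ hz => (H.descExponent_decomp hα (le_of_lt hz)).2

theorem exp_descExponent_of_lt (H : IsSkipFreeMeasure lam h) {α : ℝ} (hα : 0 < α) {β : ℂ}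
    (hβ : 0 ≤ β.re) (hβΦ : β.re < Phi lam α) :
    Complex.exp (descExponent lam α β) * (1 - Complex.exp ((β - Phi lam α) * h))
      = (1 - Complex.exp (-Phi lam 1 * h)) * (α - psi lam β) := by
  have hΦ1 := H.Phi_pos one_pos
  have h1 := H.integrableOn_and_integral_pos_part one_pos (γ := 0) (by simpa using hΦ1)
  have h2 := H.integrableOn_and_integral_pos_part hα hβΦ
  have hw : 0 < ((α : ℂ) - psi lam β).re := by
    rw [Complex.sub_re, Complex.ofReal_re]
    exact sub_pos.2 (H.re_psi_lt hα hβ hβΦ)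
  have h3 := integrableOn_frullani_and_integral hw
  have heq : ∀ t ∈ Ioi (0 : ℝ),
      (Complex.exp (-t) - Complex.exp (-(α - psi lam β) * t)) / t
      - (Complex.exp (-(1 : ℝ) * t) / t
          * ∫ x in Ioi 0, Complex.exp ((0 : ℂ) * x) ∂(cpLaw lam t))
      + (Complex.exp (-α * t) / t * ∫ x in Ioi 0, Complex.exp (β * x) ∂(cpLaw lam t))
      = ∫ x in Iic (0 : ℝ),
        (Complex.exp (-t) - Complex.exp (-α * t + β * x)) / t ∂(cpLaw lam t) := by
    intro t ht
    have ht0 := (mem_Ioi.1 ht).le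
    have hI : ∀ γ : ℂ, 0 ≤ γ.re → ∫ x in Iic (0 : ℝ), Complex.exp (γ * x) ∂(cpLaw lam t)
        = Complex.exp (t * psi lam γ) - ∫ x in Ioi (0 : ℝ), Complex.exp (γ * x) ∂(cpLaw lam t) := by
      intro γ hγ
      have hint := H.integral_cexp_cpLaw hγ ht0
      rw [eq_sub_iff_add_eq, ← hint.2, ← compl_Iic]
      exact integral_add_compl measurableSet_Iic hint.1
    have hψ0 : psi lam 0 = 0 := by simp [psi]
    rw [H.setIntegral_exp_sub_exp ht α (H.integral_cexp_cpLaw hβ ht0).1.integrableOn,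
      hI 0 le_rfl, hI β hβ, hψ0, mul_zero, Complex.exp_zero,
      show -((α : ℂ) - psi lam β) * t = -α * t + t * psi lam β by ring, Complex.exp_add]
    push_cast
    rw [neg_one_mul]
    ring
  rw [descExponent, ← setIntegral_congr_fun measurableSet_Ioi heq,
    integral_sub_add h3.1 h1.1 h2.1, h1.2, h2.2, h3.2, sub_neg_eq_add,
    Complex.exp_add, Complex.exp_add, Complex.exp_neg, Complex.exp_log,
    Complex.exp_log (H.exp_Phi_ne_one (q := 1) (by simpa using hΦ1)),
    Complex.exp_log (H.exp_Phi_ne_one hβΦ), mul_assoc,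
    inv_mul_cancel₀ (H.exp_Phi_ne_one hβΦ), zero_sub]
  · ring
  · intro h0
    rw [h0] at hw
    simp at hw

theorem exp_descExponent (H : IsSkipFreeMeasure lam h) {α : ℝ} (hα : 0 < α) {β : ℂ}
    (hβ : 0 ≤ β.re) :
    Complex.exp (descExponent lam α β) * (1 - Complex.exp ((β - Phi lam α) * h))
      = (1 - Complex.exp (-Phi lam 1 * h)) * (α - psi lam β) := by
  have hΦ := H.Phi_pos hα
  rcases hβ.eq_or_lt with h0 | h0
  · exact H.exp_descExponent_of_lt hα hβ (h0 ▸ hΦ)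
  have hopen : IsOpen {z : ℂ | 0 < z.re} := isOpen_lt continuous_const Complex.continuous_re
  have hd1 : DifferentiableOn ℂ (fun β : ℂ => Complex.exp (descExponent lam α β)
      * (1 - Complex.exp ((β - Phi lam α) * h))) {z | 0 < z.re} :=
    (H.differentiableOn_descExponent hα).cexp.mul (by fun_prop)
  have hd2 : DifferentiableOn ℂ (fun β : ℂ => (1 - Complex.exp (-Phi lam 1 * h))
      * (α - psi lam β)) {z | 0 < z.re} :=
    (H.differentiableOn_psi.const_sub _).const_mul _
  have hz0 : ((Phi lam α / 2 : ℝ) : ℂ) ∈ {z : ℂ | 0 < z.re} := by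
    simp only [mem_ofPred_eq, Complex.ofReal_re]
    positivity
  refine (hd1.analyticOnNhd hopen).eqOn_of_preconnected_of_eventuallyEq
    (hd2.analyticOnNhd hopen) (convex_halfSpace_re_gt 0).isPreconnected hz0 ?_ h0
  have hn : {z : ℂ | 0 < z.re ∧ z.re < Phi lam α} ∈ 𝓝 ((Phi lam α / 2 : ℝ) : ℂ) := by
    refine (hopen.inter (isOpen_lt Complex.continuous_re continuous_const)).mem_nhds ⟨hz0, ?_⟩
    simp only [mem_ofPred_eq, Complex.ofReal_re]
    linarith
  filter_upwards [hn] with z hz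
  exact H.exp_descExponent_of_lt hα hz.1.le hz.2

theorem exp_descExponent_of_ne (H : IsSkipFreeMeasure lam h) {α : ℝ} (hα : 0 < α) {β : ℂ}
    (hβ : 0 ≤ β.re) (hne : (α : ℂ) ≠ psi lam β) :
    1 - Complex.exp ((β - Phi lam α) * h) ≠ 0 ∧ Complex.exp (descExponent lam α β)
      = (1 - Complex.exp (-Phi lam 1 * h))
        * ((α - psi lam β) / (1 - Complex.exp ((β - Phi lam α) * h))) := by
  have h1 := H.exp_descExponent hα hβ
  have h2 : 1 - Complex.exp ((β - Phi lam α) * h) ≠ 0 := by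
    intro h0
    rw [h0, mul_zero] at h1
    have h3 := H.exp_Phi_ne_one (q := 1) (γ := 0) (by simpa using H.Phi_pos one_pos)
    rw [zero_sub] at h3
    exact mul_ne_zero h3 (sub_ne_zero.2 hne) h1.symm
  refine ⟨h2, ?_⟩
  rw [← mul_div_assoc, ← h1, mul_div_cancel_right₀ _ h2]

theorem exp_descExponent_Phi (H : IsSkipFreeMeasure lam h) {α : ℝ} (hα : 0 < α) :
    Complex.exp (descExponent lam α (Phi lam α))
      = (1 - Complex.exp (-Phi lam 1 * h)) * (deriv (psiReal lam) (Phi lam α) / h : ℝ) := by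
  have hΦ := H.Phi_pos hα
  set b := Phi lam α with hb
  have hopen : IsOpen {z : ℂ | 0 < z.re} := isOpen_lt continuous_const Complex.continuous_re
  have hc : ContinuousAt (fun x : ℝ => Complex.exp (descExponent lam α x)) b := by
    have h1 : ContinuousAt (descExponent lam α) (b : ℂ) :=
      ((H.differentiableOn_descExponent hα).differentiableAt
        (hopen.mem_nhds (by simpa using hΦ))).continuousAt
    exact (ContinuousAt.comp (f := fun x : ℝ => (x : ℂ)) h1
      Complex.continuous_ofReal.continuousAt).cexp
  have hlim := (hc.tendsto.mono_left nhdsWithin_le_nhds : Tendsto _ (𝓝[≠] b) _)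
  have hd := H.deriv_psiReal_pos hα
  have h2 := (H.tendsto_slope_quotient hα).inv₀ (div_pos H.h_pos hd).ne'
  have h3 := ((Complex.continuous_ofReal.tendsto _).comp h2).const_mul
    (1 - Complex.exp (-Phi lam 1 * h))
  rw [inv_div] at h3
  refine tendsto_nhds_unique hlim (h3.congr' ?_)
  filter_upwards [self_mem_nhdsWithin, mem_nhdsWithin_of_mem_nhds (lt_mem_nhds hΦ)] with x hx hx0
  have hne : (α : ℂ) ≠ psi lam x := by
    rw [psi_ofReal]
    intro h0
    exact hx ((H.eq_Phi_iff hα x).1 ⟨hx0, (Complex.ofReal_inj.1 h0).symm⟩)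
  rw [(H.exp_descExponent_of_ne hα (by simpa using (le_of_lt hx0)) hne).2, psi_ofReal]
  simp

end IsSkipFreeMeasure

section Chain

variable {Ω : Type*} [MeasurableSpace Ω] {X : ℝ≥0 → Ω → ℝ} {lam : Measure ℝ} {h : ℝ}
  {P : Measure Ω}

theorem IsUpwardsSkipFreeLevyChain.map_eq_cpLaw [IsProbabilityMeasure P]
    (hX : IsUpwardsSkipFreeLevyChain X lam h P) (t : ℝ≥0) : P.map (X t) = cpLaw lam t := by
  have H := hX.isSkipFreeMeasure
  have := hX.finite
  have := isProbabilityMeasure_cpLaw lam t.2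
  have : IsProbabilityMeasure (P.map (X t)) :=
    Measure.isProbabilityMeasure_map (hX.measurable t).aemeasurable
  have : IsFiniteMeasure (cpLaw lam t) := inferInstanceAs (IsFiniteMeasure (cpLaw lam t.1))
  refine Measure.ext_of_charFun ?_
  ext u
  rw [hX.charFun_eq, charFun_apply_real]
  have h1 := (H.integral_cexp_cpLaw (β := u * Complex.I) (by simp) t.2).2
  have h2 : ∀ x : ℝ, (u * x * Complex.I : ℂ) = u * Complex.I * x := fun x => by ring
  simp_rw [h2]
  refine Eq.trans ?_ h1.symm
  rw [psi]
  congr 3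
  ext x
  rw [mul_comm Complex.I]

end Chain

/-- The partial sums of a sequence of steps. -/
def walk (x : ℕ → ℝ) (k : ℕ) : ℝ := ∑ i ∈ Finset.range k, x i

theorem walk_zero (x : ℕ → ℝ) : walk x 0 = 0 := by simp [walk]

@[fun_prop]
theorem measurable_walk (k : ℕ) : Measurable fun x : ℕ → ℝ => walk x k := by
  unfold walk; fun_prop

/-- The law of a sequence of independent steps with law `μ`. -/
def stepLaw (μ : Measure ℝ) [IsProbabilityMeasure μ] : Measure (ℕ → ℝ) :=
  Measure.infinitePi fun _ : ℕ => μ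

instance (μ : Measure ℝ) [IsProbabilityMeasure μ] : IsProbabilityMeasure (stepLaw μ) := by
  unfold stepLaw; infer_instance

/-- The sequence following `p.1` for `j` steps and `p.2` afterwards. -/
def splice (j : ℕ) (p : (ℕ → ℝ) × (ℕ → ℝ)) (i : ℕ) : ℝ := if i < j then p.1 i else p.2 (i - j)

theorem measurable_splice (j : ℕ) : Measurable (splice j) := by
  refine measurable_pi_lambda _ fun i => ?_
  unfold splice
  split_ifs <;> fun_prop

theorem walk_splice_of_le {j i : ℕ} (hij : i ≤ j) (p : (ℕ → ℝ) × (ℕ → ℝ)) :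
    walk (splice j p) i = walk p.1 i :=
  Finset.sum_congr rfl fun _ hl => if_pos ((Finset.mem_range.1 hl).trans_le hij)

theorem walk_splice_add (j i : ℕ) (p : (ℕ → ℝ) × (ℕ → ℝ)) :
    walk (splice j p) (j + i) = walk p.1 j + walk p.2 i := by
  rw [walk, Finset.sum_range_add]
  congr 1
  · exact walk_splice_of_le le_rfl p
  · exact Finset.sum_congr rfl fun l _ => by simp [splice]

theorem map_splice (μ : Measure ℝ) [IsProbabilityMeasure μ] (j : ℕ) :
    ((stepLaw μ).prod (stepLaw μ)).map (splice j) = stepLaw μ := by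
  refine Measure.eq_infinitePi _ fun s t ht => ?_
  have hpre : splice j ⁻¹' (Set.pi s t)
      = (Set.pi (s.filter (· < j) : Finset ℕ) t) ×ˢ
        (Set.pi ((s.filter (¬ · < j)).image (· - j) : Finset ℕ) fun i => t (i + j)) := by
    ext p
    simp only [mem_preimage, Set.mem_pi, mem_prod, Finset.coe_filter, Finset.coe_image,
      mem_image, mem_ofPred_eq, forall_exists_index, and_imp, SetLike.mem_coe]
    constructor
    · intro hp
      refine ⟨fun i hi hij => by simpa [splice, hij] using hp i hi, ?_⟩
      rintro _ i hi hij rfl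
      rw [Nat.sub_add_cancel (not_lt.1 hij)]
      simpa [splice, hij] using hp i hi
    · rintro ⟨h1, h2⟩ i hi
      by_cases hij : i < j
      · simpa [splice, hij] using h1 i hi hij
      · have := h2 (i - j) i hi hij rfl
        rw [Nat.sub_add_cancel (not_lt.1 hij)] at this
        simpa [splice, hij] using this
  rw [Measure.map_apply (measurable_splice j)
    (MeasurableSet.pi s.countable_toSet fun i _ => ht i), hpre, Measure.prod_prod, stepLaw,
    Measure.infinitePi_pi _ fun i _ => ht i, Measure.infinitePi_pi _ fun i _ => ht (i + j),
    Finset.prod_image, ← Finset.prod_filter_mul_prod_filter_not s (· < j)]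
  · congr 1
    refine Finset.prod_congr rfl fun i hi => ?_
    rw [Nat.sub_add_cancel (not_lt.1 (Finset.mem_filter.1 hi).2)]
  · intro a ha b hb hab
    have h1 := (Finset.mem_filter.1 (Finset.mem_coe.1 ha)).2
    have h2 := (Finset.mem_filter.1 (Finset.mem_coe.1 hb)).2
    simp only at hab
    omega

/-- An expectation that factorizes over the first `j` steps and the remaining ones. -/
theorem integral_stepLaw_eq_mul {μ : Measure ℝ} [IsProbabilityMeasure μ] {F f g : (ℕ → ℝ) → ℂ}
    (hF : Measurable F) (j : ℕ) (hfg : ∀ y x, F (splice j (y, x)) = f y * g x) :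
    ∫ x, F x ∂(stepLaw μ) = (∫ x, f x ∂(stepLaw μ)) * ∫ x, g x ∂(stepLaw μ) := by
  conv_lhs => rw [← map_splice μ j]
  rw [integral_map (measurable_splice j).aemeasurable hF.aestronglyMeasurable,
    ← integral_prod_mul]
  exact integral_congr_ae (ae_of_all _ fun p => hfg p.1 p.2)

/-- Reversal of the first `j` steps. -/
def reverseSteps (j : ℕ) (x : ℕ → ℝ) (i : ℕ) : ℝ := x (if i < j then j - 1 - i else i)

theorem map_reverseSteps (μ : Measure ℝ) [IsProbabilityMeasure μ] (j : ℕ) :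
    (stepLaw μ).map (reverseSteps j) = stepLaw μ := by
  have hinj : Function.Injective fun i : ℕ => if i < j then j - 1 - i else i := by
    intro a b hab
    simp only at hab
    split_ifs at hab <;> omega
  exact Measure.map_infinitePi_infinitePi_of_inj (P := fun _ : ℕ => μ) hinj

theorem measurable_reverseSteps (j : ℕ) : Measurable (reverseSteps j) :=
  measurable_pi_lambda _ fun i => by unfold reverseSteps; fun_prop

theorem walk_reverseSteps {j i : ℕ} (hij : i ≤ j) (x : ℕ → ℝ) :
    walk (reverseSteps j x) i = walk x j - walk x (j - i) := by
  have h1 : walk x j = walk x (j - i) + ∑ l ∈ Finset.range i, x (j - i + l) := by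
    conv_lhs => rw [← Nat.sub_add_cancel hij]
    rw [walk, Finset.sum_range_add]
    rfl
  rw [h1, add_sub_cancel_left, walk, ← Finset.sum_range_reflect]
  refine Finset.sum_congr rfl fun l hl => ?_
  have := Finset.mem_range.1 hl
  unfold reverseSteps
  rw [if_pos (by omega)]
  congr 1
  omega

theorem integral_reverseSteps {μ : Measure ℝ} [IsProbabilityMeasure μ] {F : (ℕ → ℝ) → ℂ}
    (hF : Measurable F) (j : ℕ) :
    ∫ x, F (reverseSteps j x) ∂(stepLaw μ) = ∫ x, F x ∂(stepLaw μ) := by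
  conv_rhs => rw [← map_reverseSteps μ j]
  rw [integral_map (measurable_reverseSteps j).aemeasurable hF.aestronglyMeasurable]

/-- The walk stays nonpositive up to time `k`. -/
def staysNonpos (k : ℕ) : Set (ℕ → ℝ) := {x | ∀ i ≤ k, walk x i ≤ 0}

/-- Time `k` is a strict ascending ladder time. -/
def isLadder (k : ℕ) : Set (ℕ → ℝ) := {x | ∀ i < k, walk x i < walk x k}

/-- The walk becomes positive for the first time at time `k`. -/
def firstPassage (k : ℕ) : Set (ℕ → ℝ) := {x | (∀ i < k, walk x i ≤ 0) ∧ 0 < walk x k}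

/-- The walk is minimal at time `k` among the times up to `k`. -/
def isWeakMin (k : ℕ) : Set (ℕ → ℝ) := {x | ∀ i ≤ k, walk x k ≤ walk x i}

/-- The walk is positive at the times `1, …, k`. -/
def staysPos (k : ℕ) : Set (ℕ → ℝ) := {x | ∀ i ≤ k, 0 < i → 0 < walk x i}

/-- The running maximum on `{0, …, m}` is attained for the first time at time `j`. -/
def firstMax (m j : ℕ) : Set (ℕ → ℝ) :=
  {x | (∀ i < j, walk x i < walk x j) ∧ ∀ i ≤ m, walk x i ≤ walk x j}

/-- The running minimum on `{0, …, m}` is attained for the last time at time `j`. -/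
def lastMin (m j : ℕ) : Set (ℕ → ℝ) :=
  {x | (∀ i ≤ m, walk x j ≤ walk x i) ∧ ∀ i ≤ m, j < i → walk x j < walk x i}

theorem measurableSet_staysNonpos (k : ℕ) : MeasurableSet (staysNonpos k) := by
  simp only [staysNonpos, ofPred_forall]
  exact MeasurableSet.iInter fun i => MeasurableSet.iInter fun _ =>
    measurableSet_le (measurable_walk i) measurable_const

theorem measurableSet_isLadder (k : ℕ) : MeasurableSet (isLadder k) := by
  simp only [isLadder, ofPred_forall]
  exact MeasurableSet.iInter fun i => MeasurableSet.iInter fun _ =>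
    measurableSet_lt (measurable_walk i) (measurable_walk k)

theorem measurableSet_firstPassage (k : ℕ) : MeasurableSet (firstPassage k) := by
  simp only [firstPassage, ofPred_and, ofPred_forall]
  exact (MeasurableSet.iInter fun i => MeasurableSet.iInter fun _ =>
    measurableSet_le (measurable_walk i) measurable_const).inter
    (measurableSet_lt measurable_const (measurable_walk k))

theorem measurableSet_firstMax (m j : ℕ) : MeasurableSet (firstMax m j) := by
  simp only [firstMax, ofPred_and, ofPred_forall]
  exact (MeasurableSet.iInter fun i => MeasurableSet.iInter fun _ =>
    measurableSet_lt (measurable_walk i) (measurable_walk j)).inter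
    (MeasurableSet.iInter fun i => MeasurableSet.iInter fun _ =>
    measurableSet_le (measurable_walk i) (measurable_walk j))

theorem measurableSet_lastMin (m j : ℕ) : MeasurableSet (lastMin m j) := by
  simp only [lastMin, ofPred_and, ofPred_forall]
  exact (MeasurableSet.iInter fun i => MeasurableSet.iInter fun _ =>
    measurableSet_le (measurable_walk j) (measurable_walk i)).inter
    (MeasurableSet.iInter fun i => MeasurableSet.iInter fun _ => MeasurableSet.iInter fun _ =>
    measurableSet_lt (measurable_walk j) (measurable_walk i))

/-- `exp(γ S_k)` on a set of paths. -/
def expOn (s : Set (ℕ → ℝ)) (γ : ℂ) (k : ℕ) : (ℕ → ℝ) → ℂ :=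
  s.indicator fun x => Complex.exp (γ * walk x k)

theorem measurable_expOn {s : Set (ℕ → ℝ)} (hs : MeasurableSet s) (γ : ℂ) (k : ℕ) :
    Measurable (expOn s γ k) :=
  Measurable.indicator (by fun_prop) hs

section Expectations

variable (μ : Measure ℝ) [IsProbabilityMeasure μ]

/-- `E[exp(β S_k); S_i ≤ 0 for i ≤ k]` -/
def nonposExp (β : ℂ) (k : ℕ) : ℂ := ∫ x, expOn (staysNonpos k) β k x ∂(stepLaw μ)

/-- `E[exp(γ S_k); k is a strict ascending ladder time]` -/
def ladderExp (γ : ℂ) (k : ℕ) : ℂ := ∫ x, expOn (isLadder k) γ k x ∂(stepLaw μ)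

/-- `E[exp(γ S_k); k is the first passage time above zero]` -/
def passageExp (γ : ℂ) (k : ℕ) : ℂ := ∫ x, expOn (firstPassage k) γ k x ∂(stepLaw μ)

end Expectations

variable {μ : Measure ℝ} [IsProbabilityMeasure μ]

theorem splice_mem_firstMax {j k : ℕ} {y x : ℕ → ℝ} :
    splice j (y, x) ∈ firstMax (j + k) j ↔ y ∈ isLadder j ∧ x ∈ staysNonpos k := by
  simp only [firstMax, isLadder, staysNonpos, mem_ofPred_eq]
  rw [walk_splice_of_le le_rfl]
  constructor
  · rintro ⟨h1, h2⟩
    refine ⟨fun i hi => ?_, fun i hi => ?_⟩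
    · have := h1 i hi
      rwa [walk_splice_of_le hi.le] at this
    · have := h2 (j + i) (by omega)
      rw [walk_splice_add] at this
      simpa using this
  · rintro ⟨h1, h2⟩
    have h3 : ∀ i < j, walk (splice j (y, x)) i < walk y j := fun i hi => by
      rw [walk_splice_of_le hi.le]; exact h1 i hi
    refine ⟨h3, fun i hi => ?_⟩
    rcases lt_or_ge i j with hij | hij
    · exact (h3 i hij).le
    · obtain ⟨l, rfl⟩ := Nat.exists_eq_add_of_le hij
      rw [walk_splice_add]
      have := h2 l (by omega)
      simpa using this

theorem splice_mem_lastMin {j k : ℕ} {y x : ℕ → ℝ} :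
    splice j (y, x) ∈ lastMin (j + k) j
      ↔ y ∈ isWeakMin j ∧ x ∈ staysPos k := by
  simp only [lastMin, isWeakMin, staysPos, mem_ofPred_eq]
  rw [walk_splice_of_le le_rfl]
  constructor
  · rintro ⟨h1, h2⟩
    refine ⟨fun i hi => ?_, fun i hi hi0 => ?_⟩
    · have := h1 i (by omega)
      rwa [walk_splice_of_le hi] at this
    · have := h2 (j + i) (by omega) (by omega)
      rw [walk_splice_add] at this
      simpa using this
  · rintro ⟨h1, h2⟩
    have h3 : ∀ i ≤ j + k, j < i → walk y j < walk (splice j (y, x)) i := by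
      intro i hi hij
      obtain ⟨l, rfl⟩ := Nat.exists_eq_add_of_le hij.le
      rw [walk_splice_add]
      have := h2 l (by omega) (by omega)
      simpa using this
    refine ⟨fun i hi => ?_, h3⟩
    rcases le_or_gt i j with hij | hij
    · rw [walk_splice_of_le hij]; exact h1 i hij
    · exact (h3 i hi hij).le

theorem splice_mem_firstPassage_inter_isLadder {j k : ℕ} {y x : ℕ → ℝ} :
    splice j (y, x) ∈ firstPassage j ∩ isLadder (j + k)
      ↔ y ∈ firstPassage j ∧ x ∈ isLadder k := by
  simp only [firstPassage, isLadder, mem_inter_iff, mem_ofPred_eq]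
  rw [walk_splice_of_le le_rfl, walk_splice_add]
  constructor
  · rintro ⟨⟨h1, h2⟩, h3⟩
    refine ⟨⟨fun i hi => ?_, h2⟩, fun i hi => ?_⟩
    · have := h1 i hi
      rwa [walk_splice_of_le hi.le] at this
    · have := h3 (j + i) (by omega)
      rw [walk_splice_add] at this
      simpa using this
  · rintro ⟨⟨h1, h2⟩, h3⟩
    have hk : 0 ≤ walk x k := by
      rcases Nat.eq_zero_or_pos k with rfl | hk
      · rw [walk_zero]
      · have := h3 0 hk
        rw [walk_zero] at this
        exact this.le
    have h4 : ∀ i < j, walk (splice j (y, x)) i ≤ 0 := fun i hi => by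
      rw [walk_splice_of_le hi.le]; exact h1 i hi
    refine ⟨⟨h4, h2⟩, fun i hi => ?_⟩
    rcases lt_or_ge i j with hij | hij
    · have := h4 i hij
      simp only
      linarith
    · obtain ⟨l, rfl⟩ := Nat.exists_eq_add_of_le hij
      rw [walk_splice_add]
      have := h3 l (by omega)
      simpa using this

theorem integral_firstMax (γ : ℂ) (j k : ℕ) :
    ∫ x, expOn (firstMax (j + k) j) γ j x ∂(stepLaw μ) = ladderExp μ γ j * nonposExp μ 0 k := by
  refine integral_stepLaw_eq_mul (measurable_expOn (measurableSet_firstMax _ _) γ j) j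
    fun y x => ?_
  classical
  simp only [expOn, indicator_apply, splice_mem_firstMax, walk_splice_of_le le_rfl, zero_mul,
    Complex.exp_zero]
  by_cases h1 : y ∈ isLadder j <;> by_cases h2 : x ∈ staysNonpos k <;> simp [h1, h2]

theorem nonposExp_eq (β : ℂ) (j : ℕ) : nonposExp μ β j
    = ∫ x, expOn (isWeakMin j) β j x ∂(stepLaw μ) := by
  rw [nonposExp, ← integral_reverseSteps (measurable_expOn (measurableSet_staysNonpos j) β j) j]
  congr 1 with x
  classical
  simp only [expOn, indicator_apply, staysNonpos, isWeakMin, mem_ofPred_eq, walk_reverseSteps le_rfl,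
    Nat.sub_self, walk_zero, sub_zero]
  refine if_congr ?_ rfl rfl
  constructor
  · intro hx i hi
    have := hx (j - i) (by omega)
    rw [walk_reverseSteps (by omega), show j - (j - i) = i by omega] at this
    linarith
  · intro hx i hi
    rw [walk_reverseSteps hi]
    have := hx (j - i) (by omega)
    linarith

theorem ladderExp_zero_eq (k : ℕ) : ladderExp μ 0 k
    = ∫ x, expOn (staysPos k) 0 k x ∂(stepLaw μ) := by
  rw [ladderExp, ← integral_reverseSteps (measurable_expOn (measurableSet_isLadder k) 0 k) k]
  congr 1 with x
  classical
  simp only [expOn, indicator_apply, isLadder, staysPos, mem_ofPred_eq, walk_reverseSteps le_rfl,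
    Nat.sub_self, walk_zero, sub_zero]
  refine if_congr ?_ rfl rfl
  constructor
  · intro hx i hi hi0
    have := hx (k - i) (by omega)
    rw [walk_reverseSteps (by omega), show k - (k - i) = i by omega] at this
    linarith
  · intro hx i hi
    rw [walk_reverseSteps hi.le]
    have := hx (k - i) (by omega) (by omega)
    linarith

theorem integral_lastMin (β : ℂ) (j k : ℕ) :
    ∫ x, expOn (lastMin (j + k) j) β j x ∂(stepLaw μ) = nonposExp μ β j * ladderExp μ 0 k := by
  rw [nonposExp_eq, ladderExp_zero_eq]
  refine integral_stepLaw_eq_mul (measurable_expOn (measurableSet_lastMin _ _) β j) j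
    fun y x => ?_
  classical
  simp only [expOn, indicator_apply, splice_mem_lastMin, walk_splice_of_le le_rfl, zero_mul,
    Complex.exp_zero]
  by_cases h1 : y ∈ isWeakMin j <;> by_cases h2 : x ∈ staysPos k <;> simp [h1, h2]

theorem norm_expOn_le_one {s : Set (ℕ → ℝ)} {γ : ℂ} {k : ℕ}
    (hs : ∀ x ∈ s, γ.re * walk x k ≤ 0) (x : ℕ → ℝ) : ‖expOn s γ k x‖ ≤ 1 := by
  classical
  rw [expOn, indicator_apply]
  split_ifs with hx
  · rw [Complex.norm_exp, Real.exp_le_one_iff, Complex.re_mul_ofReal]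
    exact hs x hx
  · simp

theorem integrable_expOn {s : Set (ℕ → ℝ)} (hms : MeasurableSet s) {γ : ℂ} {k : ℕ}
    (hs : ∀ x ∈ s, γ.re * walk x k ≤ 0) : Integrable (expOn s γ k) (stepLaw μ) :=
  Integrable.of_bound (measurable_expOn hms γ k).aestronglyMeasurable 1
    (ae_of_all _ (norm_expOn_le_one hs))

theorem norm_integral_expOn_le_one {s : Set (ℕ → ℝ)} {γ : ℂ} {k : ℕ}
    (hs : ∀ x ∈ s, γ.re * walk x k ≤ 0) : ‖∫ x, expOn s γ k x ∂(stepLaw μ)‖ ≤ 1 := by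
  have := norm_integral_le_of_norm_le_const (μ := stepLaw μ)
    (ae_of_all _ (norm_expOn_le_one (s := s) hs))
  simpa using this

theorem nonpos_of_staysNonpos {k : ℕ} {β : ℂ} (hβ : 0 ≤ β.re) :
    ∀ x ∈ staysNonpos k, β.re * walk x k ≤ 0 := fun _ hx =>
  mul_nonpos_of_nonneg_of_nonpos hβ (hx k le_rfl)

theorem nonpos_of_isLadder {k : ℕ} {γ : ℂ} (hγ : γ.re ≤ 0) :
    ∀ x ∈ isLadder k, γ.re * walk x k ≤ 0 := by
  intro x hx
  refine mul_nonpos_of_nonpos_of_nonneg hγ ?_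
  rcases Nat.eq_zero_or_pos k with rfl | hk
  · rw [walk_zero]
  · have := hx 0 hk
    rw [walk_zero] at this
    exact this.le

theorem nonpos_of_firstPassage {k : ℕ} {γ : ℂ} (hγ : γ.re ≤ 0) :
    ∀ x ∈ firstPassage k, γ.re * walk x k ≤ 0 := fun _ hx =>
  mul_nonpos_of_nonpos_of_nonneg hγ hx.2.le

/-- Decomposition of a ladder time at the first passage above zero. -/
theorem ladderExp_succ {γ : ℂ} (hγ : γ.re ≤ 0) (m : ℕ) : ladderExp μ γ (m + 1)
    = ∑ p ∈ Finset.HasAntidiagonal.antidiagonal (m + 1), passageExp μ γ p.1 * ladderExp μ γ p.2 := by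
  classical
  have h1 : ∀ p ∈ Finset.HasAntidiagonal.antidiagonal (m + 1), passageExp μ γ p.1 * ladderExp μ γ p.2
      = ∫ x, expOn (firstPassage p.1 ∩ isLadder (m + 1)) γ (m + 1) x ∂(stepLaw μ) := by
    intro p hp
    have hp' := Finset.HasAntidiagonal.mem_antidiagonal.1 hp
    rw [← hp']
    refine (integral_stepLaw_eq_mul (measurable_expOn
      ((measurableSet_firstPassage _).inter (measurableSet_isLadder _)) γ _) p.1 fun y x => ?_).symm
    simp only [expOn, indicator_apply, splice_mem_firstPassage_inter_isLadder, walk_splice_add]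
    by_cases h1 : y ∈ firstPassage p.1 <;> by_cases h2 : x ∈ isLadder p.2 <;>
      simp [h1, h2, mul_add, Complex.exp_add]
  rw [Finset.sum_congr rfl h1, ← integral_finsetSum]
  · rw [ladderExp]
    congr 1 with x
    simp only [expOn, indicator_apply, mem_inter_iff]
    by_cases hx : x ∈ isLadder (m + 1)
    · simp only [hx, and_true, if_true]
      have hpos : 0 < walk x (m + 1) := by
        have := hx 0 (by omega)
        rwa [walk_zero] at this
      have hex : ∃ j, 0 < walk x j := ⟨m + 1, hpos⟩
      set j := Nat.find hex with hj
      have hjm : j ≤ m + 1 := Nat.find_min' hex hpos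
      have hjmem : x ∈ firstPassage j :=
        ⟨fun i hi => not_lt.1 (Nat.find_min hex hi), Nat.find_spec hex⟩
      rw [Finset.sum_eq_single (j, m + 1 - j)]
      · simp [hjmem]
      · rintro ⟨a, b⟩ hab hne
        refine if_neg fun ha => hne ?_
        have hab' := Finset.HasAntidiagonal.mem_antidiagonal.1 hab
        simp only at hab' ha
        have haj : a = j := by
          refine le_antisymm ?_ (Nat.find_min' hex ha.2)
          by_contra! hlt
          exact absurd (ha.1 j hlt) (not_le.2 (Nat.find_spec hex))
        subst haj
        rw [← hab']
        simp
      · intro hnot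
        exact absurd (Finset.HasAntidiagonal.mem_antidiagonal.2 (by omega)) hnot
    · simp [hx]
  · intro p _
    exact integrable_expOn ((measurableSet_firstPassage _).inter (measurableSet_isLadder _))
      fun x hx => nonpos_of_isLadder hγ x hx.2

theorem passageExp_zero (γ : ℂ) : passageExp μ γ 0 = 0 := by
  have : firstPassage 0 = ∅ := by
    ext x; simp [firstPassage, walk_zero]
  simp [passageExp, expOn, this]

theorem ladderExp_zero (γ : ℂ) : ladderExp μ γ 0 = 1 := by
  have : isLadder 0 = univ := by
    ext x; simp [isLadder]
  simp [ladderExp, expOn, this, walk_zero]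

theorem nonposExp_zero (β : ℂ) : nonposExp μ β 0 = 1 := by
  have : staysNonpos 0 = univ := by
    ext x; simp [staysNonpos, walk_zero]
  simp [nonposExp, expOn, this, walk_zero]

theorem integral_stepLaw_eval {E : Type*} [NormedAddCommGroup E] [NormedSpace ℝ E] {g : ℝ → E}
    (hg : AEStronglyMeasurable g μ) (k : ℕ) :
    ∫ x, g (x k) ∂(stepLaw μ) = ∫ z, g z ∂μ := by
  have hmp := measurePreserving_eval_infinitePi (fun _ : ℕ => μ) k
  rw [← hmp.map_eq] at hg
  conv_rhs => rw [← hmp.map_eq]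
  rw [integral_map hmp.measurable.aemeasurable hg]
  rfl

theorem integrable_stepLaw_eval {E : Type*} [NormedAddCommGroup E] {g : ℝ → E}
    (hg : Integrable g μ) (k : ℕ) : Integrable (fun x => g (x k)) (stepLaw μ) :=
  (measurePreserving_eval_infinitePi (fun _ : ℕ => μ) k).integrable_comp_of_integrable hg

theorem walk_succ (x : ℕ → ℝ) (k : ℕ) : walk x (k + 1) = walk x k + x k :=
  Finset.sum_range_succ _ _

theorem norm_expOn_firstPassage_le {β : ℂ} (hβ : 0 ≤ β.re) (k : ℕ) (x : ℕ → ℝ) :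
    ‖expOn (firstPassage (k + 1)) β (k + 1) x‖ ≤ Real.exp (β.re * x k) := by
  classical
  rw [expOn, indicator_apply]
  split_ifs with hx
  · rw [Complex.norm_exp, Complex.re_mul_ofReal, walk_succ]
    refine Real.exp_le_exp.2 (mul_le_mul_of_nonneg_left ?_ hβ)
    have := hx.1 k (Nat.lt_succ_self k)
    linarith
  · simpa using (Real.exp_pos _).le

theorem integrable_expOn_firstPassage {β : ℂ} (hβ : 0 ≤ β.re)
    (hI : Integrable (fun z => Real.exp (β.re * z)) μ) (k : ℕ) :
    Integrable (expOn (firstPassage (k + 1)) β (k + 1)) (stepLaw μ) :=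
  (integrable_stepLaw_eval hI k).mono'
    (measurable_expOn (measurableSet_firstPassage _) _ _).aestronglyMeasurable
    (ae_of_all _ (norm_expOn_firstPassage_le hβ k))

/-- One step of the walk killed at its first passage above zero. -/
theorem nonposExp_mul {β : ℂ} (hβ : 0 ≤ β.re)
    (hI : Integrable (fun z => Real.exp (β.re * z)) μ) (k : ℕ) :
    (∫ z : ℝ, Complex.exp (β * z) ∂μ) * nonposExp μ β k
      = nonposExp μ β (k + 1) + passageExp μ β (k + 1) := by
  classical
  rw [nonposExp, nonposExp, passageExp, ← integral_add
    (integrable_expOn (measurableSet_staysNonpos _) (nonpos_of_staysNonpos hβ))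
    (integrable_expOn_firstPassage hβ hI k), mul_comm,
    ← integral_stepLaw_eval (μ := μ) (g := fun z : ℝ => Complex.exp (β * z)) (by fun_prop) 0]
  refine (integral_stepLaw_eq_mul ((measurable_expOn (measurableSet_staysNonpos _) _ _).add
    (measurable_expOn (measurableSet_firstPassage _) _ _)) k fun y x => ?_).symm
  have hw : walk (splice k (y, x)) (k + 1) = walk y k + x 0 := by
    rw [walk_splice_add]; simp [walk]
  have h1 : splice k (y, x) ∈ staysNonpos (k + 1) ↔ y ∈ staysNonpos k ∧ walk y k + x 0 ≤ 0 := by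
    simp only [staysNonpos, mem_ofPred_eq]
    constructor
    · intro hx
      refine ⟨fun i hi => ?_, hw ▸ hx (k + 1) le_rfl⟩
      have := hx i (by omega)
      rwa [walk_splice_of_le hi] at this
    · rintro ⟨h1, h2⟩ i hi
      rcases Nat.lt_or_ge i (k + 1) with hik | hik
      · rw [walk_splice_of_le (by omega)]; exact h1 i (by omega)
      · rw [show i = k + 1 by omega, hw]; exact h2
  have h2 : splice k (y, x) ∈ firstPassage (k + 1)
      ↔ y ∈ staysNonpos k ∧ ¬ walk y k + x 0 ≤ 0 := by
    simp only [firstPassage, staysNonpos, mem_ofPred_eq, hw, not_le]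
    refine and_congr_left fun _ => ?_
    constructor
    · intro hx i hi
      have := hx i (by omega)
      rwa [walk_splice_of_le hi] at this
    · intro hx i hi
      rw [walk_splice_of_le (by omega)]; exact hx i (by omega)
  simp only [Pi.add_apply, expOn, indicator_apply, h1, h2, hw]
  by_cases h3 : y ∈ staysNonpos k <;> by_cases h4 : walk y k + x 0 ≤ 0 <;>
    simp [h3, h4, mul_add, Complex.exp_add]

theorem norm_nonposExp_le {β : ℂ} (hβ : 0 ≤ β.re) (k : ℕ) : ‖nonposExp μ β k‖ ≤ 1 :=
  norm_integral_expOn_le_one (nonpos_of_staysNonpos hβ)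

theorem norm_ladderExp_le {γ : ℂ} (hγ : γ.re ≤ 0) (k : ℕ) : ‖ladderExp μ γ k‖ ≤ 1 :=
  norm_integral_expOn_le_one (nonpos_of_isLadder hγ)

theorem norm_passageExp_le_one {γ : ℂ} (hγ : γ.re ≤ 0) (k : ℕ) : ‖passageExp μ γ k‖ ≤ 1 :=
  norm_integral_expOn_le_one (nonpos_of_firstPassage hγ)

theorem norm_passageExp_le {β : ℂ} (hβ : 0 ≤ β.re)
    (hI : Integrable (fun z => Real.exp (β.re * z)) μ) (k : ℕ) :
    ‖passageExp μ β k‖ ≤ ∫ z, Real.exp (β.re * z) ∂μ := by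
  cases k with
  | zero =>
    rw [passageExp_zero, norm_zero]
    exact integral_nonneg fun _ => (Real.exp_pos _).le
  | succ k =>
    rw [passageExp, ← integral_stepLaw_eval (μ := μ) (g := fun z : ℝ => Real.exp (β.re * z))
      (by fun_prop) k]
    exact norm_integral_le_of_norm_le (integrable_stepLaw_eval hI k)
      (ae_of_all _ (norm_expOn_firstPassage_le hβ k))

/-- The generating function of a sequence. -/
def genFun (a : ℕ → ℂ) (s : ℝ) : ℂ := ∑' n, (s : ℂ) ^ n * a n

theorem summable_genFun {a : ℕ → ℂ} {C s : ℝ} (ha : ∀ n, ‖a n‖ ≤ C) (hs0 : 0 ≤ s) (hs1 : s < 1) :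
    Summable fun n => ‖(s : ℂ) ^ n * a n‖ := by
  refine Summable.of_nonneg_of_le (fun _ => norm_nonneg _) (fun n => ?_)
    ((summable_geometric_of_lt_one hs0 hs1).mul_right C)
  rw [norm_mul, norm_pow, Complex.norm_real, Real.norm_eq_abs, abs_of_nonneg hs0]
  exact mul_le_mul_of_nonneg_left (ha n) (by positivity)

theorem norm_genFun_le {a : ℕ → ℂ} {C s : ℝ} (ha : ∀ n, ‖a n‖ ≤ C) (hs0 : 0 ≤ s) (hs1 : s < 1) :
    ‖genFun a s‖ ≤ C / (1 - s) := by
  have h1 := (hasSum_geometric_of_lt_one hs0 hs1).mul_right C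
  rw [inv_mul_eq_div] at h1
  refine tsum_of_norm_bounded h1 fun n => ?_
  rw [norm_mul, norm_pow, Complex.norm_real, Real.norm_eq_abs, abs_of_nonneg hs0]
  exact mul_le_mul_of_nonneg_left (ha n) (by positivity)

theorem genFun_eq_add {a : ℕ → ℂ} {C s : ℝ} (ha : ∀ n, ‖a n‖ ≤ C) (hs0 : 0 ≤ s) (hs1 : s < 1) :
    genFun a s = a 0 + s * genFun (fun n => a (n + 1)) s := by
  rw [genFun, (summable_genFun ha hs0 hs1).of_norm.tsum_eq_zero_add, genFun, ← tsum_mul_left]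
  simp only [pow_zero, one_mul]
  congr 2 with n
  rw [pow_succ]
  ring

theorem genFun_conv {a b : ℕ → ℂ} {A B s r : ℝ} (ha : ∀ n, ‖a n‖ ≤ A) (hb : ∀ n, ‖b n‖ ≤ B)
    (hs0 : 0 ≤ s) (hs1 : s < 1) (hr0 : 0 ≤ r) (hr1 : r ≤ 1) :
    genFun (fun m => ∑ p ∈ Finset.HasAntidiagonal.antidiagonal m, (r : ℂ) ^ p.1 * a p.1 * b p.2) s
      = genFun a (s * r) * genFun b s := by
  have hsr : s * r < 1 := (mul_le_of_le_one_right hs0 hr1).trans_lt hs1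
  rw [genFun, genFun, genFun, tsum_mul_tsum_eq_tsum_sum_antidiagonal_of_summable_norm
    (summable_genFun ha (mul_nonneg hs0 hr0) hsr) (summable_genFun hb hs0 hs1)]
  congr 1 with m
  rw [Finset.mul_sum]
  refine Finset.sum_congr rfl fun p hp => ?_
  rw [← Finset.HasAntidiagonal.mem_antidiagonal.1 hp, pow_add]
  push_cast
  rw [mul_pow]
  ring

section Walk

variable {μ : Measure ℝ} [IsProbabilityMeasure μ]

theorem genFun_nonposExp {β : ℂ} (hβ : 0 ≤ β.re)
    (hI : Integrable (fun z => Real.exp (β.re * z)) μ) {s : ℝ} (hs0 : 0 ≤ s) (hs1 : s < 1) :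
    (1 - s * ∫ z : ℝ, Complex.exp (β * z) ∂μ) * genFun (nonposExp μ β) s
      = 1 - genFun (passageExp μ β) s := by
  have h1 := norm_nonposExp_le (μ := μ) hβ
  have h2 := norm_passageExp_le hβ hI
  have e1 := genFun_eq_add h1 hs0 hs1
  have e2 := genFun_eq_add h2 hs0 hs1
  rw [nonposExp_zero] at e1
  rw [passageExp_zero, zero_add] at e2
  have e3 : (∫ z : ℝ, Complex.exp (β * z) ∂μ) * genFun (nonposExp μ β) s
      = genFun (fun n => nonposExp μ β (n + 1)) s + genFun (fun n => passageExp μ β (n + 1)) s := by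
    rw [genFun, genFun, genFun, ← tsum_mul_left, ← Summable.tsum_add
      (summable_genFun (fun n => h1 (n + 1)) hs0 hs1).of_norm
      (summable_genFun (fun n => h2 (n + 1)) hs0 hs1).of_norm]
    congr 1 with n
    rw [← mul_add, ← nonposExp_mul hβ hI]
    ring
  rw [sub_mul, one_mul, mul_assoc, e3, e2]
  nth_rewrite 1 [e1]
  ring

theorem genFun_ladderExp {γ : ℂ} (hγ : γ.re ≤ 0) {s : ℝ} (hs0 : 0 ≤ s) (hs1 : s < 1) :
    (1 - genFun (passageExp μ γ) s) * genFun (ladderExp μ γ) s = 1 := by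
  have h1 := norm_ladderExp_le (μ := μ) hγ
  have h2 := norm_passageExp_le_one (μ := μ) hγ
  have h3 := genFun_conv h2 h1 hs0 hs1 zero_le_one le_rfl
  have h4 : (fun m => ∑ p ∈ Finset.HasAntidiagonal.antidiagonal m,
      ((1 : ℝ) : ℂ) ^ p.1 * passageExp μ γ p.1 * ladderExp μ γ p.2)
      = fun m => ladderExp μ γ m - if m = 0 then 1 else 0 := by
    ext m
    simp only [Complex.ofReal_one, one_pow, one_mul]
    cases m with
    | zero => simp [passageExp_zero, ladderExp_zero]
    | succ m => simp [← ladderExp_succ hγ]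
  rw [h4, mul_one] at h3
  have h5 : genFun (fun m => ladderExp μ γ m - if m = 0 then 1 else 0) s
      = genFun (ladderExp μ γ) s - 1 := by
    have h6 : HasSum (fun n : ℕ => (s : ℂ) ^ n * if n = 0 then (1 : ℂ) else 0) 1 := by
      convert! hasSum_ite_eq (0 : ℕ) (1 : ℂ) using 2 with n
      split_ifs with hn <;> simp [hn]
    have h7 := (summable_genFun h1 hs0 hs1).of_norm.hasSum.sub h6
    refine (h7.congr_fun fun n => ?_).tsum_eq
    rw [mul_sub]
  rw [h5] at h3
  rw [sub_mul, one_mul, ← h3]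
  ring

theorem genFun_passageExp_ne_one {γ : ℂ} (hγ : γ.re ≤ 0) {s : ℝ} (hs0 : 0 ≤ s) (hs1 : s < 1) :
    1 - genFun (passageExp μ γ) s ≠ 0 :=
  left_ne_zero_of_mul_eq_one (genFun_ladderExp hγ hs0 hs1)

/-- `r^G e^{γM}` for the running maximum `M` on `{0, …, m}`, first attained at time `G`. -/
def maxFun (m : ℕ) (r : ℝ) (γ : ℂ) (x : ℕ → ℝ) : ℂ :=
  ∑ p ∈ Finset.HasAntidiagonal.antidiagonal m, (r : ℂ) ^ p.1 * expOn (firstMax m p.1) γ p.1 x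

/-- `r^L e^{βI}` for the running minimum `I` on `{0, …, m}`, last attained at time `L`. -/
def minFun (m : ℕ) (r : ℝ) (β : ℂ) (x : ℕ → ℝ) : ℂ :=
  ∑ p ∈ Finset.HasAntidiagonal.antidiagonal m, (r : ℂ) ^ p.1 * expOn (lastMin m p.1) β p.1 x

theorem measurable_maxFun (m : ℕ) (r : ℝ) (γ : ℂ) : Measurable (maxFun m r γ) :=
  Finset.measurable_fun_sum _ fun _ _ => (measurable_expOn (measurableSet_firstMax _ _) _ _).const_mul _

theorem measurable_minFun (m : ℕ) (r : ℝ) (β : ℂ) : Measurable (minFun m r β) :=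
  Finset.measurable_fun_sum _ fun _ _ => (measurable_expOn (measurableSet_lastMin _ _) _ _).const_mul _

theorem maxFun_eq {m j : ℕ} (hj : j ≤ m) {x : ℕ → ℝ} (hx : x ∈ firstMax m j) (r : ℝ) (γ : ℂ) :
    maxFun m r γ x = (r : ℂ) ^ j * Complex.exp (γ * walk x j) := by
  classical
  rw [maxFun, Finset.sum_eq_single (j, m - j)]
  · simp [expOn, hx]
  · rintro ⟨a, b⟩ hab hne
    have hab' := Finset.HasAntidiagonal.mem_antidiagonal.1 hab
    simp only at hab'
    rw [expOn, indicator_of_notMem, mul_zero]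
    intro ha
    have haj : a = j := by
      rcases lt_trichotomy a j with h1 | h1 | h1
      · exact absurd (hx.1 a h1) (not_lt.2 (ha.2 j hj))
      · exact h1
      · exact absurd (ha.1 j h1) (not_lt.2 (hx.2 a (by omega)))
    exact hne (by rw [haj, ← hab', haj]; simp)
  · intro hnot
    exact absurd (Finset.HasAntidiagonal.mem_antidiagonal.2 (by omega)) hnot

theorem minFun_eq {m j : ℕ} (hj : j ≤ m) {x : ℕ → ℝ} (hx : x ∈ lastMin m j) (r : ℝ) (β : ℂ) :
    minFun m r β x = (r : ℂ) ^ j * Complex.exp (β * walk x j) := by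
  classical
  rw [minFun, Finset.sum_eq_single (j, m - j)]
  · simp [expOn, hx]
  · rintro ⟨a, b⟩ hab hne
    have hab' := Finset.HasAntidiagonal.mem_antidiagonal.1 hab
    simp only at hab'
    rw [expOn, indicator_of_notMem, mul_zero]
    intro ha
    have haj : a = j := by
      rcases lt_trichotomy a j with h1 | h1 | h1
      · exact absurd (ha.2 j hj h1) (not_lt.2 (hx.1 a (by omega)))
      · exact h1
      · exact absurd (hx.2 a (by omega) h1) (not_lt.2 (ha.1 j hj))
    exact hne (by rw [haj, ← hab', haj]; simp)
  · intro hnot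
    exact absurd (Finset.HasAntidiagonal.mem_antidiagonal.2 (by omega)) hnot

theorem nonpos_of_firstMax {m j : ℕ} {γ : ℂ} (hγ : γ.re ≤ 0) :
    ∀ x ∈ firstMax m j, γ.re * walk x j ≤ 0 := by
  intro x hx
  have := hx.2 0 (Nat.zero_le _)
  rw [walk_zero] at this
  exact mul_nonpos_of_nonpos_of_nonneg hγ this

theorem nonpos_of_lastMin {m j : ℕ} {β : ℂ} (hβ : 0 ≤ β.re) :
    ∀ x ∈ lastMin m j, β.re * walk x j ≤ 0 := by
  intro x hx
  have := hx.1 0 (Nat.zero_le _)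
  rw [walk_zero] at this
  exact mul_nonpos_of_nonneg_of_nonpos hβ this

theorem integral_maxFun {γ : ℂ} (hγ : γ.re ≤ 0) (m : ℕ) (r : ℝ) :
    ∫ x, maxFun m r γ x ∂(stepLaw μ) = ∑ p ∈ Finset.HasAntidiagonal.antidiagonal m,
      (r : ℂ) ^ p.1 * ladderExp μ γ p.1 * nonposExp μ 0 p.2 := by
  simp only [maxFun]
  rw [integral_finsetSum]
  · refine Finset.sum_congr rfl fun p hp => ?_
    rw [integral_const_mul, ← Finset.HasAntidiagonal.mem_antidiagonal.1 hp, integral_firstMax,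
      mul_assoc]
  · exact fun p _ => (integrable_expOn (measurableSet_firstMax _ _)
      (nonpos_of_firstMax hγ)).const_mul _

theorem integral_minFun {β : ℂ} (hβ : 0 ≤ β.re) (m : ℕ) (r : ℝ) :
    ∫ x, minFun m r β x ∂(stepLaw μ) = ∑ p ∈ Finset.HasAntidiagonal.antidiagonal m,
      (r : ℂ) ^ p.1 * nonposExp μ β p.1 * ladderExp μ 0 p.2 := by
  simp only [minFun]
  rw [integral_finsetSum]
  · refine Finset.sum_congr rfl fun p hp => ?_
    rw [integral_const_mul, ← Finset.HasAntidiagonal.mem_antidiagonal.1 hp, integral_lastMin,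
      mul_assoc]
  · exact fun p _ => (integrable_expOn (measurableSet_lastMin _ _)
      (nonpos_of_lastMin hβ)).const_mul _

theorem genFun_nonposExp_zero {s : ℝ} (hs0 : 0 ≤ s) (hs1 : s < 1) :
    (1 - s) * genFun (nonposExp μ 0) s = 1 - genFun (passageExp μ 0) s := by
  have := genFun_nonposExp (μ := μ) (β := 0) le_rfl (by simp) hs0 hs1
  simpa using this

/-- The discrete Wiener–Hopf factor of the maximum at a geometric time. -/
theorem genFun_integral_maxFun {γ : ℂ} (hγ : γ.re ≤ 0) {s r : ℝ} (hs0 : 0 ≤ s) (hs1 : s < 1)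
    (hr0 : 0 ≤ r) (hr1 : r ≤ 1) :
    (1 - s) * genFun (fun m => ∫ x, maxFun m r γ x ∂(stepLaw μ)) s
      = (1 - genFun (passageExp μ 0) s) / (1 - genFun (passageExp μ γ) (s * r)) := by
  have hsr : s * r < 1 := (mul_le_of_le_one_right hs0 hr1).trans_lt hs1
  simp only [integral_maxFun hγ]
  rw [genFun_conv (norm_ladderExp_le hγ) (norm_nonposExp_le le_rfl) hs0 hs1 hr0 hr1,
    ← genFun_nonposExp_zero hs0 hs1,
    eq_div_iff (genFun_passageExp_ne_one hγ (mul_nonneg hs0 hr0) hsr)]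
  have := genFun_ladderExp (μ := μ) hγ (mul_nonneg hs0 hr0) hsr
  linear_combination ((1 - s : ℂ) * genFun (nonposExp μ 0) s) * this

/-- The discrete Wiener–Hopf factor of the minimum at a geometric time. -/
theorem genFun_integral_minFun {β : ℂ} (hβ : 0 ≤ β.re)
    (hI : Integrable (fun z => Real.exp (β.re * z)) μ) {s r : ℝ} (hs0 : 0 ≤ s) (hs1 : s < 1)
    (hr0 : 0 ≤ r) (hr1 : r ≤ 1) :
    (1 - (s * r : ℝ) * ∫ z : ℝ, Complex.exp (β * z) ∂μ)
        * ((1 - s) * genFun (fun m => ∫ x, minFun m r β x ∂(stepLaw μ)) s)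
      = (1 - s) * (1 - genFun (passageExp μ β) (s * r)) / (1 - genFun (passageExp μ 0) s) := by
  have hsr : s * r < 1 := (mul_le_of_le_one_right hs0 hr1).trans_lt hs1
  simp only [integral_minFun hβ]
  rw [genFun_conv (norm_nonposExp_le hβ) (norm_ladderExp_le le_rfl) hs0 hs1 hr0 hr1,
    eq_div_iff (genFun_passageExp_ne_one le_rfl hs0 hs1),
    ← genFun_nonposExp hβ hI (mul_nonneg hs0 hr0) hsr]
  have := genFun_ladderExp (μ := μ) (γ := 0) le_rfl hs0 hs1
  linear_combination ((1 - s : ℂ) * genFun (nonposExp μ β) (s * r)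
    * (1 - (s * r : ℝ) * ∫ z : ℝ, Complex.exp (β * z) ∂μ)) * this

end Walk

instance (lam : Measure ℝ) [IsFiniteMeasure lam] (t : ℝ≥0) : IsProbabilityMeasure (cpLaw lam t) :=
  isProbabilityMeasure_cpLaw lam t.2

theorem ae_walk_lattice {μ : Measure ℝ} [IsProbabilityMeasure μ] {h : ℝ}
    (hμ : ∀ᵐ x ∂μ, ∃ k : ℤ, x = h * k) :
    ∀ᵐ x ∂(stepLaw μ), ∀ k, ∃ j : ℤ, walk x k = h * j := by
  have h1 : ∀ᵐ x ∂(stepLaw μ), ∀ k, ∃ j : ℤ, x k = h * j :=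
    ae_all_iff.2 fun k =>
      (measurePreserving_eval_infinitePi (fun _ : ℕ => μ) k).quasiMeasurePreserving.ae hμ
  filter_upwards [h1] with x hx k
  induction k with
  | zero => exact ⟨0, by simp [walk_zero]⟩
  | succ k ih =>
    obtain ⟨i, hi⟩ := ih
    obtain ⟨j, hj⟩ := hx k
    exact ⟨i + j, by rw [walk_succ, hi, hj]; push_cast; ring⟩

namespace IsSkipFreeMeasure

variable {lam : Measure ℝ} {h : ℝ} [IsFiniteMeasure lam]

/-- Overshoots at the first passage above zero are negligible on a fine grid. -/
theorem norm_passageExp_sub_le (H : IsSkipFreeMeasure lam h) (γ : ℂ) {δ : ℝ≥0} (hδ : 0 < δ)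
    (hδ1 : δ ≤ 1) (k : ℕ) :
    ‖passageExp (cpLaw lam δ) γ k - Complex.exp (γ * h) * passageExp (cpLaw lam δ) 0 k‖
      ≤ 2 * (Real.exp (lam.real univ * Real.exp (max γ.re 0 * h)) * (δ : ℝ) ^ 2) := by
  classical
  set b := max γ.re 0 with hb
  have hb0 : 0 ≤ b := le_max_right _ _
  have hbγ : γ.re ≤ b := le_max_left _ _
  set μ := cpLaw lam δ with hμ
  have hIb : Integrable (fun z => Real.exp (b * z)) μ := (H.integral_exp_cpLaw hb0 δ.2).1
  have hIb' : Integrable ((Ici (2 * h)).indicator fun z => 2 * Real.exp (b * z)) μ :=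
    (hIb.const_mul 2).indicator measurableSet_Ici
  cases k with
  | zero => rw [passageExp_zero, passageExp_zero, mul_zero, sub_zero, norm_zero]; positivity
  | succ k =>
    have hIγ : Integrable (expOn (firstPassage (k + 1)) γ (k + 1)) (stepLaw μ) := by
      rcases le_total γ.re 0 with h0 | h0
      · exact integrable_expOn (measurableSet_firstPassage _) (nonpos_of_firstPassage h0)
      · refine integrable_expOn_firstPassage h0 ?_ k
        rwa [hb, max_eq_left h0] at hIb
    have hI0 : Integrable (expOn (firstPassage (k + 1)) 0 (k + 1)) (stepLaw μ) :=
      integrable_expOn (measurableSet_firstPassage _) (nonpos_of_firstPassage le_rfl)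
    rw [passageExp, passageExp, ← integral_const_mul, ← integral_sub hIγ (hI0.const_mul _)]
    refine (norm_integral_le_of_norm_le (integrable_stepLaw_eval hIb' k) ?_).trans ?_
    · filter_upwards [ae_walk_lattice (H.ae_cpLaw_lattice δ)] with x hx
      simp only [expOn, indicator_apply, zero_mul, Complex.exp_zero]
      by_cases hfp : x ∈ firstPassage (k + 1)
      · simp only [hfp, if_true, mul_one]
        obtain ⟨j, hj⟩ := hx (k + 1)
        have hpos : 0 < walk x (k + 1) := hfp.2
        have hle : walk x (k + 1) ≤ x k := by
          have := hfp.1 k (Nat.lt_succ_self k)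
          rw [walk_succ]; linarith
        rw [hj, mul_pos_iff_of_pos_left H.h_pos] at hpos
        have hj1 : 1 ≤ j := by exact_mod_cast hpos
        rcases hj1.eq_or_lt with h1 | h1
        · rw [hj, ← h1]
          simp only [Int.cast_one, mul_one, sub_self, norm_zero]
          split_ifs <;> positivity
        · have h2 : (2 : ℝ) ≤ j := by exact_mod_cast h1
          have h3 : 2 * h ≤ walk x (k + 1) := by
            rw [hj, mul_comm]; exact mul_le_mul_of_nonneg_left h2 H.h_pos.le
          rw [if_pos (show x k ∈ Ici (2 * h) from h3.trans hle)]
          refine (norm_sub_le _ _).trans ?_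
          rw [two_mul, Complex.norm_exp, Complex.norm_exp, Complex.re_mul_ofReal,
            Complex.re_mul_ofReal]
          have hwk : 0 ≤ walk x (k + 1) := hfp.2.le
          refine add_le_add (Real.exp_le_exp.2 ?_) (Real.exp_le_exp.2 ?_)
          · exact (mul_le_mul_of_nonneg_right hbγ hwk).trans (mul_le_mul_of_nonneg_left hle hb0)
          · refine (mul_le_mul_of_nonneg_right hbγ H.h_pos.le).trans
              (mul_le_mul_of_nonneg_left ?_ hb0)
            linarith [H.h_pos]
      · simp only [hfp, if_false, mul_zero, sub_self, norm_zero]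
        split_ifs <;> positivity
    · rw [integral_stepLaw_eval (μ := μ) hIb'.1 k, integral_indicator measurableSet_Ici,
        integral_const_mul]
      exact mul_le_mul_of_nonneg_left
        (H.setIntegral_exp_Ici_le hb0 (by exact_mod_cast hδ) (by exact_mod_cast hδ1)) two_pos.le

theorem norm_passageExp_cpLaw_le (H : IsSkipFreeMeasure lam h) (γ : ℂ) (δ : ℝ≥0) :
    ∃ C, ∀ k, ‖passageExp (cpLaw lam δ) γ k‖ ≤ C := by
  rcases le_total γ.re 0 with h0 | h0
  · exact ⟨1, norm_passageExp_le_one h0⟩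
  · exact ⟨_, norm_passageExp_le h0 (H.integral_exp_cpLaw h0 δ.2).1⟩

theorem tendsto_one_sub_exp_div {δ : ℕ → ℝ≥0} (hδ : ∀ n, 0 < δ n)
    (hlim : Tendsto δ atTop (𝓝 0)) (z : ℂ) :
    Tendsto (fun n => (1 - Complex.exp (-z * (δ n : ℝ))) / (δ n : ℝ)) atTop (𝓝 z) := by
  have h1 : HasDerivAt (fun t : ℝ => 1 - Complex.exp (-z * t)) z 0 := by
    have := (((Complex.ofRealCLM.hasDerivAt (x := (0 : ℝ))).const_mul (-z)).cexp).const_sub 1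
    simpa using this
  have h2 := h1.tendsto_slope_zero
  have h3 : Tendsto (fun n => (δ n : ℝ)) atTop (𝓝[≠] 0) := by
    refine tendsto_nhdsWithin_iff.2 ⟨?_, Eventually.of_forall fun n => ?_⟩
    · exact_mod_cast (NNReal.continuous_coe.tendsto 0).comp hlim
    · simpa using (hδ n).ne'
  refine (h2.comp h3).congr fun n => ?_
  simp [div_eq_inv_mul]

theorem tendsto_genFun_passageExp (H : IsSkipFreeMeasure lam h) {δ : ℕ → ℝ≥0}
    (hδ : ∀ n, 0 < δ n) (hδ1 : ∀ n, δ n ≤ 1) (hlim : Tendsto δ atTop (𝓝 0)) {q : ℝ} (hq : 0 < q)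
    (γ : ℂ) :
    Tendsto (fun n => genFun (passageExp (cpLaw lam (δ n)) γ) (Real.exp (-q * δ n))) atTop
      (𝓝 (Complex.exp ((γ - Phi lam q) * h))) := by
  have hs0 : ∀ n, 0 ≤ Real.exp (-q * δ n) := fun n => (Real.exp_pos _).le
  have hs1 : ∀ n, Real.exp (-q * δ n) < 1 := fun n => by
    rw [Real.exp_lt_one_iff]
    exact mul_neg_of_neg_of_pos (neg_lt_zero.2 hq) (by exact_mod_cast hδ n)
  have hδ0 : Tendsto (fun n => (δ n : ℝ)) atTop (𝓝 0) := by
    exact_mod_cast (NNReal.continuous_coe.tendsto 0).comp hlim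
  have hslope : Tendsto (fun n => (1 - Real.exp (-q * δ n)) / (δ n : ℝ)) atTop (𝓝 q) := by
    have := (Complex.continuous_re.tendsto _).comp (tendsto_one_sub_exp_div hδ hlim (q : ℂ))
    rw [Complex.ofReal_re] at this
    refine this.congr fun n => ?_
    have : (1 - Complex.exp (-(q : ℂ) * (δ n : ℝ))) / ((δ n : ℝ) : ℂ)
        = (((1 - Real.exp (-q * δ n)) / (δ n : ℝ) : ℝ) : ℂ) := by push_cast; rfl
    simp only [Function.comp]
    rw [this, Complex.ofReal_re]
  have hdiff : ∀ γ : ℂ, Tendsto (fun n =>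
      genFun (passageExp (cpLaw lam (δ n)) γ) (Real.exp (-q * δ n))
      - Complex.exp (γ * h) * genFun (passageExp (cpLaw lam (δ n)) 0) (Real.exp (-q * δ n)))
      atTop (𝓝 0) := by
    intro γ
    set C := 2 * Real.exp (lam.real univ * Real.exp (max γ.re 0 * h)) with hC
    have hbound : ∀ n, ‖genFun (passageExp (cpLaw lam (δ n)) γ) (Real.exp (-q * δ n))
        - Complex.exp (γ * h) * genFun (passageExp (cpLaw lam (δ n)) 0) (Real.exp (-q * δ n))‖
        ≤ C * δ n * ((1 - Real.exp (-q * δ n)) / (δ n : ℝ))⁻¹ := by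
      intro n
      obtain ⟨A, hA⟩ := H.norm_passageExp_cpLaw_le γ (δ n)
      obtain ⟨B, hB⟩ := H.norm_passageExp_cpLaw_le 0 (δ n)
      have h1 : genFun (passageExp (cpLaw lam (δ n)) γ) (Real.exp (-q * δ n))
          - Complex.exp (γ * h) * genFun (passageExp (cpLaw lam (δ n)) 0) (Real.exp (-q * δ n))
          = genFun (fun k => passageExp (cpLaw lam (δ n)) γ k
            - Complex.exp (γ * h) * passageExp (cpLaw lam (δ n)) 0 k) (Real.exp (-q * δ n)) := by
        rw [genFun, genFun, genFun, ← tsum_mul_left, ← Summable.tsum_sub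
          (summable_genFun hA (hs0 n) (hs1 n)).of_norm
          ((summable_genFun hB (hs0 n) (hs1 n)).of_norm.mul_left _)]
        congr 1 with k
        ring
      rw [h1]
      refine (norm_genFun_le (fun k => H.norm_passageExp_sub_le γ (hδ n) (hδ1 n) k) (hs0 n)
        (hs1 n)).trans (le_of_eq ?_)
      rw [hC, inv_div]
      ring
    have hlim2 : Tendsto (fun n => C * δ n * ((1 - Real.exp (-q * δ n)) / (δ n : ℝ))⁻¹) atTop
        (𝓝 (C * 0 * q⁻¹)) := (hδ0.const_mul C).mul (hslope.inv₀ hq.ne')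
    rw [mul_zero, zero_mul] at hlim2
    exact squeeze_zero_norm hbound hlim2
  have hΦ := H.Phi_pos hq
  have hone : ∀ n, genFun (passageExp (cpLaw lam (δ n)) (Phi lam q)) (Real.exp (-q * δ n)) = 1 := by
    intro n
    have hre : 0 ≤ ((Phi lam q : ℝ) : ℂ).re := by simpa using hΦ.le
    have h1 := genFun_nonposExp (μ := cpLaw lam (δ n)) hre
      (H.integral_exp_cpLaw hre (δ n).2).1 (hs0 n) (hs1 n)
    have h2 : (Real.exp (-q * δ n) : ℂ)
        * ∫ z : ℝ, Complex.exp ((Phi lam q : ℝ) * z) ∂(cpLaw lam (δ n)) = 1 := by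
      rw [(H.integral_cexp_cpLaw hre (δ n).coe_nonneg).2, psi_ofReal, H.psiReal_Phi hq, Complex.ofReal_exp,
        ← Complex.exp_add, Complex.exp_eq_one_iff]
      exact ⟨0, by push_cast; ring⟩
    rw [h2, sub_self, zero_mul] at h1
    exact (sub_eq_zero.1 h1.symm).symm
  have h0 : Tendsto (fun n => genFun (passageExp (cpLaw lam (δ n)) 0) (Real.exp (-q * δ n))) atTop
      (𝓝 (Complex.exp (-Phi lam q * h))) := by
    have h1 := hdiff (Phi lam q)
    simp only [hone] at h1
    have h2 := (tendsto_const_nhds (x := (1 : ℂ))).sub h1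
    have h3 := h2.const_mul (Complex.exp (-Phi lam q * h))
    rw [sub_zero, mul_one] at h3
    refine h3.congr fun n => ?_
    rw [sub_sub_cancel, ← mul_assoc, ← Complex.exp_add]
    simp
  have h1 := (hdiff γ).add (h0.const_mul (Complex.exp (γ * h)))
  rw [zero_add, ← Complex.exp_add, ← add_mul, ← sub_eq_add_neg] at h1
  refine h1.congr fun n => ?_
  ring

end IsSkipFreeMeasure

namespace IsSkipFreeMeasure

variable {lam : Measure ℝ} {h : ℝ} [IsFiniteMeasure lam]

theorem one_sub_cexp_ne_zero {z : ℂ} (hz : z.re < 0) : 1 - Complex.exp z ≠ 0 := by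
  intro h0
  have h1 : ‖Complex.exp z‖ = 1 := by rw [← sub_eq_zero.1 h0, norm_one]
  rw [Complex.norm_exp, Real.exp_eq_one_iff] at h1
  exact hz.ne h1

theorem tendsto_genFun_maxFun (H : IsSkipFreeMeasure lam h) {δ : ℕ → ℝ≥0}
    (hδ : ∀ n, 0 < δ n) (hδ1 : ∀ n, δ n ≤ 1) (hlim : Tendsto δ atTop (𝓝 0)) {p α : ℝ} (hp : 0 < p)
    (hα : 0 ≤ α) {β : ℂ} (hβ : 0 ≤ β.re) :
    Tendsto (fun n => (1 - (Real.exp (-p * δ n) : ℂ))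
        * genFun (fun m => ∫ x, maxFun m (Real.exp (-α * δ n)) (-β) x ∂(stepLaw (cpLaw lam (δ n))))
          (Real.exp (-p * δ n))) atTop
      (𝓝 ((1 - Complex.exp (-Phi lam p * h)) / (1 - Complex.exp (-(β + Phi lam (p + α)) * h)))) := by
  have hpα : 0 < p + α := by linarith
  have hΦ := H.Phi_pos hpα
  have h0 := H.tendsto_genFun_passageExp hδ hδ1 hlim hp 0
  have h1 := H.tendsto_genFun_passageExp hδ hδ1 hlim hpα (-β)
  have hne : 1 - Complex.exp (-(β + Phi lam (p + α)) * h) ≠ 0 := by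
    refine one_sub_cexp_ne_zero ?_
    have := H.h_pos
    simp only [neg_mul, Complex.neg_re, Complex.mul_re, Complex.add_re, Complex.ofReal_re,
      Complex.ofReal_im, mul_zero, sub_zero]
    have : 0 < (β.re + Phi lam (p + α)) * h := by positivity
    linarith
  have e1 : (0 - (Phi lam p : ℂ)) * h = -Phi lam p * h := by ring
  have e2 : (-β - (Phi lam (p + α) : ℂ)) * h = -(β + Phi lam (p + α)) * h := by ring
  rw [e1] at h0
  rw [e2] at h1
  refine ((h0.const_sub 1).div (h1.const_sub 1) hne).congr fun n => ?_
  have hd : (0 : ℝ) < δ n := NNReal.coe_pos.2 (hδ n)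
  rw [genFun_integral_maxFun (by simpa using hβ) (Real.exp_pos _).le
    (Real.exp_lt_one_iff.2 (by nlinarith)) (Real.exp_pos _).le
    (Real.exp_le_one_iff.2 (by nlinarith)), ← Real.exp_add,
    ← add_mul, ← neg_add]
  rfl

theorem tendsto_genFun_minFun (H : IsSkipFreeMeasure lam h) {δ : ℕ → ℝ≥0}
    (hδ : ∀ n, 0 < δ n) (hδ1 : ∀ n, δ n ≤ 1) (hlim : Tendsto δ atTop (𝓝 0)) {p α : ℝ} (hp : 0 < p)
    (hα : 0 ≤ α) {β : ℂ} (hβ : 0 ≤ β.re) (hne : (p : ℂ) + α ≠ psi lam β) :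
    Tendsto (fun n => (1 - (Real.exp (-p * δ n) : ℂ))
        * genFun (fun m => ∫ x, minFun m (Real.exp (-α * δ n)) β x ∂(stepLaw (cpLaw lam (δ n))))
          (Real.exp (-p * δ n))) atTop
      (𝓝 (p / (p + α - psi lam β)
        * ((1 - Complex.exp ((β - Phi lam (p + α)) * h)) / (1 - Complex.exp (-Phi lam p * h))))) := by
  have hpα : 0 < p + α := by linarith
  have hΦ := H.Phi_pos hp
  have h0 := H.tendsto_genFun_passageExp hδ hδ1 hlim hp 0
  have h1 := H.tendsto_genFun_passageExp hδ hδ1 hlim hpα β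
  have hne0 : 1 - Complex.exp (-Phi lam p * h) ≠ 0 := by
    refine one_sub_cexp_ne_zero ?_
    have := H.h_pos
    simp only [neg_mul, Complex.neg_re, Complex.mul_re, Complex.ofReal_re,
      Complex.ofReal_im, mul_zero, sub_zero]
    have : 0 < Phi lam p * h := by positivity
    linarith
  have e1 : (0 - (Phi lam p : ℂ)) * h = -Phi lam p * h := by ring
  rw [e1] at h0
  have hz : (p : ℂ) + α - psi lam β ≠ 0 := sub_ne_zero.2 hne
  have h2 := tendsto_one_sub_exp_div hδ hlim (p : ℂ)
  have h3 := tendsto_one_sub_exp_div hδ hlim ((p : ℂ) + α - psi lam β)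
  have h4 := (h2.div h3 hz).mul ((h1.const_sub 1).div (h0.const_sub 1) hne0)
  refine h4.congr' ?_
  filter_upwards [h3.eventually_ne hz] with n hn
  have hd : (0 : ℝ) < δ n := NNReal.coe_pos.2 (hδ n)
  have hdC : ((δ n : ℝ) : ℂ) ≠ 0 := Complex.ofReal_ne_zero.2 hd.ne'
  have key := genFun_integral_minFun (μ := cpLaw lam (δ n)) hβ
    (H.integral_exp_cpLaw hβ (δ n).coe_nonneg).1 (Real.exp_pos (-p * δ n)).le
    (Real.exp_lt_one_iff.2 (by nlinarith)) (Real.exp_pos (-α * δ n)).le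
    (Real.exp_le_one_iff.2 (by nlinarith))
  have e3 : Real.exp (-p * δ n) * Real.exp (-α * δ n) = Real.exp (-(p + α) * δ n) := by
    rw [← Real.exp_add]
    congr 1
    ring
  rw [e3, (H.integral_cexp_cpLaw hβ (δ n).coe_nonneg).2] at key
  have e4 : (Real.exp (-(p + α) * δ n) : ℂ) * Complex.exp ((δ n : ℝ) * psi lam β)
      = Complex.exp (-(p + α - psi lam β) * (δ n : ℝ)) := by
    rw [Complex.ofReal_exp, ← Complex.exp_add]
    congr 1
    push_cast
    ring
  rw [e4] at key
  have e5 : (Real.exp (-p * δ n) : ℂ) = Complex.exp (-p * (δ n : ℝ)) := by push_cast; rfl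
  have hn' : 1 - Complex.exp (-(p + α - psi lam β) * (δ n : ℝ)) ≠ 0 := fun h0 => hn (by
    rw [h0, zero_div])
  simp only [Pi.div_apply]
  rw [← mul_right_inj' hn', key, e5, div_div_div_cancel_right₀ hdC, ← mul_assoc,
    mul_div_cancel₀ _ hn', mul_div_assoc]

end IsSkipFreeMeasure

/-- A path that is right-continuous with left limits for the discrete topology on its values. -/
structure IsStepPath (f : ℝ≥0 → ℝ) : Prop where
  right : ∀ t, ∀ᶠ s in 𝓝[≥] t, f s = f t
  left : ∀ t, ∃ l, ∀ᶠ s in 𝓝[<] t, f s = l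

theorem eq_of_lattice {h x y : ℝ} (hx : ∃ k : ℤ, x = h * k) (hy : ∃ k : ℤ, y = h * k)
    (hxy : |x - y| < h) : x = y := by
  obtain ⟨k, rfl⟩ := hx
  obtain ⟨l, rfl⟩ := hy
  have hh : 0 < h := (abs_nonneg _).trans_lt hxy
  rw [← mul_sub, abs_mul, abs_of_pos hh, mul_lt_iff_lt_one_right hh] at hxy
  have : |k - l| < 1 := by exact_mod_cast hxy
  rw [sub_eq_zero.1 (Int.abs_lt_one_iff.1 this)]

theorem isStepPath_of_lattice {f : ℝ≥0 → ℝ} {h : ℝ} (hh : 0 < h)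
    (hf : ∀ t, ContinuousWithinAt f (Ici t) t) (hl : ∀ t, ∃ l, Tendsto f (𝓝[<] t) (𝓝 l))
    (hlat : ∀ t, ∃ k : ℤ, f t = h * k) : IsStepPath f where
  right t := by
    filter_upwards [(hf t).eventually (Metric.ball_mem_nhds (f t) hh)] with s hs
    exact eq_of_lattice (hlat s) (hlat t) hs
  left t := by
    obtain ⟨l, hl⟩ := hl t
    have h1 := hl.eventually (Metric.ball_mem_nhds l (half_pos hh))
    by_cases hn : (𝓝[<] t).NeBot
    · obtain ⟨s₀, hs₀⟩ := h1.exists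
      refine ⟨f s₀, ?_⟩
      filter_upwards [h1] with s hs
      refine eq_of_lattice (hlat s) (hlat s₀) ?_
      rw [← Real.dist_eq]
      calc dist (f s) (f s₀) ≤ dist (f s) l + dist (f s₀) l := dist_triangle_right _ _ _
        _ < h / 2 + h / 2 := add_lt_add hs hs₀
        _ = h := add_halves h
    · rw [not_neBot.1 hn]
      exact ⟨0, eventually_bot⟩

theorem IsStepPath.finite_image {f : ℝ≥0 → ℝ} (hf : IsStepPath f) (t : ℝ≥0) :
    (f '' Iic t).Finite := by
  have hc : IsCompact (Iic t) := by
    rw [← Icc_bot]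
    exact isCompact_Icc
  refine hc.induction_on (p := fun s => (f '' s).Finite) (by simp)
    (fun s u hsu hu => hu.subset (image_mono hsu))
    (fun s u hs hu => by rw [image_union]; exact hs.union hu) fun x _ => ?_
  obtain ⟨l, hl⟩ := hf.left x
  refine ⟨{s | f s = l ∨ f s = f x}, mem_nhdsWithin_of_mem_nhds ?_,
    (toFinite {l, f x}).subset ?_⟩
  · rw [← nhdsLT_sup_nhdsGE, mem_sup]
    exact ⟨hl.mono fun _ => Or.inl, (hf.right x).mono fun _ => Or.inr⟩
  · rintro _ ⟨s, hs, rfl⟩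
    exact hs

theorem tendsto_of_eventually_exists {F : ℕ → ℂ} {Ψ : ℝ → ℂ} {a : ℝ} (hΨ : ContinuousAt Ψ a)
    {δ : ℕ → ℝ≥0} (hlim : Tendsto δ atTop (𝓝 0))
    (hF : ∀ᶠ n in atTop, ∃ u : ℝ, |u - a| ≤ δ n ∧ F n = Ψ u) :
    Tendsto F atTop (𝓝 (Ψ a)) := by
  obtain ⟨u, hu⟩ := hF.choice
  have h1 : Tendsto u atTop (𝓝 a) := by
    rw [tendsto_iff_dist_tendsto_zero]
    refine squeeze_zero' (Eventually.of_forall fun _ => dist_nonneg) (hu.mono fun n hn => hn.1) ?_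
    exact (NNReal.continuous_coe.tendsto 0).comp hlim
  exact (hΨ.tendsto.comp h1).congr' (hu.mono fun n hn => hn.2.symm)

/-- The increments of a path along the grid of mesh `d`. -/
def gridSteps (f : ℝ≥0 → ℝ) (d : ℝ≥0) (i : ℕ) : ℝ := f ((i + 1 : ℕ) * d) - f (i * d)

theorem walk_gridSteps {f : ℝ≥0 → ℝ} (h0 : f 0 = 0) (d : ℝ≥0) (k : ℕ) :
    walk (gridSteps f d) k = f (k * d) := by
  simp only [walk, gridSteps]
  rw [Finset.sum_range_sub (fun i : ℕ => f (i * d)), Nat.cast_zero, zero_mul, h0, sub_zero]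

section Grid

variable {d t : ℝ≥0}

theorem grid_last_gt (hd : 0 < d) (t : ℝ≥0) : t < ((⌊t / d⌋₊ + 1 : ℕ) : ℝ≥0) * d := by
  rw [← div_lt_iff₀ hd]
  exact_mod_cast Nat.lt_floor_add_one (t / d)

theorem grid_le {i : ℕ} (hd : 0 < d) (hi : i ≤ ⌊t / d⌋₊ + 1) : (i : ℝ≥0) * d ≤ t + d := by
  have h1 : (i : ℝ≥0) ≤ t / d + 1 :=
    calc (i : ℝ≥0) ≤ ((⌊t / d⌋₊ + 1 : ℕ) : ℝ≥0) := by exact_mod_cast hi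
      _ ≤ t / d + 1 := by
        push_cast
        gcongr
        exact Nat.floor_le zero_le
  calc (i : ℝ≥0) * d ≤ (t / d + 1) * d := by gcongr
    _ = t + d := by rw [add_mul, div_mul_cancel₀ _ hd.ne', one_mul]

theorem ceil_le_grid {G : ℝ≥0} (hd : 0 < d) (hG : G ≤ t) : ⌈G / d⌉₊ ≤ ⌊t / d⌋₊ + 1 := by
  rw [Nat.ceil_le, div_le_iff₀ hd]
  exact hG.trans (grid_last_gt hd t).le

end Grid

section Path

variable {Ω : Type*} {X : ℝ≥0 → Ω → ℝ} {ω : Ω}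

theorem exists_runSup (hf : IsStepPath fun s => X s ω) (t : ℝ≥0) :
    (∃ s ≤ t, X s ω = runSup X t ω) ∧ ∀ s ≤ t, X s ω ≤ runSup X t ω := by
  have hfin := hf.finite_image t
  refine ⟨?_, fun s hs => le_csSup hfin.bddAbove ⟨s, hs, rfl⟩⟩
  obtain ⟨s, hs, h1⟩ := Set.Nonempty.csSup_mem (nonempty_Iic.image _) hfin
  exact ⟨s, hs, h1⟩

theorem exists_runInf (hf : IsStepPath fun s => X s ω) (t : ℝ≥0) :
    (∃ s ≤ t, X s ω = runInf X t ω) ∧ ∀ s ≤ t, runInf X t ω ≤ X s ω := by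
  have hfin := hf.finite_image t
  refine ⟨?_, fun s hs => csInf_le hfin.bddBelow ⟨s, hs, rfl⟩⟩
  obtain ⟨s, hs, h1⟩ := Set.Nonempty.csInf_mem (nonempty_Iic.image _) hfin
  exact ⟨s, hs, h1⟩

theorem lastMaxTime_spec (hf : IsStepPath fun s => X s ω) (t : ℝ≥0) :
    lastMaxTime X t ω ≤ t ∧ X (lastMaxTime X t ω) ω = runSup X t ω ∧
      ∀ s < lastMaxTime X t ω, X s ω < runSup X t ω := by
  obtain ⟨⟨s₀, hs₀, h0⟩, hle⟩ := exists_runSup hf t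
  set E := {s | s ≤ t ∧ X s ω = runSup X t ω} with hE
  have hne : E.Nonempty := ⟨s₀, hs₀, h0⟩
  have hG : lastMaxTime X t ω = sInf E := rfl
  have hGt : sInf E ≤ t := (csInf_le (OrderBot.bddBelow _) hne.some_mem).trans hne.some_mem.1
  rw [hG]
  refine ⟨hGt, ?_, fun s hs => ?_⟩
  · obtain ⟨s, hs, h1⟩ := (((isGLB_csInf hne (OrderBot.bddBelow _)).frequently_mem
      hne).and_eventually (hf.right (sInf E))).exists
    exact h1.symm.trans hs.2
  · have hst := hs.le.trans hGt
    exact lt_of_le_of_ne (hle s hst) fun h1 =>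
      notMem_of_lt_csInf hs (OrderBot.bddBelow _) ⟨hst, h1⟩

theorem tendsto_maxFun_gridSteps (hf : IsStepPath fun s => X s ω) (h0 : X 0 ω = 0) (t : ℝ≥0)
    {δ : ℕ → ℝ≥0} (hδ : ∀ n, 0 < δ n) (hlim : Tendsto δ atTop (𝓝 0)) (α : ℝ) (γ : ℂ) :
    Tendsto (fun n => maxFun (⌊t / δ n⌋₊ + 1) (Real.exp (-α * δ n)) γ
      (gridSteps (fun s => X s ω) (δ n))) atTop
      (𝓝 (Complex.exp (-α * (lastMaxTime X t ω : ℝ) + γ * (runSup X t ω : ℝ)))) := by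
  obtain ⟨hGt, hG, hlt⟩ := lastMaxTime_spec hf t
  have hle := (exists_runSup hf t).2
  set G := lastMaxTime X t ω
  set M := runSup X t ω
  refine tendsto_of_eventually_exists (Ψ := fun u : ℝ => Complex.exp (-α * u + γ * M))
    (by fun_prop) hlim ?_
  obtain ⟨u, hu, hu'⟩ := mem_nhdsGE_iff_exists_Ico_subset.1 (hf.right G)
  obtain ⟨v, hv, hv'⟩ := mem_nhdsGE_iff_exists_Ico_subset.1 (hf.right t)
  have h1 : ∀ w : ℝ≥0, Tendsto (fun n => w + δ n) atTop (𝓝 w) := fun w => by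
    simpa using hlim.const_add w
  filter_upwards [(h1 G).eventually (gt_mem_nhds hu), (h1 t).eventually (gt_mem_nhds hv)]
    with n hn1 hn2
  have hd := hδ n
  set d := δ n
  set j := ⌈G / d⌉₊ with hj
  have hj1 : G ≤ j * d := (div_le_iff₀ hd).1 (Nat.le_ceil _)
  have hj2 : (j : ℝ≥0) * d < G + d := by
    have h2 : (j : ℝ≥0) < G / d + 1 := Nat.ceil_lt_add_one zero_le
    calc (j : ℝ≥0) * d < (G / d + 1) * d := by gcongr
      _ = G + d := by rw [add_mul, div_mul_cancel₀ _ hd.ne', one_mul]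
  have hXj : X (j * d) ω = M := (hu' ⟨hj1, hj2.trans hn1⟩ : X (j * d) ω = X G ω).trans hG
  have hmem : gridSteps (fun s => X s ω) d ∈ firstMax (⌊t / d⌋₊ + 1) j := by
    refine ⟨fun i hi => ?_, fun i hi => ?_⟩
    · rw [walk_gridSteps h0, walk_gridSteps h0, hXj]
      exact hlt _ ((lt_div_iff₀ hd).1 (Nat.lt_ceil.1 hi))
    · rw [walk_gridSteps h0, walk_gridSteps h0, hXj]
      rcases le_total ((i : ℝ≥0) * d) t with h3 | h3
      · exact hle _ h3
      · have h4 : X (i * d) ω = X t ω := hv' ⟨h3, (grid_le hd hi).trans_lt hn2⟩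
        rw [h4]
        exact hle t le_rfl
  refine ⟨((j : ℝ≥0) * d : ℝ≥0), ?_, ?_⟩
  · rw [abs_le]
    have h2 : (G : ℝ) ≤ ((j : ℝ≥0) * d : ℝ≥0) := by exact_mod_cast hj1
    have h3 : (((j : ℝ≥0) * d : ℝ≥0) : ℝ) < G + d := by exact_mod_cast hj2
    constructor <;> linarith [d.coe_nonneg]
  · rw [maxFun_eq (ceil_le_grid hd hGt) hmem, walk_gridSteps h0, hXj, Complex.ofReal_exp,
      ← Complex.exp_nat_mul, ← Complex.exp_add]
    congr 1
    push_cast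
    ring

theorem lastMinTime_eq (hf : IsStepPath fun s => X s ω) (t : ℝ≥0) :
    lastMinTime X t ω = sSup {s | s ≤ t ∧ X s ω = runInf X t ω} := by
  have hle := (exists_runInf hf t).2
  refine csSup_eq_csSup_of_forall_exists_le ?_ ?_
  · rintro s ⟨hs, h1⟩
    by_cases h2 : ∃ a ∈ {s | s ≤ t ∧ X s ω = runInf X t ω}, s ≤ a
    · exact h2
    · push Not at h2
      obtain ⟨a, ha, h3⟩ := (exists_runInf hf t).1
      refine ⟨s, ⟨hs, le_antisymm ?_ (hle s hs)⟩, le_rfl⟩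
      rw [h1, ← h3]
      exact (exists_runInf hf s).2 a (h2 a ⟨ha, h3⟩).le
  · rintro s ⟨hs, h1⟩
    refine ⟨s, ⟨hs, le_antisymm ?_ ((exists_runInf hf s).2 s le_rfl)⟩, le_rfl⟩
    obtain ⟨a, ha, h3⟩ := (exists_runInf hf s).1
    rw [h1, ← h3]
    exact hle a (ha.trans hs)

theorem tendsto_minFun_gridSteps (hf : IsStepPath fun s => X s ω) (h0 : X 0 ω = 0) (t : ℝ≥0)
    {δ : ℕ → ℝ≥0} (hδ : ∀ n, 0 < δ n) (hlim : Tendsto δ atTop (𝓝 0)) (α : ℝ) (β : ℂ) :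
    Tendsto (fun n => minFun (⌊t / δ n⌋₊ + 1) (Real.exp (-α * δ n)) β
      (gridSteps (fun s => X s ω) (δ n))) atTop
      (𝓝 (Complex.exp (-α * (lastMinTime X t ω : ℝ) + β * (runInf X t ω : ℝ)))) := by
  obtain ⟨⟨a, hat, ha⟩, hle⟩ := exists_runInf hf t
  rw [lastMinTime_eq hf t]
  set A := {s | s ≤ t ∧ X s ω = runInf X t ω}
  set m := runInf X t ω
  have hne : A.Nonempty := ⟨a, hat, ha⟩
  have hbdd : BddAbove A := ⟨t, fun s hs => hs.1⟩
  have hLt : sSup A ≤ t := csSup_le hne fun s hs => hs.1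
  have hA : ∀ s ≤ t, sSup A < s → m < X s ω := fun s hs h1 =>
    lt_of_le_of_ne (hle s hs) fun h2 => h1.not_ge (le_csSup hbdd ⟨hs, h2.symm⟩)
  refine tendsto_of_eventually_exists (Ψ := fun u : ℝ => Complex.exp (-α * u + β * m))
    (by fun_prop) hlim ?_
  obtain ⟨v, hv, hv'⟩ := mem_nhdsGE_iff_exists_Ico_subset.1 (hf.right t)
  have h1 : ∀ w : ℝ≥0, Tendsto (fun n => w + δ n) atTop (𝓝 w) := fun w => by
    simpa using hlim.const_add w
  have hcalc : ∀ (d : ℝ≥0) (j : ℕ), j ≤ ⌊t / d⌋₊ + 1 → X (j * d) ω = m →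
      gridSteps (fun s => X s ω) d ∈ lastMin (⌊t / d⌋₊ + 1) j →
      minFun (⌊t / d⌋₊ + 1) (Real.exp (-α * d)) β (gridSteps (fun s => X s ω) d)
        = Complex.exp (-α * (((j : ℝ≥0) * d : ℝ≥0) : ℝ) + β * m) := by
    intro d j hj hXj hmem
    rw [minFun_eq hj hmem, walk_gridSteps h0, hXj, Complex.ofReal_exp,
      ← Complex.exp_nat_mul, ← Complex.exp_add]
    congr 1
    push_cast
    ring
  by_cases htm : X t ω = m
  · have hL : sSup A = t := le_antisymm hLt (le_csSup hbdd ⟨le_rfl, htm⟩)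
    rw [hL]
    filter_upwards [(h1 t).eventually (gt_mem_nhds hv)] with n hn2
    have hd := hδ n
    set d := δ n
    have hN1 := grid_last_gt hd t
    have hN2 := grid_le (t := t) hd le_rfl
    have hXN : X ((⌊t / d⌋₊ + 1 : ℕ) * d) ω = m :=
      (hv' ⟨hN1.le, hN2.trans_lt hn2⟩ : X ((⌊t / d⌋₊ + 1 : ℕ) * d) ω = X t ω).trans htm
    refine ⟨_, ?_, hcalc d _ le_rfl hXN ?_⟩
    · rw [abs_le]
      have h2 : (t : ℝ) < (((⌊t / d⌋₊ + 1 : ℕ) : ℝ≥0) * d : ℝ≥0) := by exact_mod_cast hN1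
      have h3 : ((((⌊t / d⌋₊ + 1 : ℕ) : ℝ≥0) * d : ℝ≥0) : ℝ) ≤ t + d := by exact_mod_cast hN2
      constructor <;> linarith [d.coe_nonneg]
    · refine ⟨fun i hi => ?_, fun i hi hi' => absurd hi' (by omega)⟩
      rw [walk_gridSteps h0, walk_gridSteps h0, hXN]
      rcases le_total ((i : ℝ≥0) * d) t with h3 | h3
      · exact hle _ h3
      · have h4 : X (i * d) ω = X t ω := hv' ⟨h3, (grid_le hd (by omega)).trans_lt hn2⟩
        rw [h4]
        exact hle t le_rfl
  · have hLm : X (sSup A) ω ≠ m := by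
      intro h2
      have hlt : sSup A < t := lt_of_le_of_ne hLt fun h3 => htm (h3 ▸ h2)
      have h3 : ∀ᶠ s in 𝓝[>] sSup A, X s ω = X (sSup A) ω :=
        (hf.right (sSup A)).filter_mono (nhdsWithin_mono _ Ioi_subset_Ici_self)
      obtain ⟨s, hs1, hs2⟩ := (h3.and (Ioo_mem_nhdsGT hlt)).exists
      exact (hA s hs2.2.le hs2.1).ne' (hs1.trans h2)
    have hneL : ∀ s ∈ A, s < sSup A := fun s hs =>
      lt_of_le_of_ne (le_csSup hbdd hs) fun h2 => hLm (h2 ▸ hs.2)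
    obtain ⟨l, hl⟩ := hf.left (sSup A)
    have hfreq : ∃ᶠ s in 𝓝[<] sSup A, s ∈ A := by
      have h2 := (isLUB_csSup hne hbdd).frequently_mem hne
      rw [frequently_nhdsWithin_iff] at h2 ⊢
      exact h2.mono fun s hs => ⟨hs.1, hneL s hs.1⟩
    obtain ⟨s, hs, hsl⟩ := (hfreq.and_eventually hl).exists
    have hlm : l = m := hsl.symm.trans hs.2
    rw [hlm] at hl
    obtain ⟨u, hu, hu'⟩ := (mem_nhdsLT_iff_exists_Ioo_subset' (hneL s hs)).1 hl
    filter_upwards [(h1 u).eventually (gt_mem_nhds hu), (h1 t).eventually (gt_mem_nhds hv)]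
      with n hn1 hn2
    have hd := hδ n
    set d := δ n
    have hLpos : 0 < sSup A := zero_le.trans_lt (hneL s hs)
    obtain ⟨j, hj⟩ : ∃ j, ⌈sSup A / d⌉₊ = j + 1 :=
      Nat.exists_eq_succ_of_ne_zero (Nat.ceil_pos.2 (div_pos hLpos hd)).ne'
    have hj1 : (j : ℝ≥0) * d < sSup A := (lt_div_iff₀ hd).1 (Nat.lt_ceil.1 (by omega))
    have hj2 : sSup A ≤ ((j + 1 : ℕ) : ℝ≥0) * d := (div_le_iff₀ hd).1 (Nat.ceil_le.1 hj.le)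
    have hj3 : sSup A ≤ (j : ℝ≥0) * d + d := by
      rwa [Nat.cast_succ, add_mul, one_mul] at hj2
    have hju : u < (j : ℝ≥0) * d := lt_of_add_lt_add_right (hn1.trans_le hj3)
    have hXj : X (j * d) ω = m := hu' ⟨hju, hj1⟩
    have hjN : j ≤ ⌊t / d⌋₊ + 1 := by
      have := ceil_le_grid hd hLt
      omega
    refine ⟨_, ?_, hcalc d j hjN hXj ?_⟩
    · rw [abs_le]
      have h2 : (((j : ℝ≥0) * d : ℝ≥0) : ℝ) < sSup A := by exact_mod_cast hj1
      have h3 : ((sSup A : ℝ≥0) : ℝ) ≤ (((j : ℝ≥0) * d : ℝ≥0) : ℝ) + d := by exact_mod_cast hj3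
      constructor <;> linarith [d.coe_nonneg]
    · have hgt : ∀ i, j < i → i ≤ ⌊t / d⌋₊ + 1 → m < X (i * d) ω := by
        intro i hi hi'
        rcases le_total ((i : ℝ≥0) * d) t with h3 | h3
        · have h4 : sSup A ≤ i * d := hj2.trans (by gcongr; omega)
          rcases h4.eq_or_lt with h5 | h5
          · rw [← h5]
            exact lt_of_le_of_ne (hle _ hLt) hLm.symm
          · exact hA _ h3 h5
        · have h4 : X (i * d) ω = X t ω := hv' ⟨h3, (grid_le hd hi').trans_lt hn2⟩
          rw [h4]
          exact lt_of_le_of_ne (hle t le_rfl) (Ne.symm htm)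
      refine ⟨fun i hi => ?_, fun i hi hi' => ?_⟩
      · rw [walk_gridSteps h0, walk_gridSteps h0, hXj]
        rcases lt_or_ge j i with h2 | h2
        · exact (hgt i h2 hi).le
        · exact hle _ ((mul_le_mul_left (by exact_mod_cast h2) d).trans (hj1.le.trans hLt))
      · rw [walk_gridSteps h0, walk_gridSteps h0, hXj]
        exact hgt i hi' hi

end Path

theorem isClosed_lattice {h : ℝ} (hh : 0 < h) : IsClosed {x : ℝ | ∃ k : ℤ, x = h * k} := by
  have h1 : {x : ℝ | ∃ k : ℤ, x = h * k} = (fun x => x / h) ⁻¹' range ((↑) : ℤ → ℝ) := by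
    ext x
    simp only [mem_ofPred_eq, mem_preimage, mem_range]
    refine exists_congr fun k => ?_
    rw [eq_div_iff hh.ne', mul_comm, eq_comm]
  rw [h1]
  exact Int.isClosedEmbedding_coe_real.isClosed_range.preimage (continuous_id.div_const h)

theorem norm_maxFun_le_one {γ : ℂ} (hγ : γ.re ≤ 0) {r : ℝ} (hr0 : 0 ≤ r) (hr1 : r ≤ 1) (m : ℕ)
    (x : ℕ → ℝ) : ‖maxFun m r γ x‖ ≤ 1 := by
  by_cases hx : ∃ j ≤ m, x ∈ firstMax m j
  · obtain ⟨j, hj, hx⟩ := hx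
    rw [maxFun_eq hj hx, norm_mul, norm_pow, Complex.norm_real, Real.norm_eq_abs,
      abs_of_nonneg hr0, Complex.norm_exp]
    refine mul_le_one₀ (pow_le_one₀ hr0 hr1) (Real.exp_pos _).le (Real.exp_le_one_iff.2 ?_)
    simpa using nonpos_of_firstMax hγ x hx
  · push Not at hx
    rw [maxFun, Finset.sum_eq_zero, norm_zero]
    · exact zero_le_one
    · intro q hq
      have := Finset.HasAntidiagonal.mem_antidiagonal.1 hq
      rw [expOn, indicator_of_notMem (hx _ (by omega)), mul_zero]

theorem norm_minFun_le_one {β : ℂ} (hβ : 0 ≤ β.re) {r : ℝ} (hr0 : 0 ≤ r) (hr1 : r ≤ 1) (m : ℕ)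
    (x : ℕ → ℝ) : ‖minFun m r β x‖ ≤ 1 := by
  by_cases hx : ∃ j ≤ m, x ∈ lastMin m j
  · obtain ⟨j, hj, hx⟩ := hx
    rw [minFun_eq hj hx, norm_mul, norm_pow, Complex.norm_real, Real.norm_eq_abs,
      abs_of_nonneg hr0, Complex.norm_exp]
    refine mul_le_one₀ (pow_le_one₀ hr0 hr1) (Real.exp_pos _).le (Real.exp_le_one_iff.2 ?_)
    simpa using nonpos_of_lastMin hβ x hx
  · push Not at hx
    rw [minFun, Finset.sum_eq_zero, norm_zero]
    · exact zero_le_one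
    · intro q hq
      have := Finset.HasAntidiagonal.mem_antidiagonal.1 hq
      rw [expOn, indicator_of_notMem (hx _ (by omega)), mul_zero]

theorem expMeasure_floor_eq {p : ℝ} (hp : 0 < p) {d : ℝ≥0} (hd : 0 < d) (k : ℕ) :
    (expMeasure 1).real {x | ⌊(x / p).toNNReal / d⌋₊ = k}
      = Real.exp (-p * d) ^ k * (1 - Real.exp (-p * d)) := by
  have : IsProbabilityMeasure (expMeasure 1) := isProbabilityMeasure_expMeasure zero_lt_one
  have hd' : (0 : ℝ) < d := NNReal.coe_pos.2 hd
  have hcdf : ∀ x : ℝ, 0 ≤ x → (expMeasure 1).real (Iic x) = 1 - Real.exp (-x) := by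
    intro x hx
    rw [← cdf_eq_real, cdf_expMeasure_eq zero_lt_one, if_pos hx, one_mul]
  have hac : expMeasure 1 ≪ volume := withDensity_absolutelyContinuous _ _
  have hpos : ∀ᵐ x ∂(expMeasure 1), 0 < x := by
    rw [ae_iff]
    have h1 := hcdf 0 le_rfl
    rw [neg_zero, Real.exp_zero, sub_self, measureReal_eq_zero_iff] at h1
    simp only [not_lt]
    exact h1
  have hne : ∀ a : ℝ, ∀ᵐ x ∂(expMeasure 1), x ≠ a := fun a =>
    hac.ae_le (Measure.ae_ne volume a)
  set a : ℝ := k * d * p with ha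
  set b : ℝ := (k + 1 : ℕ) * d * p with hb
  have ha0 : 0 ≤ a := by positivity
  have hab : a ≤ b := by
    rw [ha, hb]
    gcongr
    exact Nat.le_succ k
  have hset : {x | ⌊(x / p).toNNReal / d⌋₊ = k} =ᵐ[expMeasure 1] (Iic b \ Iic a : Set ℝ) := by
    filter_upwards [hpos, hne a, hne b] with x hx hxa hxb
    refine propext ?_
    change ⌊(x / p).toNNReal / d⌋₊ = k ↔ x ≤ b ∧ ¬ x ≤ a
    have hxp : 0 ≤ x / p := by positivity
    rw [Nat.floor_eq_iff zero_le, le_div_iff₀ hd, div_lt_iff₀ hd,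
      Real.le_toNNReal_iff_coe_le hxp, ← NNReal.coe_lt_coe, Real.coe_toNNReal _ hxp,
      div_lt_iff₀ hp, le_div_iff₀ hp, not_le]
    push_cast
    have hb' : b = (k + 1) * d * p := by rw [hb]; push_cast; rfl
    rw [← hb', ← ha]
    constructor
    · rintro ⟨h1, h2⟩
      exact ⟨h2.le, lt_of_le_of_ne h1 hxa.symm⟩
    · rintro ⟨h1, h2⟩
      exact ⟨h2.le, lt_of_le_of_ne h1 hxb⟩
  rw [measureReal_congr hset, measureReal_sdiff (Iic_subset_Iic.2 hab) measurableSet_Iic,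
    hcdf a ha0, hcdf b (ha0.trans hab), ← Real.exp_nat_mul]
  have e1 : -b = k * (-p * d) + -p * d := by rw [hb]; push_cast; ring
  have e2 : -a = k * (-p * d) := by rw [ha]; ring
  rw [e1, e2, Real.exp_add]
  ring

section Chain

variable {Ω : Type*} [MeasurableSpace Ω] {P : Measure Ω} [IsProbabilityMeasure P]
  {X : ℝ≥0 → Ω → ℝ} {lam : Measure ℝ} {h : ℝ}

theorem IsUpwardsSkipFreeLevyChain.ae_lattice [IsFiniteMeasure lam]
    (hX : IsUpwardsSkipFreeLevyChain X lam h P) :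
    ∀ᵐ ω ∂P, ∀ t, ∃ k : ℤ, X t ω = h * k := by
  have H := hX.isSkipFreeMeasure
  obtain ⟨D, hDc, hD⟩ := TopologicalSpace.exists_countable_dense ℝ≥0
  have h1 : ∀ t, ∀ᵐ ω ∂P, ∃ k : ℤ, X t ω = h * k := by
    intro t
    refine ae_of_ae_map (hX.measurable t).aemeasurable (p := fun x => ∃ k : ℤ, x = h * k) ?_
    rw [hX.map_eq_cpLaw t]
    exact H.ae_cpLaw_lattice t
  filter_upwards [(ae_ball_iff hDc).2 fun t _ => h1 t] with ω hω t
  have hmem : t ∈ closure (Ioi t ∩ D) := by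
    have h2 : closure (Ioi t) ⊆ closure (Ioi t ∩ D) :=
      closure_minimal (hD.open_subset_closure_inter isOpen_Ioi) isClosed_closure
    refine h2 ?_
    rw [closure_Ioi]
    exact self_mem_Ici
  have h3 : ContinuousWithinAt (fun s => X s ω) (Ioi t ∩ D) t :=
    (hX.rightCts ω t).mono (inter_subset_left.trans Ioi_subset_Ici_self)
  have h4 := h3.mem_closure_image hmem
  refine closure_minimal ?_ (isClosed_lattice hX.h_pos) h4
  rintro _ ⟨s, hs, rfl⟩
  exact hω s hs.2

theorem IsUpwardsSkipFreeLevyChain.ae_isStepPath [IsFiniteMeasure lam]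
    (hX : IsUpwardsSkipFreeLevyChain X lam h P) :
    ∀ᵐ ω ∂P, IsStepPath (fun s => X s ω) := by
  filter_upwards [hX.ae_lattice] with ω hω
  exact isStepPath_of_lattice hX.h_pos (hX.rightCts ω) (hX.leftLim ω) hω

theorem measurable_gridSteps (d : ℝ≥0) : Measurable fun f : ℝ≥0 → ℝ => gridSteps f d := by
  unfold gridSteps
  fun_prop

theorem IsUpwardsSkipFreeLevyChain.map_gridSteps [IsFiniteMeasure lam]
    (hX : IsUpwardsSkipFreeLevyChain X lam h P) (d : ℝ≥0) :
    P.map (fun ω => gridSteps (fun s => X s ω) d) = stepLaw (cpLaw lam d) := by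
  have hmono : Monotone fun i : ℕ => (i : ℝ≥0) * d := fun i j hij => by
    change (i : ℝ≥0) * d ≤ j * d
    gcongr
  have h1 := (hX.indep.nat hmono).map_fun_eq_infinitePi_map₀' fun i =>
    ((hX.measurable _).sub (hX.measurable _)).aemeasurable
  have h2 : ∀ i : ℕ, P.map (fun ω => X (((i + 1 : ℕ) : ℝ≥0) * d) ω - X (i * d) ω)
      = cpLaw lam d := by
    intro i
    have e : ((i + 1 : ℕ) : ℝ≥0) * d = i * d + d := by rw [Nat.cast_succ, add_mul, one_mul]
    rw [e, (hX.stationary (i * d) d).map_eq, hX.map_eq_cpLaw]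
  refine h1.trans ?_
  rw [stepLaw]
  congr 1
  ext1 i
  exact h2 i

variable [IsFiniteMeasure lam] {e : Ω → ℝ} {p : ℝ}

/-- Expectations of functionals of the grid up to an independent exponential time. -/
theorem integral_gridSteps_floor (hX : IsUpwardsSkipFreeLevyChain X lam h P)
    (he : HasLaw e (expMeasure 1) P) (hind : IndepFun (fun ω t => X t ω) e P) (hp : 0 < p)
    {d : ℝ≥0} (hd : 0 < d) {F : ℕ → (ℕ → ℝ) → ℂ} (hF : ∀ m, Measurable (F m))
    (hF1 : ∀ m x, ‖F m x‖ ≤ 1) :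
    AEStronglyMeasurable (fun ω => F (⌊(e ω / p).toNNReal / d⌋₊ + 1)
      (gridSteps (fun s => X s ω) d)) P ∧
    ∫ ω, F (⌊(e ω / p).toNNReal / d⌋₊ + 1) (gridSteps (fun s => X s ω) d) ∂P
      = (1 - (Real.exp (-p * d) : ℂ))
        * genFun (fun m => ∫ x, F (m + 1) x ∂(stepLaw (cpLaw lam d))) (Real.exp (-p * d)) := by
  have : IsProbabilityMeasure (expMeasure 1) := isProbabilityMeasure_expMeasure zero_lt_one
  have hKm : Measurable fun x : ℝ => ⌊(x / p).toNNReal / d⌋₊ := by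
    refine Nat.measurable_floor.comp ?_
    fun_prop
  have hWm : Measurable fun ω => gridSteps (fun s => X s ω) d :=
    (measurable_gridSteps d).comp (measurable_pi_lambda _ hX.measurable)
  have hKe : AEMeasurable (fun ω => ⌊(e ω / p).toNNReal / d⌋₊) P :=
    hKm.comp_aemeasurable he.aemeasurable
  have hind' : IndepFun (fun ω => gridSteps (fun s => X s ω) d)
      (fun ω => ⌊(e ω / p).toNNReal / d⌋₊) P := hind.comp (measurable_gridSteps d) hKm
  have hG : Measurable fun q : (ℕ → ℝ) × ℕ => F (q.2 + 1) q.1 :=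
    measurable_from_prod_countable_left fun k => hF (k + 1)
  have hjoint := (indepFun_iff_map_prod_eq_prod_map_map hWm.aemeasurable hKe).1 hind'
  rw [hX.map_gridSteps] at hjoint
  have hlaw : ∀ k : ℕ, (P.map fun ω => ⌊(e ω / p).toNNReal / d⌋₊).real {k}
      = Real.exp (-p * d) ^ k * (1 - Real.exp (-p * d)) := by
    intro k
    rw [← expMeasure_floor_eq hp hd k, map_measureReal_apply_of_aemeasurable hKe
      (measurableSet_singleton k), ← he.map_eq]
    exact (map_measureReal_apply_of_aemeasurable he.aemeasurable
      (hKm (measurableSet_singleton k))).symm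
  have := Measure.isProbabilityMeasure_map hKe
  have hint : ∀ ν : Measure ℕ, IsProbabilityMeasure ν →
      Integrable (fun q : (ℕ → ℝ) × ℕ => F (q.2 + 1) q.1) ((stepLaw (cpLaw lam d)).prod ν) :=
    fun ν _ => Integrable.of_bound hG.aestronglyMeasurable 1 (ae_of_all _ fun q => hF1 _ _)
  refine ⟨(hG.comp_aemeasurable (hWm.aemeasurable.prodMk hKe)).aestronglyMeasurable, ?_⟩
  have h1 := integral_map (hWm.aemeasurable.prodMk hKe) (hG.aestronglyMeasurable)
  refine h1.symm.trans ?_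
  rw [hjoint, integral_prod_symm _ (hint _ this),
    integral_countable (hint _ this).integral_prod_right, genFun, ← tsum_mul_left]
  refine tsum_congr fun k => ?_
  rw [hlaw, Complex.real_smul]
  push_cast
  ring

theorem integrable_of_grid (hX : IsUpwardsSkipFreeLevyChain X lam h P)
    (he : HasLaw e (expMeasure 1) P) (hind : IndepFun (fun ω t => X t ω) e P) (hp : 0 < p)
    {δ : ℕ → ℝ≥0} (hδ : ∀ n, 0 < δ n) {F : ℕ → ℕ → (ℕ → ℝ) → ℂ} (hF : ∀ n m, Measurable (F n m))
    (hF1 : ∀ n m x, ‖F n m x‖ ≤ 1) {Z : Ω → ℂ}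
    (hZ : ∀ᵐ ω ∂P, Tendsto (fun n => F n (⌊(e ω / p).toNNReal / δ n⌋₊ + 1)
      (gridSteps (fun s => X s ω) (δ n))) atTop (𝓝 (Z ω))) :
    Integrable Z P := by
  have h1 := fun n => (integral_gridSteps_floor hX he hind hp (hδ n) (hF n) (hF1 n)).1
  refine Integrable.of_bound (aestronglyMeasurable_of_tendsto_ae _ h1 hZ) 1 ?_
  filter_upwards [hZ] with ω hω
  exact le_of_tendsto hω.norm (Eventually.of_forall fun n => hF1 _ _ _)

theorem integral_eq_of_grid (hX : IsUpwardsSkipFreeLevyChain X lam h P)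
    (he : HasLaw e (expMeasure 1) P) (hind : IndepFun (fun ω t => X t ω) e P) (hp : 0 < p)
    {δ : ℕ → ℝ≥0} (hδ : ∀ n, 0 < δ n) (hlim : Tendsto δ atTop (𝓝 0))
    {F : ℕ → ℕ → (ℕ → ℝ) → ℂ} (hF : ∀ n m, Measurable (F n m))
    (hF1 : ∀ n m x, ‖F n m x‖ ≤ 1) {Z : Ω → ℂ}
    (hZ : ∀ᵐ ω ∂P, Tendsto (fun n => F n (⌊(e ω / p).toNNReal / δ n⌋₊ + 1)
      (gridSteps (fun s => X s ω) (δ n))) atTop (𝓝 (Z ω))) {c : ℂ}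
    (hc : Tendsto (fun n => (1 - (Real.exp (-p * δ n) : ℂ))
      * genFun (fun m => ∫ x, F n m x ∂(stepLaw (cpLaw lam (δ n)))) (Real.exp (-p * δ n)))
      atTop (𝓝 c)) :
    ∫ ω, Z ω ∂P = c := by
  have h1 := fun n => integral_gridSteps_floor hX he hind hp (hδ n) (hF n) (hF1 n)
  have h2 := tendsto_integral_of_dominated_convergence (fun _ => 1) (fun n => (h1 n).1)
    (integrable_const 1) (fun n => ae_of_all _ fun ω => hF1 n _ _) hZ
  refine tendsto_nhds_unique h2 ?_
  have hδ0 : Tendsto (fun n => (δ n : ℝ)) atTop (𝓝 0) :=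
    (NNReal.continuous_coe.tendsto 0).comp hlim
  have hs : Tendsto (fun n => (Real.exp (-p * δ n) : ℂ)) atTop (𝓝 1) := by
    have h3 : Continuous fun x : ℝ => (Real.exp (-p * x) : ℂ) := by fun_prop
    have h4 := (h3.tendsto 0).comp hδ0
    rw [mul_zero, Real.exp_zero, Complex.ofReal_one] at h4
    exact h4
  have hA : ∀ n m, ‖∫ x, F n m x ∂(stepLaw (cpLaw lam (δ n)))‖ ≤ 1 := by
    intro n m
    have := norm_integral_le_of_norm_le_const (μ := stepLaw (cpLaw lam (δ n)))
      (ae_of_all _ fun x => hF1 n m x)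
    simpa using this
  have h0 : Tendsto (fun n => (1 - (Real.exp (-p * δ n) : ℂ))
      * ∫ x, F n 0 x ∂(stepLaw (cpLaw lam (δ n)))) atTop (𝓝 0) := by
    have h3 : Tendsto (fun n => ‖1 - (Real.exp (-p * δ n) : ℂ)‖) atTop (𝓝 0) := by
      simpa using (hs.const_sub 1).norm
    refine squeeze_zero_norm (fun n => ?_) h3
    rw [norm_mul]
    exact mul_le_of_le_one_right (norm_nonneg _) (hA n 0)
  have h5 := (hc.sub h0).div hs one_ne_zero
  rw [sub_zero, div_one] at h5
  refine h5.congr fun n => ?_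
  have hd : (0 : ℝ) < δ n := NNReal.coe_pos.2 (hδ n)
  have hs1 : Real.exp (-p * δ n) < 1 := Real.exp_lt_one_iff.2 (by nlinarith)
  have hne : (Real.exp (-p * δ n) : ℂ) ≠ 0 := Complex.ofReal_ne_zero.2 (Real.exp_pos _).ne'
  rw [(h1 n).2]
  simp only [Pi.div_apply]
  rw [genFun_eq_add (hA n) (Real.exp_pos _).le hs1, div_eq_iff hne]
  ring

end Chain

namespace IsUpwardsSkipFreeLevyChain

variable {Ω : Type*} [MeasurableSpace Ω] {P : Measure Ω} [IsProbabilityMeasure P]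
  {X : ℝ≥0 → Ω → ℝ} {lam : Measure ℝ} {h : ℝ} {e : Ω → ℝ} {p α : ℝ}

theorem tendsto_mesh : Tendsto (fun n : ℕ => 1 / ((n : ℝ≥0) + 1)) atTop (𝓝 0) := by
  rw [← NNReal.tendsto_coe]
  simpa using tendsto_one_div_add_atTop_nhds_zero_nat (𝕜 := ℝ)

theorem mesh_pos (n : ℕ) : 0 < 1 / ((n : ℝ≥0) + 1) := by positivity

theorem mesh_le_one (n : ℕ) : 1 / ((n : ℝ≥0) + 1) ≤ 1 :=
  div_le_one_of_le₀ (by simp) zero_le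

theorem exp_mesh_le_one (hα : 0 ≤ α) (d : ℝ≥0) : Real.exp (-α * d) ≤ 1 :=
  Real.exp_le_one_iff.2 (by nlinarith [d.coe_nonneg])

/-- The ascending Wiener–Hopf factor. -/
theorem integral_max (hX : IsUpwardsSkipFreeLevyChain X lam h P)
    (he : HasLaw e (expMeasure 1) P) (hind : IndepFun (fun ω t => X t ω) e P) (hp : 0 < p)
    (hα : 0 ≤ α) {β : ℂ} (hβ : 0 ≤ β.re) :
    Integrable (fun ω => Complex.exp (-α * (lastMaxTime X (e ω / p).toNNReal ω : ℝ)
      - β * (runSup X (e ω / p).toNNReal ω : ℝ))) P ∧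
    ∫ ω, Complex.exp (-α * (lastMaxTime X (e ω / p).toNNReal ω : ℝ)
      - β * (runSup X (e ω / p).toNNReal ω : ℝ)) ∂P
      = (1 - Complex.exp (-(Phi lam p) * h)) / (1 - Complex.exp (-(β + Phi lam (p + α)) * h)) := by
  have := hX.finite
  have hγ : (-β).re ≤ 0 := by simpa using hβ
  have hZ : ∀ᵐ ω ∂P, Tendsto (fun n : ℕ => maxFun
      (⌊(e ω / p).toNNReal / (1 / ((n : ℝ≥0) + 1))⌋₊ + 1)
      (Real.exp (-α * (1 / ((n : ℝ≥0) + 1) : ℝ≥0))) (-β)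
      (gridSteps (fun s => X s ω) (1 / ((n : ℝ≥0) + 1)))) atTop
      (𝓝 (Complex.exp (-α * (lastMaxTime X (e ω / p).toNNReal ω : ℝ)
        - β * (runSup X (e ω / p).toNNReal ω : ℝ)))) := by
    filter_upwards [hX.ae_isStepPath, hX.zero] with ω hω h0
    have := tendsto_maxFun_gridSteps hω h0 (e ω / p).toNNReal mesh_pos tendsto_mesh α (-β)
    rwa [neg_mul β, ← sub_eq_add_neg] at this
  exact ⟨integrable_of_grid hX he hind hp mesh_pos
      (F := fun n m => maxFun m (Real.exp (-α * (1 / ((n : ℝ≥0) + 1) : ℝ≥0))) (-β))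
      (fun _ _ => measurable_maxFun _ _ _)
      (fun _ _ _ => norm_maxFun_le_one hγ (Real.exp_pos _).le (exp_mesh_le_one hα _) _ _) hZ,
    integral_eq_of_grid hX he hind hp mesh_pos tendsto_mesh
      (F := fun n m => maxFun m (Real.exp (-α * (1 / ((n : ℝ≥0) + 1) : ℝ≥0))) (-β))
      (fun _ _ => measurable_maxFun _ _ _)
      (fun _ _ _ => norm_maxFun_le_one hγ (Real.exp_pos _).le (exp_mesh_le_one hα _) _ _) hZ
      (hX.isSkipFreeMeasure.tendsto_genFun_maxFun mesh_pos mesh_le_one tendsto_mesh hp hα hβ)⟩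

/-- The descending Wiener–Hopf factor. -/
theorem integral_min (hX : IsUpwardsSkipFreeLevyChain X lam h P)
    (he : HasLaw e (expMeasure 1) P) (hind : IndepFun (fun ω t => X t ω) e P) (hp : 0 < p)
    (hα : 0 ≤ α) {β : ℂ} (hβ : 0 ≤ β.re) :
    Integrable (fun ω => Complex.exp (-α * (lastMinTime X (e ω / p).toNNReal ω : ℝ)
      + β * (runInf X (e ω / p).toNNReal ω : ℝ))) P ∧
    ((p : ℂ) + α ≠ psi lam β →
      ∫ ω, Complex.exp (-α * (lastMinTime X (e ω / p).toNNReal ω : ℝ)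
        + β * (runInf X (e ω / p).toNNReal ω : ℝ)) ∂P
        = p / (p + α - psi lam β) * ((1 - Complex.exp ((β - Phi lam (p + α)) * h))
          / (1 - Complex.exp (-(Phi lam p) * h)))) := by
  have := hX.finite
  have hZ : ∀ᵐ ω ∂P, Tendsto (fun n : ℕ => minFun
      (⌊(e ω / p).toNNReal / (1 / ((n : ℝ≥0) + 1))⌋₊ + 1)
      (Real.exp (-α * (1 / ((n : ℝ≥0) + 1) : ℝ≥0))) β
      (gridSteps (fun s => X s ω) (1 / ((n : ℝ≥0) + 1)))) atTop
      (𝓝 (Complex.exp (-α * (lastMinTime X (e ω / p).toNNReal ω : ℝ)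
        + β * (runInf X (e ω / p).toNNReal ω : ℝ)))) := by
    filter_upwards [hX.ae_isStepPath, hX.zero] with ω hω h0
    exact tendsto_minFun_gridSteps hω h0 (e ω / p).toNNReal mesh_pos tendsto_mesh α β
  exact ⟨integrable_of_grid hX he hind hp mesh_pos
      (F := fun n m => minFun m (Real.exp (-α * (1 / ((n : ℝ≥0) + 1) : ℝ≥0))) β)
      (fun _ _ => measurable_minFun _ _ _)
      (fun _ _ _ => norm_minFun_le_one hβ (Real.exp_pos _).le (exp_mesh_le_one hα _) _ _) hZ,
    fun hne => integral_eq_of_grid hX he hind hp mesh_pos tendsto_mesh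
      (F := fun n m => minFun m (Real.exp (-α * (1 / ((n : ℝ≥0) + 1) : ℝ≥0))) β)
      (fun _ _ => measurable_minFun _ _ _)
      (fun _ _ _ => norm_minFun_le_one hβ (Real.exp_pos _).le (exp_mesh_le_one hα _) _ _) hZ
      (hX.isSkipFreeMeasure.tendsto_genFun_minFun mesh_pos mesh_le_one tendsto_mesh hp hα hβ hne)⟩

/-- The descending Wiener–Hopf factor at the zero of its denominator. -/
theorem integral_min_Phi (hX : IsUpwardsSkipFreeLevyChain X lam h P)
    (he : HasLaw e (expMeasure 1) P) (hind : IndepFun (fun ω t => X t ω) e P) (hp : 0 < p)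
    (hα : 0 ≤ α) :
    ∫ ω, Complex.exp (-α * (lastMinTime X (e ω / p).toNNReal ω : ℝ)
      + Phi lam (p + α) * (runInf X (e ω / p).toNNReal ω : ℝ)) ∂P
      = ((p * h / (deriv (psiReal lam) (Phi lam (p + α)) * (1 - Real.exp (-(Phi lam p) * h))) : ℝ)
        : ℂ) := by
  have := hX.finite
  have H := hX.isSkipFreeMeasure
  have hpα : 0 < p + α := by linarith
  have hΦ := H.Phi_pos hpα
  set b := Phi lam (p + α) with hb
  have hInf : ∀ᵐ ω ∂P, ∀ t, runInf X t ω ≤ 0 := by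
    filter_upwards [hX.ae_isStepPath, hX.zero] with ω hω h0 t
    rw [← h0]
    exact (exists_runInf hω t).2 0 zero_le
  have hpos : ∀ᶠ x : ℝ in 𝓝[≠] b, 0 < x := mem_nhdsWithin_of_mem_nhds (lt_mem_nhds hΦ)
  have h1 : Tendsto (fun x : ℝ => ∫ ω, Complex.exp
      (-α * (lastMinTime X (e ω / p).toNNReal ω : ℝ)
        + x * (runInf X (e ω / p).toNNReal ω : ℝ)) ∂P) (𝓝[≠] b)
      (𝓝 (∫ ω, Complex.exp (-α * (lastMinTime X (e ω / p).toNNReal ω : ℝ)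
        + b * (runInf X (e ω / p).toNNReal ω : ℝ)) ∂P)) := by
    refine tendsto_integral_filter_of_dominated_convergence (fun _ => 1) ?_ ?_
      (integrable_const 1) ?_
    · filter_upwards [hpos] with x hx
      exact (hX.integral_min he hind hp hα (β := x) (by simpa using hx.le)).1.aestronglyMeasurable
    · filter_upwards [hpos] with x hx
      filter_upwards [hInf] with ω hω
      rw [Complex.norm_exp]
      refine Real.exp_le_one_iff.2 ?_
      have h2 := hω (e ω / p).toNNReal
      have h3 : (0 : ℝ) ≤ lastMinTime X (e ω / p).toNNReal ω := NNReal.coe_nonneg _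
      simp only [Complex.add_re, Complex.mul_re, Complex.neg_re, Complex.neg_im,
        Complex.ofReal_re, Complex.ofReal_im, mul_zero, sub_zero]
      nlinarith [mul_nonneg hα h3, mul_nonneg hx.le (neg_nonneg.2 h2)]
    · refine ae_of_all _ fun ω => tendsto_nhdsWithin_of_tendsto_nhds ?_
      have hc : Continuous fun x : ℝ => Complex.exp
          (-α * (lastMinTime X (e ω / p).toNNReal ω : ℝ)
            + x * (runInf X (e ω / p).toNNReal ω : ℝ)) := by fun_prop
      exact hc.tendsto b
  have h2 := (H.tendsto_slope_quotient hpα).const_mul (p / (1 - Real.exp (-(Phi lam p) * h)))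
  have h3 := (Complex.continuous_ofReal.tendsto _).comp h2
  refine (tendsto_nhds_unique h1 (h3.congr' ?_)).trans ?_
  · filter_upwards [self_mem_nhdsWithin, hpos] with x hx hx0
    have hne : (p : ℂ) + α ≠ psi lam x := by
      rw [psi_ofReal]
      intro h0
      exact hx ((H.eq_Phi_iff hpα x).1 ⟨hx0, by exact_mod_cast h0.symm⟩)
    rw [(hX.integral_min he hind hp hα (β := x) (by simpa using hx0.le)).2 hne, psi_ofReal]
    simp only [Function.comp_apply]
    push_cast
    ring
  · congr 1
    rw [div_mul_div_comm, mul_comm (deriv _ _)]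

theorem ascIntegrand_eq (hX : IsUpwardsSkipFreeLevyChain X lam h P) (α β : ℂ) {t : ℝ}
    (ht : t ∈ Ioi (0 : ℝ)) : ascIntegrand X P α β t = ∫ x in Ioi (0 : ℝ),
      (Complex.exp (-t) - Complex.exp (-α * t - β * x)) / t ∂(cpLaw lam t) := by
  rw [ascIntegrand, hX.map_eq_cpLaw, Real.coe_toNNReal _ (le_of_lt ht)]

theorem descIntegrand_eq (hX : IsUpwardsSkipFreeLevyChain X lam h P) (α β : ℂ) {t : ℝ}
    (ht : t ∈ Ioi (0 : ℝ)) : descIntegrand X P α β t = ∫ x in Iic (0 : ℝ),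
      (Complex.exp (-t) - Complex.exp (-α * t + β * x)) / t ∂(cpLaw lam t) := by
  rw [descIntegrand, hX.map_eq_cpLaw, Real.coe_toNNReal _ (le_of_lt ht)]

theorem kappaStar_eq (hX : IsUpwardsSkipFreeLevyChain X lam h P) (c : ℝ) (hα : 0 < α) {β : ℂ}
    (hβ : 0 ≤ β.re) :
    IntegrableOn (ascIntegrand X P α β) (Ioi 0) ∧ kappaStar c X P α β
      = ((c / (1 - Real.exp (-Phi lam 1 * h)) : ℝ) : ℂ)
        * (1 - Complex.exp (-(β + Phi lam α) * h)) := by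
  have := hX.finite
  have h1 := hX.isSkipFreeMeasure.ascending_exponent hα hβ
  refine ⟨h1.1.congr_fun (fun t ht => (hX.ascIntegrand_eq _ _ ht).symm) measurableSet_Ioi, ?_⟩
  rw [kappaStar, setIntegral_congr_fun measurableSet_Ioi fun t ht => hX.ascIntegrand_eq _ _ ht,
    h1.2]
  push_cast
  ring

theorem kappaHat_eq_descExponent (hX : IsUpwardsSkipFreeLevyChain X lam h P) (c : ℝ) (β : ℂ) :
    kappaHat c X P α β = c * Complex.exp (IsSkipFreeMeasure.descExponent lam α β) := by
  rw [kappaHat, setIntegral_congr_fun measurableSet_Ioi fun t ht => hX.descIntegrand_eq _ _ ht,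
    IsSkipFreeMeasure.descExponent]

theorem kappaHat_eq (hX : IsUpwardsSkipFreeLevyChain X lam h P) (c : ℝ) (hα : 0 < α) {β : ℂ}
    (hβ : 0 ≤ β.re) :
    IntegrableOn (descIntegrand X P α β) (Ioi 0) ∧ ((α : ℂ) ≠ psi lam β → kappaHat c X P α β
      = ((c * (1 - Real.exp (-Phi lam 1 * h)) : ℝ) : ℂ)
        * ((α - psi lam β) / (1 - Complex.exp ((β - Phi lam α) * h)))) := by
  have := hX.finite
  have H := hX.isSkipFreeMeasure
  refine ⟨(H.descExponent_decomp hα hβ).1.congr_fun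
    (fun t ht => (hX.descIntegrand_eq _ _ ht).symm) measurableSet_Ioi, fun hne => ?_⟩
  rw [hX.kappaHat_eq_descExponent, (H.exp_descExponent_of_ne hα hβ hne).2]
  push_cast
  ring

theorem kappaHat_Phi (hX : IsUpwardsSkipFreeLevyChain X lam h P) (c : ℝ) (hα : 0 < α) :
    kappaHat c X P α (Phi lam α) = ((c * (1 - Real.exp (-Phi lam 1 * h))
      * deriv (psiReal lam) (Phi lam α) / h : ℝ) : ℂ) := by
  have := hX.finite
  rw [hX.kappaHat_eq_descExponent, hX.isSkipFreeMeasure.exp_descExponent_Phi hα]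
  push_cast
  ring

end IsUpwardsSkipFreeLevyChain

end SkipFree

end

open SkipFree in
theorem mainTheorem7 {Ω : Type*} [MeasurableSpace Ω] (P : Measure Ω) [IsProbabilityMeasure P]
    (X : ℝ≥0 → Ω → ℝ) (lam : Measure ℝ) (h : ℝ)
    (hX : IsUpwardsSkipFreeLevyChain X lam h P) :
    -- the Wiener-Hopf factors at `T ω = e ω / p`, an independent exponential time of rate `p`
    (∀ e : Ω → ℝ, HasLaw e (expMeasure 1) P → IndepFun (fun ω t => X t ω) e P →
      ∀ p : ℝ, 0 < p → ∀ T : Ω → ℝ≥0, T = (fun ω => (e ω / p).toNNReal) →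
      ∀ α : ℝ, 0 ≤ α →
        (∀ β : ℂ, 0 ≤ β.re →
          Integrable (fun ω => Complex.exp
            (-α * (lastMaxTime X (T ω) ω : ℝ) - β * (runSup X (T ω) ω : ℝ))) P ∧
          ∫ ω, Complex.exp
            (-α * (lastMaxTime X (T ω) ω : ℝ) - β * (runSup X (T ω) ω : ℝ)) ∂P
            = (1 - Complex.exp (-(Phi lam p) * h))
              / (1 - Complex.exp (-(β + Phi lam (p + α)) * h))) ∧
        (∀ β : ℂ, 0 ≤ β.re →
          Integrable (fun ω => Complex.exp
            (-α * (lastMinTime X (T ω) ω : ℝ) + β * (runInf X (T ω) ω : ℝ))) P ∧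
          ((p : ℂ) + α ≠ psi lam β →
            ∫ ω, Complex.exp
              (-α * (lastMinTime X (T ω) ω : ℝ) + β * (runInf X (T ω) ω : ℝ)) ∂P
              = p / (p + α - psi lam β)
                * ((1 - Complex.exp ((β - Phi lam (p + α)) * h))
                  / (1 - Complex.exp (-(Phi lam p) * h))))) ∧
        (∀ β₀ : ℝ, (0 < β₀ ∧ psiReal lam β₀ = p + α) ↔ β₀ = Phi lam (p + α)) ∧
        (∀ β₀ : ℝ, β₀ = Phi lam (p + α) →
          DifferentiableAt ℝ (psiReal lam) β₀ ∧ 0 < deriv (psiReal lam) β₀ ∧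
          DifferentiableAt ℝ (Phi lam) (p + α) ∧
          ∫ ω, Complex.exp
            (-α * (lastMinTime X (T ω) ω : ℝ) + β₀ * (runInf X (T ω) ω : ℝ)) ∂P
            = ((p * h / (deriv (psiReal lam) β₀ * (1 - Real.exp (-(Phi lam p) * h))) : ℝ) : ℂ) ∧
          p * h / (deriv (psiReal lam) β₀ * (1 - Real.exp (-(Phi lam p) * h)))
            = p * h * deriv (Phi lam) (p + α) / (1 - Real.exp (-(Phi lam p) * h)))) ∧
    -- the ladder exponents
    (∀ cStar cHat : ℝ, 0 < cStar → 0 < cHat → ∃ kStar kHat : ℝ, 0 < kStar ∧ 0 < kHat ∧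
      ∀ α : ℝ, 0 < α →
        (∀ β : ℂ, 0 ≤ β.re →
          MeasureTheory.IntegrableOn (ascIntegrand X P α β) (Set.Ioi 0) ∧
          kappaStar cStar X P α β
            = kStar * (1 - Complex.exp (-(β + Phi lam α) * h))) ∧
        (∀ β : ℂ, 0 ≤ β.re →
          MeasureTheory.IntegrableOn (descIntegrand X P α β) (Set.Ioi 0) ∧
          ((α : ℂ) ≠ psi lam β →
            kappaHat cHat X P α β
              = kHat * ((α - psi lam β) / (1 - Complex.exp ((β - Phi lam α) * h))))) ∧
        (∀ β₀ : ℝ, (0 < β₀ ∧ psiReal lam β₀ = α) ↔ β₀ = Phi lam α) ∧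
        (∀ β₀ : ℝ, β₀ = Phi lam α →
          DifferentiableAt ℝ (psiReal lam) β₀ ∧ 0 < deriv (psiReal lam) β₀ ∧
          DifferentiableAt ℝ (Phi lam) α ∧
          kappaHat cHat X P α β₀
            = ((kHat * deriv (psiReal lam) β₀ / h : ℝ) : ℂ) ∧
          kHat * deriv (psiReal lam) β₀ / h = kHat / (h * deriv (Phi lam) α))) := by
  have := hX.finite
  have H := hX.isSkipFreeMeasure
  refine ⟨fun e he hind p hp T hT α hα => ?_, fun cStar cHat hcS hcH => ?_⟩
  · subst hT
    have hpα : 0 < p + α := by linarith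
    refine ⟨fun β hβ => hX.integral_max he hind hp hα hβ,
      fun β hβ => hX.integral_min he hind hp hα hβ, H.eq_Phi_iff hpα, ?_⟩
    rintro _ rfl
    refine ⟨(H.hasStrictDerivAt_psiReal (H.Phi_pos hpα)).hasDerivAt.differentiableAt,
      H.deriv_psiReal_pos hpα, (H.hasDerivAt_Phi hpα).differentiableAt,
      hX.integral_min_Phi he hind hp hα, ?_⟩
    rw [(H.hasDerivAt_Phi hpα).deriv, ← div_div, div_eq_mul_inv (p * h)]
  · have hd : 0 < 1 - Real.exp (-Phi lam 1 * h) := by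
      have := mul_pos (H.Phi_pos one_pos) H.h_pos
      rw [sub_pos, Real.exp_lt_one_iff]
      linarith
    refine ⟨cStar / (1 - Real.exp (-Phi lam 1 * h)), cHat * (1 - Real.exp (-Phi lam 1 * h)),
      div_pos hcS hd, mul_pos hcH hd, fun α hα => ⟨fun β hβ => hX.kappaStar_eq cStar hα hβ,
        fun β hβ => hX.kappaHat_eq cHat hα hβ, H.eq_Phi_iff hα, ?_⟩⟩
    rintro _ rfl
    refine ⟨(H.hasStrictDerivAt_psiReal (H.Phi_pos hα)).hasDerivAt.differentiableAt,
      H.deriv_psiReal_pos hα, (H.hasDerivAt_Phi hα).differentiableAt,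
      hX.kappaHat_Phi cHat hα, ?_⟩
    rw [(H.hasDerivAt_Phi hα).deriv, ← div_div, div_inv_eq_mul, div_mul_eq_mul_div]
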